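/- Let $m,n,u,v\ge 0$ be integers with $m+n>0$ and $u+v>0$. **Notation.** Let $\mathbf B_{m|n}=\{\overline m<\overline{m-1}<\dots<\overline 1<1<2<\dots<n\}$, with $|b|=0$ for barred and $|b|=1$ for unbarred $b$. Let $P_{m|n}=\bigoplus_b\mathbb Z\epsilon_b$ with $(\epsilon_b,\epsilon_{b'})=(-1)^{|b|}\delta_{bb'}$, simple roots $\alpha_{\overline k}=\epsilon_{\overline{k+1}}-\epsilon_{\overline k}$ ($1\le k<m$), $\alpha_0=\epsilon_{\overline 1}-\epsilon_1$ (if $m,n>0$), $\alpha_l=\epsilon_l-\epsilon_{l+1}$ ($1\le l<n$), and $\langle h_i,\lambda\rangle=(\alpha_i,\lambda)$ for $i=\overline k,0$, $\langle h_l,\lambda\rangle=-(\alpha_l,\lambda)$ for $1\le l<n$; $I_{m|n}$ is the set of indices. A $\mathfrak{gl}_{m|n}$-crystal is a set $B$ with maps $\mathrm{wt}:B\to P_{m|n}$, $\varepsilon_i,\varphi_i:B\to\mathbb Z_{\ge0}$, $e_i,f_i:B\to B\cup\{0\}$ ($i\in I_{m|n}$) such that $\varphi_i-\varepsilon_i=\langle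 h_i,\mathrm{wt}\rangle$ for $i\ne0$; $\langle h_0,\mathrm{wt}\rangle\ge0$, and $\varphi_0+\varepsilon_0$ is $0$ where $\langle h_0,\mathrm{wt}\rangle=0$ and $1$ elsewhere; $e_i$ (resp. $f_i$), where non-zero, changes $(\varepsilon_i,\varphi_i,\mathrm{wt})$ by $(-1,1,\alpha_i)$ (resp. $(1,-1,-\alpha_i)$); and $f_ib=b'\Leftrightarrow e_ib'=b$. An isomorphism of crystals is a bijection preserving $\mathrm{wt},\varepsilon_i,\varphi_i$ and the arrows $b\xrightarrow{i}f_ib$. A $(\mathfrak{gl}_{m|n},\mathfrak{gl}_{u|v})$-bicrystal is a set with a $\mathfrak{gl}_{m|n}$- and a $\mathfrak{gl}_{u|v}$-crystal structure whose operators (as maps on $B\cup\{0\}$) commute; an isomorphism of bicrystals is an isomorphism for both structures. *Words.* $\mathbf B_{m|n}$ is a crystal with arrows $\overline m\xrightarrow{\overline{m-1}}\cdots\xrightarrow{\overline 1}\overline 1\xrightarrow{0}1\xrightarrow{1}\cdots\xrightarrow{n-1}n$, $\mathrm{wt}(b)=\epsilon_b$, and $\varepsilon_i(b)$, $\varphi_i(b)$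 the numbers of $i$-arrows into and out of $b$. A word $w_1\cdots w_r$ is identified with $w_1\otimes\cdots\otimes w_r$ (the empty word has weight, $\varepsilon_i$, $\varphi_i$ zero and is killed by $e_i,f_i$), where weights add and: for $i=\overline k$, $e_i$ acts on $b_1$ in $b_1\otimes b_2$ if $\varphi_i(b_1)\ge\varepsilon_i(b_2)$ and on $b_2$ otherwise, $f_i$ acts on $b_1$ if $\varphi_i(b_1)>\varepsilon_i(b_2)$ and on $b_2$ otherwise, $\varepsilon_i=\max(\varepsilon_i(b_1),\varepsilon_i(b_2)-\langle h_i,\mathrm{wt}\,b_1\rangle)$, $\varphi_i=\max(\varphi_i(b_1)+\langle h_i,\mathrm{wt}\,b_2\rangle,\varphi_i(b_2))$; for $1\le i<n$ the same rules hold with the roles of $b_1,b_2$ exchanged; for $i=0$, $e_0,f_0,\varepsilon_0,\varphi_0$ are those of $b_1$ if $\langle h_0,\mathrm{wt}\,b_1\rangle>0$ and those of $b_2$ otherwise. *Tableaux.* $\mathcal P_{m|n}$ is the set of partitions with $\lambda_{m+1}\le n$, and $\mathbf B_{m|n}(\lambda)$ is the set of fillings of the Young diagram $\lambda$ by $\mathbf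 B_{m|n}$ with weakly increasing rows and columns, barred letters strictly increasing in columns and unbarred ones strictly increasing in rows; it is regarded as a subset of the crystal of words by reading columns from right to left, each from top to bottom. $H^\lambda_{m|n}\in\mathbf B_{m|n}(\lambda)$ is the tableau whose $k$-th row is filled with $\overline{m-k+1}$ for $k\le m$ and whose $j$-th column is filled with $j$ below row $m$. $P(w)$ is obtained from the empty tableau by inserting $w_1,w_2,\dots,w_r$ successively by column bumping: $b$ replaces the smallest (and among equals the highest) entry $b'$ of the first column with $b'\ge b$ if $|b|=0$, $b'>b$ if $|b|=1$, and $b'$ is inserted likewise in the next column; if there is no such entry, $b$ is put at the bottom of the column. *Matrices.* Let $\mathbf M$ be the set of matrices $A=(a_{bb'})_{b\in\mathbf B_{m|n},b'\in\mathbf B_{u|v}}$ with entries in $\mathbb Z_{\ge0}$ and $a_{bb'}\le1$ if $|b|\ne|b'|$. Order pairs by $(i,j)<(k,l)$ iff $j<l$, or $j=l$ is barred and $i>k$, or $j=l$ is unbarred and $i<k$. Each $A\in\mathbf M$ corresponds to the unique pair of words $(\mathbf i,\mathbf j)$ such that $(i_1,j_1)\le(i_2,j_2)\le\cdots$ and $(b,b')$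 occurs $a_{bb'}$ times among the $(i_k,j_k)$; let $(\mathbf l,\mathbf k)$ be the pair that corresponds in the same way to the transpose $A^t\in\mathbf M_{u|v,m|n}$. Let $e_i,f_i$ ($i\in I_{m|n}$) act on $A$ through $\mathbf i$, with $\mathbf j$ fixed, and $e_j^*,f_j^*$ ($j\in I_{u|v}$) through $\mathbf l$, with $\mathbf k$ fixed; the weights, $\varepsilon$'s and $\varphi$'s are those of $\mathbf i$ and $\mathbf l$. Put $\pi(A)=(P(\mathbf i),P(\mathbf l))$, and let $\mathbf M_{\rm h.w.}$ be the set of highest weight elements, i.e. of the $A\in\mathbf M$ with $\pi(A)=(H^\lambda_{m|n},H^\mu_{u|v})$ for some $\lambda\in\mathcal P_{m|n}$, $\mu\in\mathcal P_{u|v}$. For $\lambda\in\mathcal P_{m|n}\cap\mathcal P_{u|v}$ and $m\ge u$, let $\ell=\lambda_{m+1}$, let $\nu_1,\dots,\nu_\ell$ be given by $(\nu_1+\cdots+\nu_\ell,\ \nu_2+\cdots+\nu_\ell,\ \dots,\ \nu_\ell)=(\lambda_{m+1},\lambda_{m+2},\dots)'$ (conjugate partition), and let $A_\lambda\in\mathbf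 M$ be the matrix with $a_{\overline{m-k}\,\overline{u-k}}=\lambda_{k+1}$ for $0\le k<u$; $a_{\overline{m-k}\,t}=1$ for $u\le k<m$, $1\le t\le \lambda_{k+1}$; $a_{st}=\nu_{s+t-1}$ for $1\le s\le n$, $1\le t\le v$, $s+t\le\ell+1$; and all other entries $0$. For $m<u$, $A_\lambda$ is the transpose of the matrix so defined with $(m,n)$ and $(u,v)$ exchanged. **Theorem.** The sets $\mathbf B_{m|n}(\lambda)$ ($\lambda\in\mathcal P_{m|n}$), $\mathbf B_{u|v}(\mu)$ ($\mu\in\mathcal P_{u|v}$) and $\mathbf M$, each together with $0$, are stable under the operators above; $\mathbf M$ and $\bigoplus_{\lambda\in\mathcal P_{m|n}\cap\mathcal P_{u|v}}\mathbf B_{m|n}(\lambda)\times\mathbf B_{u|v}(\lambda)$ are $(\mathfrak{gl}_{m|n},\mathfrak{gl}_{u|v})$-bicrystals (where $\bigoplus$ is disjoint union and the two algebras act on the first and second component respectively); and $$\mathbf M_{\rm h.w.}=\{A_\lambda\mid\lambda\in\mathcal P_{m|n}\cap\mathcal P_{u|v}\},$$ and $\pi$ is an isomorphism of $(\mathfrak{gl}_{m|n},\mathfrak{gl}_{u|v})$-bicrystals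 $$\pi:\mathbf M\longrightarrow\bigoplus_{\lambda\in\mathcal P_{m|n}\cap\mathcal P_{u|v}}\mathbf B_{m|n}(\lambda)\times\mathbf B_{u|v}(\lambda).$$ Moreover, with $hs_\lambda(x)=\sum_{T\in\mathbf B_{m|n}(\lambda)}x^{\mathrm{wt}\,T}$ (and likewise $hs_\lambda(y)$ for $\mathbf B_{u|v}(\lambda)$), the super Cauchy identity holds as an identity of formal power series in the $x_b$ ($b\in\mathbf B_{m|n}$) and $y_{b'}$ ($b'\in\mathbf B_{u|v}$): $$\frac{\prod_{|b|\ne|b'|}(1+x_by_{b'})}{\prod_{|b|=|b'|}(1-x_by_{b'})}=\sum_{\lambda\in\mathcal P_{m|n}\cap\mathcal P_{u|v}}hs_\lambda(x)\,hs_\lambda(y).$$ -/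

import Mathlib

namespace SuperKnuth

/-! ### Letters, weights, roots -/

/-- The linearly ordered set `\bar m < ⋯ < \bar 1 < 1 < ⋯ < n`, realized as `Fin (m + n)`:
position `k < m` is the letter `\overline{m-k}`, position `m + l` is the letter `l + 1`. -/
abbrev Letter (m n : ℕ) := Fin (m + n)

/-- The degree: `0` for the barred letters, `1` for the unbarred ones. -/
def deg (m n : ℕ) (b : Letter m n) : ℕ := if b.val < m then 0 else 1

/-- The index set `\overline{m-1}, …, \bar 1, 0, 1, …, n-1` of simple roots, in this order: one index
for each pair of consecutive letters (so `0` is an index only if `m` and `n` are both positive).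
The index at position `k` is of type `\bar p` if `k + 1 < m`, is `0` if `k + 1 = m`, and is
of type `p` if `m ≤ k`. -/
abbrev Index (m n : ℕ) := Fin (m + n - 1)

/-- The smaller of the two consecutive letters attached to `i`. -/
def lo (m n : ℕ) (i : Index m n) : Letter m n := ⟨i.val, by omega⟩

/-- The larger of the two consecutive letters attached to `i`. -/
def hi (m n : ℕ) (i : Index m n) : Letter m n := ⟨i.val + 1, by omega⟩

/-- The weight lattice, the free abelian group on the `ϵ_b`. -/
abbrev Weight (m n : ℕ) := Letter m n → ℤ

/-- The symmetric bilinear form with `(ϵ_b, ϵ_b') = (-1)^|b| δ_{bb'}`. -/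
def form (m n : ℕ) (x y : Weight m n) : ℤ := ∑ b, (-1) ^ deg m n b * (x b * y b)

/-- The simple root `α_i`. -/
def root (m n : ℕ) (i : Index m n) : Weight m n :=
  Pi.single (lo m n i) 1 - Pi.single (hi m n i) 1

/-- The pairing `⟨h_i, x⟩` with the simple coroot. -/
def coroot (m n : ℕ) (i : Index m n) (x : Weight m n) : ℤ :=
  if i.val + 1 ≤ m then form m n (root m n i) x else - form m n (root m n i) x

/-! ### Crystals -/

/-- The data of a `gl(m|n)`-crystal on `B`; the formal symbol `0` is `none`. -/
structure CrystalData (m n : ℕ) (B : Type*) where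
  wt : B → Weight m n
  ε : Index m n → B → ℕ
  φ : Index m n → B → ℕ
  e : Index m n → B → Option B
  f : Index m n → B → Option B

/-- The axioms of a `gl(m|n)`-crystal. -/
structure IsCrystal {m n : ℕ} {B : Type*} (C : CrystalData m n B) : Prop where
  even_string : ∀ i b, i.val + 1 ≠ m → (C.φ i b : ℤ) - C.ε i b = coroot m n i (C.wt b)
  odd_nonneg : ∀ i b, i.val + 1 = m → 0 ≤ coroot m n i (C.wt b)
  odd_string : ∀ i b, i.val + 1 = m →
    C.φ i b + C.ε i b = if coroot m n i (C.wt b) = 0 then 0 else 1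
  e_spec : ∀ i b b', C.e i b = some b' →
    C.ε i b' + 1 = C.ε i b ∧ C.φ i b' = C.φ i b + 1 ∧ C.wt b' = C.wt b + root m n i
  f_spec : ∀ i b b', C.f i b = some b' →
    C.ε i b' = C.ε i b + 1 ∧ C.φ i b' + 1 = C.φ i b ∧ C.wt b' = C.wt b - root m n i
  f_iff_e : ∀ i b b', C.f i b = some b' ↔ C.e i b' = some b

/-- `ψ` is an isomorphism of crystals: an isomorphism of coloured oriented graphs that
preserves `wt`, `ε_i`, `φ_i`. -/
structure IsCrystalIso {m n : ℕ} {B₁ B₂ : Type*} (C₁ : CrystalData m n B₁)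
    (C₂ : CrystalData m n B₂) (ψ : B₁ → B₂) : Prop where
  bijective : Function.Bijective ψ
  wt : ∀ b, C₂.wt (ψ b) = C₁.wt b
  ε : ∀ i b, C₂.ε i (ψ b) = C₁.ε i b
  φ : ∀ i b, C₂.φ i (ψ b) = C₁.φ i b
  arrow : ∀ i b b', C₁.f i b = some b' ↔ C₂.f i (ψ b) = some (ψ b')

/-- The image of `r` is a subset of `W` such that the image together with `0` is stable under
the Kashiwara operators, and `r` identifies `B` with this subset. -/
structure IsStableEmbedding {m n : ℕ} {B W : Type*} (C : CrystalData m n W) (r : B → W) :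
    Prop where
  injective : Function.Injective r
  e_mem : ∀ i b w, C.e i (r b) = some w → w ∈ Set.range r
  f_mem : ∀ i b w, C.f i (r b) = some w → w ∈ Set.range r

open Classical in
/-- The structure that `B` inherits from `W` when it is identified, along `r`, with a subset
of `W` (meaningful when `IsStableEmbedding C r` holds). -/
noncomputable def CrystalData.restrict {m n : ℕ} {B W : Type*} (C : CrystalData m n W)
    (r : B → W) : CrystalData m n B where
  wt b := C.wt (r b)
  ε i b := C.ε i (r b)
  φ i b := C.φ i (r b)
  e i b := if h : ∃ b', C.e i (r b) = some (r b') then some h.choose else none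
  f i b := if h : ∃ b', C.f i (r b) = some (r b') then some h.choose else none

/-- The crystal structure on `B × D` that acts on the first component. -/
def CrystalData.onFst {m n : ℕ} {B : Type*} (C : CrystalData m n B) (D : Type*) :
    CrystalData m n (B × D) where
  wt p := C.wt p.1
  ε i p := C.ε i p.1
  φ i p := C.φ i p.1
  e i p := (C.e i p.1).map fun b => (b, p.2)
  f i p := (C.f i p.1).map fun b => (b, p.2)

/-- The crystal structure on `D × B` that acts on the second component. -/
def CrystalData.onSnd {m n : ℕ} {B : Type*} (C : CrystalData m n B) (D : Type*) :
    CrystalData m n (D × B) where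
  wt p := C.wt p.2
  ε i p := C.ε i p.2
  φ i p := C.φ i p.2
  e i p := (C.e i p.2).map fun b => (p.1, b)
  f i p := (C.f i p.2).map fun b => (p.1, b)

/-- The direct sum (disjoint union) of a family of crystals. -/
def CrystalData.sum {m n : ℕ} {ι : Type*} {B : ι → Type*} (C : ∀ k, CrystalData m n (B k)) :
    CrystalData m n (Σ k, B k) where
  wt p := (C p.1).wt p.2
  ε i p := (C p.1).ε i p.2
  φ i p := (C p.1).φ i p.2
  e i p := ((C p.1).e i p.2).map fun b => ⟨p.1, b⟩
  f i p := ((C p.1).f i p.2).map fun b => ⟨p.1, b⟩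

/-! ### Bicrystals -/

/-- The data of a `(gl(m|n), gl(u|v))`-bicrystal. -/
structure BicrystalData (m n u v : ℕ) (B : Type*) where
  left : CrystalData m n B
  right : CrystalData u v B

/-- The axioms of a bicrystal: two crystal structures whose Kashiwara operators, as maps on
`B ∪ {0}`, commute. -/
structure IsBicrystal {m n u v : ℕ} {B : Type*} (C : BicrystalData m n u v B) : Prop where
  left : IsCrystal C.left
  right : IsCrystal C.right
  e_e : ∀ i j b, (C.left.e i b).bind (C.right.e j) = (C.right.e j b).bind (C.left.e i)
  e_f : ∀ i j b, (C.left.e i b).bind (C.right.f j) = (C.right.f j b).bind (C.left.e i)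
  f_e : ∀ i j b, (C.left.f i b).bind (C.right.e j) = (C.right.e j b).bind (C.left.f i)
  f_f : ∀ i j b, (C.left.f i b).bind (C.right.f j) = (C.right.f j b).bind (C.left.f i)

/-- `ψ` is an isomorphism of bicrystals. -/
structure IsBicrystalIso {m n u v : ℕ} {B₁ B₂ : Type*} (C₁ : BicrystalData m n u v B₁)
    (C₂ : BicrystalData m n u v B₂) (ψ : B₁ → B₂) : Prop where
  left : IsCrystalIso C₁.left C₂.left ψ
  right : IsCrystalIso C₁.right C₂.right ψ

/-! ### The crystal of words -/

/-- `ε_i` of a letter: the number of `i`-arrows coming in. -/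
def letterEps (m n : ℕ) (i : Index m n) (b : Letter m n) : ℕ := if b = hi m n i then 1 else 0

/-- `φ_i` of a letter: the number of `i`-arrows going out. -/
def letterPhi (m n : ℕ) (i : Index m n) (b : Letter m n) : ℕ := if b = lo m n i then 1 else 0

/-- `e_i` on letters. -/
def letterE (m n : ℕ) (i : Index m n) (b : Letter m n) : Option (Letter m n) :=
  if b = hi m n i then some (lo m n i) else none

/-- `f_i` on letters. -/
def letterF (m n : ℕ) (i : Index m n) (b : Letter m n) : Option (Letter m n) :=
  if b = lo m n i then some (hi m n i) else none

/-- The weight `ϵ_b` of a letter. -/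
def letterWt (m n : ℕ) (b : Letter m n) : Weight m n := Pi.single b 1

/-- The weight of a word. -/
def wordWt (m n : ℕ) (w : List (Letter m n)) : Weight m n := fun b => (w.count b : ℤ)

/-- `ε_i` of a word `b w = b ⊗ w`, by the tensor product rule. -/
def wordEps (m n : ℕ) (i : Index m n) : List (Letter m n) → ℕ
  | [] => 0
  | b :: w =>
    if i.val + 1 < m then
      (max (letterEps m n i b : ℤ) (wordEps m n i w - coroot m n i (letterWt m n b))).toNat
    else if i.val + 1 = m then
      if 0 < coroot m n i (letterWt m n b) then letterEps m n i b else wordEps m n i w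
    else
      (max (letterEps m n i b - coroot m n i (wordWt m n w)) (wordEps m n i w : ℤ)).toNat

/-- `φ_i` of a word `b w = b ⊗ w`, by the tensor product rule. -/
def wordPhi (m n : ℕ) (i : Index m n) : List (Letter m n) → ℕ
  | [] => 0
  | b :: w =>
    if i.val + 1 < m then
      (max (letterPhi m n i b + coroot m n i (wordWt m n w)) (wordPhi m n i w : ℤ)).toNat
    else if i.val + 1 = m then
      if 0 < coroot m n i (letterWt m n b) then letterPhi m n i b else wordPhi m n i w
    else
      (max (letterPhi m n i b : ℤ) (wordPhi m n i w + coroot m n i (letterWt m n b))).toNat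

/-- `e_i` of a word `b w = b ⊗ w`, by the tensor product rule. -/
def wordE (m n : ℕ) (i : Index m n) : List (Letter m n) → Option (List (Letter m n))
  | [] => none
  | b :: w =>
    if (i.val + 1 < m ∧ wordEps m n i w ≤ letterPhi m n i b) ∨
        (i.val + 1 = m ∧ 0 < coroot m n i (letterWt m n b)) ∨
        (m < i.val + 1 ∧ wordPhi m n i w < letterEps m n i b) then
      (letterE m n i b).map fun b' => b' :: w
    else (wordE m n i w).map fun w' => b :: w'

/-- `f_i` of a word `b w = b ⊗ w`, by the tensor product rule. -/
def wordF (m n : ℕ) (i : Index m n) : List (Letter m n) → Option (List (Letter m n))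
  | [] => none
  | b :: w =>
    if (i.val + 1 < m ∧ wordEps m n i w < letterPhi m n i b) ∨
        (i.val + 1 = m ∧ 0 < coroot m n i (letterWt m n b)) ∨
        (m < i.val + 1 ∧ wordPhi m n i w ≤ letterEps m n i b) then
      (letterF m n i b).map fun b' => b' :: w
    else (wordF m n i w).map fun w' => b :: w'

/-- The crystal of all finite words, `w_1 ⋯ w_r` being `w_1 ⊗ ⋯ ⊗ w_r`. -/
def words (m n : ℕ) : CrystalData m n (List (Letter m n)) where
  wt := wordWt m n
  ε := wordEps m n
  φ := wordPhi m n
  e := wordE m n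
  f := wordF m n

/-! ### Hook semistandard tableaux -/

/-- `(m,n)`-hook partitions, as Young diagrams: `λ_{m+1} ≤ n` (rows are numbered from `0`). -/
def IsHook (m n : ℕ) (μ : YoungDiagram) : Prop := μ.rowLen m ≤ n

/-- `x` may stand directly above `y` in a column: weakly increasing, strictly for degree `0`. -/
def ColRel (m n : ℕ) (x y : Letter m n) : Prop := x < y ∨ (x = y ∧ deg m n x = 1)

/-- `x` may stand directly to the left of `y` in a row: weakly increasing, strictly for
degree `1`. -/
def RowRel (m n : ℕ) (x y : Letter m n) : Prop := x < y ∨ (x = y ∧ deg m n x = 0)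

/-- `T`, the list of the (non-empty) columns from left to right, each column being listed from
top to bottom, is an `(m,n)`-hook semistandard tableau of shape `μ`. -/
structure IsTableau (m n : ℕ) (μ : YoungDiagram) (T : List (List (Letter m n))) : Prop where
  nonempty : [] ∉ T
  shape : ∀ j, (T.getD j []).length = μ.colLen j
  col : ∀ c ∈ T, c.IsChain (ColRel m n)
  row : T.IsChain fun s t => ∀ (k : ℕ) (x y : Letter m n),
    s[k]? = some x → t[k]? = some y → RowRel m n x y

/-- The set of `(m,n)`-hook semistandard tableaux of shape `μ`. -/
@[ext]
structure Tableau (m n : ℕ) (μ : YoungDiagram) where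
  columns : List (List (Letter m n))
  isTableau : IsTableau m n μ columns

/-- The column reading: columns from right to left, each from top to bottom. -/
def Tableau.word {m n : ℕ} {μ : YoungDiagram} (T : Tableau m n μ) : List (Letter m n) :=
  T.columns.reverse.flatten

/-- The crystal of tableaux of shape `μ`, a subset of the crystal of words. -/
noncomputable def tableauCrystal (m n : ℕ) (μ : YoungDiagram) :
    CrystalData m n (Tableau m n μ) :=
  (words m n).restrict Tableau.word

/-- The highest weight tableau of shape `μ`: for `k < m` row `k` (counted from `0`) is filled with
`\overline{m-k}`, and below row `m` the column `j` (counted from `0`) is filled with `j + 1`. -/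
def highestTableau (m n : ℕ) (μ : YoungDiagram) (h : IsHook m n μ) : List (List (Letter m n)) :=
  List.ofFn fun j : Fin (μ.rowLen 0) => List.ofFn fun k : Fin (μ.colLen j) =>
    if hk : k.val < m then ⟨k.val, by omega⟩ else
      ⟨m + j.val, by
        have h1 : j.val < μ.rowLen k.val :=
          YoungDiagram.mem_iff_lt_rowLen.1 (YoungDiagram.mem_iff_lt_colLen.2 k.2)
        have h2 : μ.rowLen k.val ≤ μ.rowLen m := μ.rowLen_anti _ _ (by omega)
        have h3 : μ.rowLen m ≤ n := h
        omega⟩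

/-! ### Column bumping -/

/-- Insert `b` into a column: `b` replaces the topmost entry `x` with `b ≤ x` (if `|b| = 0`) or
`b < x` (if `|b| = 1`), and `x` is bumped out; if there is none, `b` is put at the bottom. (In a
column of a semistandard tableau the topmost such entry is the smallest one.) -/
def insertColumn (m n : ℕ) (b : Letter m n) :
    List (Letter m n) → List (Letter m n) × Option (Letter m n)
  | [] => ([b], none)
  | x :: c =>
    if (deg m n b = 0 ∧ b ≤ x) ∨ (deg m n b = 1 ∧ b < x) then (b :: c, some x)
    else (x :: (insertColumn m n b c).1, (insertColumn m n b c).2)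

/-- Schensted's column bumping `T ← b`. -/
def bump (m n : ℕ) : List (List (Letter m n)) → Letter m n → List (List (Letter m n))
  | [], b => [[b]]
  | c :: T, b =>
    match insertColumn m n b c with
    | (c', none) => c' :: T
    | (c', some b') => c' :: bump m n T b'

/-- `P(w) = (⋯((w_1 ← w_2) ← w_3) ⋯) ← w_r`. -/
def P (m n : ℕ) (w : List (Letter m n)) : List (List (Letter m n)) :=
  w.foldl (bump m n) []

/-! ### Matrices and biwords -/

/-- The set `𝐌` of matrices of non-negative integers whose entries are at most `1` where the
degrees of row and column differ. -/
@[ext]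
structure SuperMatrix (m n u v : ℕ) where
  entry : Matrix (Letter m n) (Letter u v) ℕ
  le_one : ∀ b b', deg m n b ≠ deg u v b' → entry b b' ≤ 1

/-- The transposed matrix. -/
def SuperMatrix.transpose {m n u v : ℕ} (A : SuperMatrix m n u v) : SuperMatrix u v m n :=
  ⟨A.entry.transpose, fun b b' h => A.le_one b' b h.symm⟩

/-- The super lexicographic ordering on pairs of letters. -/
def SuperLex (m n u v : ℕ) (p q : Letter m n × Letter u v) : Prop :=
  p.2 < q.2 ∨ (p.2 = q.2 ∧ deg u v p.2 = 0 ∧ q.1 < p.1) ∨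
    (p.2 = q.2 ∧ deg u v p.2 = 1 ∧ p.1 < q.1)

/-- The set `Ω` of biwords `(i, j)`, as lists of pairs `(i_k, j_k)`: weakly increasing for the super
lexicographic ordering, and a pair whose letters have different degrees is not repeated. -/
def Omega (m n u v : ℕ) : Set (List (Letter m n × Letter u v)) :=
  {w | w.IsChain fun p q =>
    (SuperLex m n u v p q ∨ p = q) ∧ (deg m n p.1 ≠ deg u v p.2 → p ≠ q)}

/-- The matrix of a biword: the entry at `(b, b')` is the number of `k` with
`(i_k, j_k) = (b, b')`. -/
def countMatrix {m n u v : ℕ} (w : List (Letter m n × Letter u v)) :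
    Matrix (Letter m n) (Letter u v) ℕ :=
  fun b b' => w.count (b, b')

/-- The biword `(i, j) ∈ Ω` of a matrix; see `biword_unique`. -/
def SuperMatrix.biword {m n u v : ℕ} (A : SuperMatrix m n u v) :
    List (Letter m n × Letter u v) :=
  (List.finRange (u + v)).flatMap fun b' =>
    (if deg u v b' = 0 then (List.finRange (m + n)).reverse else List.finRange (m + n)).flatMap
      fun b => List.replicate (A.entry b b') (b, b')

/-- The pair of words `(i, j)` with `A = A(i, j)` and `(i, j) ∈ Ω`. -/
def SuperMatrix.wordPair {m n u v : ℕ} (A : SuperMatrix m n u v) :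
    List (Letter m n) × List (Letter u v) :=
  (A.biword.map Prod.fst, A.biword.map Prod.snd)

/-- The pair of words `(l, k)` with `A = A(k, l)` and `(k, l) ∈ Ω^*`, where `(k, l) ∈ Ω^*` means
that `(l, k)` is in the set `Ω` of `(gl(u|v), gl(m|n))`. -/
def SuperMatrix.wordPairStar {m n u v : ℕ} (A : SuperMatrix m n u v) :
    List (Letter u v) × List (Letter m n) :=
  A.transpose.wordPair

/-- The tableau `P_1(A) = P(i)`, as a list of columns. -/
def SuperMatrix.P₁ {m n u v : ℕ} (A : SuperMatrix m n u v) : List (List (Letter m n)) :=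
  P m n A.wordPair.1

/-- The tableau `P_2(A) = P(l)`, as a list of columns. -/
def SuperMatrix.P₂ {m n u v : ℕ} (A : SuperMatrix m n u v) : List (List (Letter u v)) :=
  P u v A.wordPairStar.1

/-- The two crystal structures on `𝐌`, through its identifications with `Ω` and `Ω^*`: the
operators `e_i, f_i` act on the word `i` of `(i, j) ∈ Ω`, the operators `e_j^*, f_j^*` act on the
word `l` of `(k, l) ∈ Ω^*`. -/
noncomputable def matrixBicrystal (m n u v : ℕ) :
    BicrystalData m n u v (SuperMatrix m n u v) where
  left := ((words m n).onFst (List (Letter u v))).restrict SuperMatrix.wordPair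
  right := ((words u v).onFst (List (Letter m n))).restrict SuperMatrix.wordPairStar

/-- The set of highest weight elements of `𝐌`. -/
def highestMatrices (m n u v : ℕ) : Set (SuperMatrix m n u v) :=
  {A | ∃ (μ ν : YoungDiagram) (hμ : IsHook m n μ) (hν : IsHook u v ν),
    A.P₁ = highestTableau m n μ hμ ∧ A.P₂ = highestTableau u v ν hν}

/-! ### The matrices `A_λ` -/

/-- The number `ν_k` (`k ≥ 1`), determined by
`ν_k + ν_{k+1} + ⋯ = (the k-th part of the conjugate of (λ_{m+1}, λ_{m+2}, …))`; this part is the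
length of the `k`-th column of `λ` below the first `m` rows. -/
def nuPart (m : ℕ) (μ : YoungDiagram) (k : ℕ) : ℕ :=
  (μ.colLen (k - 1) - m) - (μ.colLen k - m)

/-- The matrix `A_λ` in the case `u ≤ m`. -/
def matrixOfGE (m n u v : ℕ) (μ : YoungDiagram) : SuperMatrix m n u v :=
  ⟨fun b b' =>
    if b.val < m then
      if b'.val < u then
        if b.val = b'.val then μ.rowLen b.val else 0
      else
        -- `b' = t` with `t = b'.val - u + 1`
        if u ≤ b.val ∧ b'.val - u + 1 ≤ μ.rowLen b.val then 1 else 0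
    else
      if b'.val < u then 0
      else
        -- `b = s` and `b' = t` with `s = b.val - m + 1`, `t = b'.val - u + 1`
        if (b.val - m + 1) + (b'.val - u + 1) ≤ μ.rowLen m + 1 then
          nuPart m μ ((b.val - m + 1) + (b'.val - u + 1) - 1)
        else 0,
    by
      intro b b' h
      unfold deg at h
      by_cases h1 : b.val < m <;> by_cases h2 : b'.val < u
      · simp [h1, h2] at h
      · simp only [h1, h2, if_true, if_false]
        split_ifs <;> omega
      · simp [h1, h2]
      · simp [h1, h2] at h⟩

/-- The matrix `A_λ`. -/
def matrixOf (m n u v : ℕ) (μ : YoungDiagram) : SuperMatrix m n u v :=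
  if u ≤ m then matrixOfGE m n u v μ else (matrixOfGE u v m n μ).transpose

/-! ### The direct sum of the `B(λ) × B(λ)` -/

/-- The shapes `λ` in `𝒫_{m|n} ∩ 𝒫_{u|v}`. -/
abbrev CommonHook (m n u v : ℕ) := {μ : YoungDiagram // IsHook m n μ ∧ IsHook u v μ}

/-- The disjoint union of the sets `B_{m|n}(λ) × B_{u|v}(λ)`. -/
abbrev TableauPairs (m n u v : ℕ) :=
  Σ μ : CommonHook m n u v, Tableau m n μ.1 × Tableau u v μ.1

/-- The bicrystal `⨁_λ B_{m|n}(λ) × B_{u|v}(λ)`. -/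
noncomputable def tableauPairsBicrystal (m n u v : ℕ) :
    BicrystalData m n u v (TableauPairs m n u v) where
  left := CrystalData.sum fun μ => (tableauCrystal m n μ.1).onFst (Tableau u v μ.1)
  right := CrystalData.sum fun μ => (tableauCrystal u v μ.1).onSnd (Tableau m n μ.1)

/-! ### Hook Schur functions -/

instance Tableau.instFinite (m n : ℕ) (μ : YoungDiagram) : Finite (Tableau m n μ) := by
  let S : Set (List (Letter m n)) := {c | c.length ≤ μ.colLen 0}
  have hS : S.Finite := List.finite_length_le _ _
  have : Finite S := hS
  have hT : {T : List S | T.length ≤ μ.rowLen 0}.Finite := List.finite_length_le _ _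
  suffices h : {T | IsTableau m n μ T}.Finite by
    have : Finite {T | IsTableau m n μ T} := h
    exact Finite.of_injective
      (fun T : Tableau m n μ => (⟨T.columns, T.isTableau⟩ : {T | IsTableau m n μ T}))
      fun T T' h => Tableau.ext (congrArg Subtype.val h)
  refine Set.Finite.subset (hT.image (List.map Subtype.val)) ?_
  intro T hTab
  have hmem : ∀ c ∈ T, c ∈ S := by
    intro c hc
    obtain ⟨j, hj, rfl⟩ := List.mem_iff_getElem.1 hc
    have h1 := hTab.shape j
    rw [List.getD_eq_getElem _ _ hj] at h1
    have h2 := μ.colLen_anti 0 j (Nat.zero_le _)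
    change T[j].length ≤ _
    omega
  refine ⟨T.pmap Subtype.mk hmem, ?_, ?_⟩
  · change (List.pmap _ _ _).length ≤ _
    rw [List.length_pmap]
    by_contra hlt
    push Not at hlt
    have h1 := hTab.shape (μ.rowLen 0)
    rw [List.getD_eq_getElem _ _ hlt] at h1
    have h2 : μ.colLen (μ.rowLen 0) = 0 := by
      by_contra h0
      have := YoungDiagram.mem_iff_lt_colLen.2 (Nat.pos_of_ne_zero h0)
      have := YoungDiagram.mem_iff_lt_rowLen.1 this
      omega
    rw [h2] at h1
    have h3 : T[μ.rowLen 0] = [] := List.length_eq_zero_iff.1 h1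
    exact hTab.nonempty (h3 ▸ List.getElem_mem hlt)
  · rw [List.map_pmap]
    simp

noncomputable instance Tableau.instFintype (m n : ℕ) (μ : YoungDiagram) :
    Fintype (Tableau m n μ) := Fintype.ofFinite _

/-- The hook Schur function `hs_μ(x) = ∑_T x^{wt T}`. -/
noncomputable def hookSchur {R : Type*} [CommSemiring R] (m n : ℕ) (μ : YoungDiagram)
    (x : Letter m n → R) : R :=
  ∑ T : Tableau m n μ, ∏ b, x b ^ T.word.count b

/-- The variable `x_b`, in the ring of formal power series in the `x_b` and the `y_b'`. -/
noncomputable def varX (m n u v : ℕ) (b : Letter m n) :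
    MvPowerSeries (Letter m n ⊕ Letter u v) ℤ := MvPowerSeries.X (Sum.inl b)

/-- The variable `y_b'`, in the ring of formal power series in the `x_b` and the `y_b'`. -/
noncomputable def varY (m n u v : ℕ) (b' : Letter u v) :
    MvPowerSeries (Letter m n ⊕ Letter u v) ℤ := MvPowerSeries.X (Sum.inr b')

/-- The product of `1 + x_b y_b'` over all `b`, `b'` with `|b| ≠ |b'|`, divided by the product of
`1 - x_b y_b'` over all `b`, `b'` with `|b| = |b'|`. -/
noncomputable def cauchyProduct (m n u v : ℕ) : MvPowerSeries (Letter m n ⊕ Letter u v) ℤ :=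
  (∏ p : Letter m n × Letter u v with deg m n p.1 ≠ deg u v p.2,
    (1 + varX m n u v p.1 * varY m n u v p.2)) *
  MvPowerSeries.invOfUnit
    (∏ p : Letter m n × Letter u v with deg m n p.1 = deg u v p.2,
      (1 - varX m n u v p.1 * varY m n u v p.2)) 1

theorem cauchyProduct_mul (m n u v : ℕ) :
    cauchyProduct m n u v *
        (∏ p : Letter m n × Letter u v with deg m n p.1 = deg u v p.2,
          (1 - varX m n u v p.1 * varY m n u v p.2)) =
      ∏ p : Letter m n × Letter u v with deg m n p.1 ≠ deg u v p.2,
        (1 + varX m n u v p.1 * varY m n u v p.2) := by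
  unfold cauchyProduct
  rw [mul_assoc, mul_comm (MvPowerSeries.invOfUnit _ _), MvPowerSeries.mul_invOfUnit, mul_one]
  simp [varX, varY, map_prod]

/-! ### The biword of a matrix is the unique one in `Ω` -/

theorem SuperLex.trans {m n u v : ℕ} {p q r : Letter m n × Letter u v}
    (h : SuperLex m n u v p q) (h' : SuperLex m n u v q r) : SuperLex m n u v p r := by
  unfold SuperLex at *
  grind

theorem SuperLex.irrefl {m n u v : ℕ} (p : Letter m n × Letter u v) :
    ¬ SuperLex m n u v p p := by
  unfold SuperLex
  grind

theorem sum_map_single {α : Type*} [DecidableEq α] {a : α} (l : List α) (hl : l.Nodup)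
    (ha : a ∈ l) (k : ℕ) : (l.map fun c => if c = a then k else 0).sum = k := by
  induction l with
  | nil => simp at ha
  | cons c l ih =>
    rw [List.nodup_cons] at hl
    rw [List.map_cons, List.sum_cons]
    by_cases h : c = a
    · subst h
      have : (l.map fun d => if d = c then k else 0).sum = 0 := by
        refine List.sum_eq_zero ?_
        intro x hx
        obtain ⟨d, hd, rfl⟩ := List.mem_map.1 hx
        exact if_neg fun hdc : d = c => hl.1 (hdc ▸ hd)
      simp [this]
    · rw [if_neg h, zero_add]
      exact ih hl.2 ((List.mem_cons.1 ha).resolve_left fun h' => h h'.symm)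

theorem count_biword {m n u v : ℕ} (A : SuperMatrix m n u v) : countMatrix A.biword = A.entry := by
  funext b b'
  have hin : ∀ (c' : Letter u v) (l : List (Letter m n)), l.Nodup → b ∈ l →
      (l.flatMap fun c => List.replicate (A.entry c c') (c, c')).count (b, b') =
        if c' = b' then A.entry b b' else 0 := by
    intro c' l hl hb
    rw [List.count_flatMap]
    have : (List.count (b, b') ∘ fun c => List.replicate (A.entry c c') (c, c')) =
        fun c => if c = b then (if c' = b' then A.entry b b' else 0) else 0 := by
      funext c
      simp only [Function.comp, List.count_replicate]
      by_cases h1 : c = b <;> by_cases h2 : c' = b' <;> simp [h1, h2]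
    rw [this]
    exact sum_map_single l hl hb _
  unfold countMatrix SuperMatrix.biword
  rw [List.count_flatMap]
  have : (List.count (b, b') ∘ fun c' : Letter u v =>
      (if deg u v c' = 0 then (List.finRange (m + n)).reverse else List.finRange (m + n)).flatMap
        fun c => List.replicate (A.entry c c') (c, c')) =
      fun c' => if c' = b' then A.entry b b' else 0 := by
    funext c'
    refine hin c' _ ?_ ?_
    · split_ifs
      · exact List.nodup_reverse.2 (List.nodup_finRange _)
      · exact List.nodup_finRange _
    · split_ifs <;> simp
  rw [this]
  exact sum_map_single _ (List.nodup_finRange _) (List.mem_finRange _) _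

theorem biword_mem {m n u v : ℕ} (A : SuperMatrix m n u v) : A.biword ∈ Omega m n u v := by
  refine List.Pairwise.isChain ?_
  unfold SuperMatrix.biword
  rw [List.pairwise_flatMap]
  constructor
  · intro b' _
    rw [List.pairwise_flatMap]
    constructor
    · intro b _
      rw [List.pairwise_replicate]
      by_cases h : deg m n b = deg u v b'
      · right
        simp [h]
      · left
        exact A.le_one b b' h
    · have key : ∀ x y : Letter m n,
          SuperLex m n u v (x, b') (y, b') →
          ∀ p ∈ List.replicate (A.entry x b') (x, b'), ∀ q ∈ List.replicate (A.entry y b') (y, b'),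
            (SuperLex m n u v p q ∨ p = q) ∧ (deg m n p.1 ≠ deg u v p.2 → p ≠ q) := by
        intro x y hxy p hp q hq
        rw [List.eq_of_mem_replicate hp, List.eq_of_mem_replicate hq]
        refine ⟨Or.inl hxy, fun _ heq => ?_⟩
        rw [heq] at hxy
        exact SuperLex.irrefl _ hxy
      by_cases hd : deg u v b' = 0
      · rw [if_pos hd, List.pairwise_reverse]
        refine (List.pairwise_lt_finRange _).imp ?_
        intro x y hxy
        exact key y x (Or.inr (Or.inl ⟨rfl, hd, hxy⟩))
      · rw [if_neg hd]
        refine (List.pairwise_lt_finRange _).imp ?_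
        intro x y hxy
        refine key x y (Or.inr (Or.inr ⟨rfl, ?_, hxy⟩))
        unfold deg at hd ⊢
        split_ifs at hd ⊢ <;> simp_all
  · refine (List.pairwise_lt_finRange _).imp ?_
    intro x' y' hxy p hp q hq
    simp only [List.mem_flatMap, List.mem_replicate] at hp hq
    obtain ⟨x, -, -, rfl⟩ := hp
    obtain ⟨y, -, -, rfl⟩ := hq
    refine ⟨Or.inl (Or.inl hxy), fun _ heq => ?_⟩
    have : x' = y' := congrArg Prod.snd heq
    exact absurd this (ne_of_lt hxy)

theorem biword_unique {m n u v : ℕ} (A : SuperMatrix m n u v)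
    (w : List (Letter m n × Letter u v)) :
    (w ∈ Omega m n u v ∧ countMatrix w = A.entry) ↔ w = A.biword := by
  constructor
  · rintro ⟨hw, hA⟩
    have sorted : ∀ l ∈ Omega m n u v, l.Pairwise fun p q => SuperLex m n u v p q ∨ p = q := by
      intro l hl
      have : IsTrans (Letter m n × Letter u v) fun p q => SuperLex m n u v p q ∨ p = q :=
        ⟨by
          rintro p q r (h | rfl) (h' | rfl)
          · exact Or.inl (h.trans h')
          · exact Or.inl h
          · exact Or.inl h'
          · exact Or.inr rfl⟩
      exact (List.IsChain.imp (fun _ _ h => h.1) hl).pairwise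
    have hperm : w.Perm A.biword := by
      rw [List.perm_iff_count]
      rintro ⟨b, b'⟩
      have := hA.trans (count_biword A).symm
      exact congrFun (congrFun this b) b'
    refine hperm.eq_of_pairwise ?_ (sorted w hw) (sorted _ (biword_mem A))
    rintro p q _ _ (h | h) (h' | h')
    · exact absurd (h.trans h') (SuperLex.irrefl _)
    · exact h'.symm
    · exact h
    · exact h
  · rintro rfl
    exact ⟨biword_mem A, count_biword A⟩

end SuperKnuth

set_option linter.unusedSectionVars false

namespace SuperKnuth

/-! ### Column insertion for an abstract comparison relation -/

/-! Let R b x mean that b bumps x: b < x, or b = x is barred. A filling is semistandard exactly when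
R holds from left to right along rows and never from a lower to a higher entry of a column, so one
relation governs rows, columns and insertion. R and its complement are both transitive, and
Schensted's arguments need nothing else; they are therefore carried out for an abstract R and can
also be applied to strict orders.

Bijectivity of π is the Robinson–Schensted–Knuth correspondence. The bumping lemma (`bumpCol_lt`,
`bumpCol_le`) says that inserting the block of a barred letter of the second alphabet adds a
horizontal strip, with cells appearing from left to right, and that the block of an unbarred letter
adds a vertical strip, with cells appearing from right to left. Reverse bumping hence recovers each
block from the shapes before and after it. These shapes are recorded by the second tableau, although
that one is defined as P(l), by insertion of the word of the transpose. The reason is a symmetry: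
after standardization the two words become a permutation and its inverse, and the local growth rule
`colLens_growth` is symmetric, so both insertion tableaux have the same shape (`colLens_symm`,
`SuperMatrix.colLens_P₁_eq`). Applied to the matrix with its last columns deleted, this shows that
P₂ restricted to the first q letters has the shape of the tableau of the first q blocks
(`SuperMatrix.length_filter_P₂`).

For the crystals, the super Knuth relations on three letters respect ε, φ and the operators e.
Column insertion is a sequence of such relations, and the few columns where e alters the bumping
route are computed by hand; so P commutes with e and preserves the shape (`wordE_colInsert`,
`wordE_P`). Since P fixes the reading words of tableaux, tableaux are stable. The operators also
preserve the form of the blocks, so matrices are stable; and because the shapes of all prefixes are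
preserved, e acting on the first word leaves P₂ unchanged. Thus π is an isomorphism for the first
structure, and by transposition for the second. Commutation of the two structures on matrices is
then pulled back from the products of tableau crystals, where it is evident.

A highest weight matrix has both tableaux of the form H with a common shape, and injectivity of π
leaves one matrix for each shape. That it is A_λ follows by inserting the word of A_λ column by
column (`colP_hwWord`) for P₁; for P₂ the shape and the weight suffice (`eq_highestTableau`). The
Cauchy identity counts matrices by their row and column sums: directly, as a product over positions,
and through π, as a sum over pairs of tableaux. -/

/-- The properties of the relation `R b x` (`b` bumps `x`) that make column insertion work. -/
class IsBumpRel {α : Type*} (R : α → α → Prop) : Prop where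
  trans : ∀ {x y z}, R x y → R y z → R x z
  split : ∀ {x z} (y), R x z → R x y ∨ R y z

/-- Insertion of `b` into a column: `b` replaces the topmost entry `x` with `R b x`. -/
def colInsert {α : Type*} (R : α → α → Prop) [DecidableRel R] (b : α) : List α → List α × Option α
  | [] => ([b], none)
  | x :: c => if R b x then (b :: c, some x) else (x :: (colInsert R b c).1, (colInsert R b c).2)

/-- Column bumping. -/
def colBump {α : Type*} (R : α → α → Prop) [DecidableRel R] : List (List α) → α → List (List α)
  | [], b => [[b]]
  | c :: T, b =>
    match colInsert R b c with
    | (c', none) => c' :: T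
    | (c', some x) => c' :: colBump R T x

/-- The column in which the new cell appears. -/
def bumpCol {α : Type*} (R : α → α → Prop) [DecidableRel R] : List (List α) → α → ℕ
  | [], _ => 0
  | c :: T, b =>
    match colInsert R b c with
    | (_, none) => 0
    | (_, some x) => bumpCol R T x + 1

/-- The columns have the property that no entry bumps one above it. -/
def IsCol {α : Type*} (R : α → α → Prop) (c : List α) : Prop := c.Pairwise fun x y => ¬ R y x

/-- The column `t` may stand directly to the right of `s`. -/
def RowLe {α : Type*} (R : α → α → Prop) : List α → List α → Prop
  | _, [] => True
  | [], _ :: _ => False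
  | x :: s, y :: t => R x y ∧ RowLe R s t

/-- Semistandard tableaux with respect to `R`, as lists of columns. -/
structure IsTab {α : Type*} (R : α → α → Prop) (T : List (List α)) : Prop where
  ne_nil : ∀ c ∈ T, c ≠ []
  col : ∀ c ∈ T, IsCol R c
  row : T.IsChain (RowLe R)

/-- The column lengths of a tableau. -/
def colLens {α : Type*} (T : List (List α)) : ℕ → ℕ := fun j => (T.getD j []).length

section Insertion

variable {α : Type*} (R : α → α → Prop) [DecidableRel R]

/-- The normal form to which arguments about a single column are reduced: b comes to rest below
letters it cannot bump, or takes the place of the first letter that it bumps. -/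
theorem colInsert_cases (b : α) (c : List α) :
    ((∀ x ∈ c, ¬ R b x) ∧ colInsert R b c = (c ++ [b], none)) ∨
      ∃ p x q, c = p ++ x :: q ∧ (∀ y ∈ p, ¬ R b y) ∧ R b x ∧
        colInsert R b c = (p ++ b :: q, some x) := by
  induction c with
  | nil => left; simp [colInsert]
  | cons y c ih =>
    by_cases h : R b y
    · right
      exact ⟨[], y, c, by simp, by simp, h, by simp [colInsert, h]⟩
    · rcases ih with ⟨h1, h2⟩ | ⟨p, x, q, rfl, h1, h2, h3⟩
      · left
        simp only [colInsert, h, h2, if_false]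
        exact ⟨by simpa [h] using h1, rfl⟩
      · right
        refine ⟨y :: p, x, q, rfl, by simpa [h] using h1, h2, ?_⟩
        simp [colInsert, h, h3]

theorem colInsert_append_of_forall (b : α) (p q : List α) (h : ∀ y ∈ p, ¬ R b y) :
    colInsert R b (p ++ q) = (p ++ (colInsert R b q).1, (colInsert R b q).2) := by
  induction p with
  | nil => simp
  | cons y p ih =>
    simp only [List.mem_cons, forall_eq_or_imp] at h
    simp [colInsert, h.1, ih h.2]

theorem colInsert_eq_none_of_forall (b : α) (c : List α) (h : ∀ y ∈ c, ¬ R b y) :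
    colInsert R b c = (c ++ [b], none) := by
  simpa [colInsert] using colInsert_append_of_forall R b c [] h

theorem colInsert_eq_some (b x : α) (p q : List α) (h : ∀ y ∈ p, ¬ R b y) (hx : R b x) :
    colInsert R b (p ++ x :: q) = (p ++ b :: q, some x) := by
  simp [colInsert_append_of_forall R b p _ h, colInsert, hx]

variable {R}

theorem rel_of_colInsert {b x : α} {c c' : List α} (h : colInsert R b c = (c', some x)) :
    R b x := by
  rcases colInsert_cases R b c with ⟨-, h2⟩ | ⟨p, y, q, -, -, hy, h2⟩
  · simp [h2] at h
  · simp only [h2, Prod.mk.injEq, Option.some.injEq] at h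
    exact h.2 ▸ hy

theorem mem_of_colInsert {b x : α} {c c' : List α} (h : colInsert R b c = (c', some x)) :
    x ∈ c := by
  rcases colInsert_cases R b c with ⟨-, h2⟩ | ⟨p, y, q, rfl, -, hy, h2⟩
  · simp [h2] at h
  · simp only [h2, Prod.mk.injEq, Option.some.injEq] at h
    simp [h.2]

theorem mem_colInsert (b : α) (c : List α) : b ∈ (colInsert R b c).1 := by
  rcases colInsert_cases R b c with ⟨-, h2⟩ | ⟨p, y, q, rfl, -, hy, h2⟩ <;> simp [h2]

theorem colInsert_none_eq {b : α} {c c' : List α} (h : colInsert R b c = (c', none)) :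
    c' = c ++ [b] ∧ ∀ x ∈ c, ¬ R b x := by
  rcases colInsert_cases R b c with ⟨h1, h2⟩ | ⟨p, y, q, -, -, hy, h2⟩
  · simp only [h2, Prod.mk.injEq] at h
    exact ⟨h.1.symm, h1⟩
  · simp [h2] at h

theorem colInsert_length_some {b x : α} {c c' : List α} (h : colInsert R b c = (c', some x)) :
    c'.length = c.length := by
  rcases colInsert_cases R b c with ⟨-, h2⟩ | ⟨p, y, q, rfl, -, hy, h2⟩
  · simp [h2] at h
  · simp only [h2, Prod.mk.injEq] at h
    simp [← h.1]

theorem colInsert_ne_nil (b : α) (c : List α) : (colInsert R b c).1 ≠ [] :=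
  List.ne_nil_of_mem (mem_colInsert b c)

/-- The entries above the place of b are those that b failed to bump; an entry below it that bumped
b would, by transitivity, bump the old entry x. -/
theorem IsCol.colInsert [IsBumpRel R] {c : List α} (hc : IsCol R c) (b : α) :
    IsCol R (colInsert R b c).1 := by
  rcases colInsert_cases R b c with ⟨h1, h2⟩ | ⟨p, x, q, rfl, h1, hx, h2⟩
  · rw [h2]
    unfold IsCol at *
    simp only [List.pairwise_append, List.pairwise_cons]
    simp_all
  · rw [h2]
    unfold IsCol at *
    simp only [List.pairwise_append, List.pairwise_cons, List.mem_cons] at hc ⊢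
    refine ⟨hc.1, ⟨fun y hy hyb => hc.2.1.1 y hy (IsBumpRel.trans hyb hx), hc.2.1.2⟩, ?_⟩
    rintro a ha z (rfl | hz)
    · exact h1 a ha
    · exact hc.2.2 a ha z (Or.inr hz)

theorem RowLe.nil (s : List α) : RowLe R s [] := by
  cases s <;> trivial

theorem RowLe.append {s t : List α} (h : RowLe R s t) (r : List α) : RowLe R (s ++ r) t := by
  induction s generalizing t with
  | nil => cases t with
    | nil => exact RowLe.nil _
    | cons y t => exact h.elim
  | cons x s ih => cases t with
    | nil => exact RowLe.nil _
    | cons y t => exact ⟨h.1, ih h.2⟩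

theorem RowLe.length_le {s t : List α} (h : RowLe R s t) : t.length ≤ s.length := by
  induction s generalizing t with
  | nil => cases t with
    | nil => simp
    | cons y t => exact h.elim
  | cons x s ih => cases t with
    | nil => simp
    | cons y t => simpa using ih h.2

theorem RowLe.exists_rel {s t : List α} (h : RowLe R s t) {y : α} (hy : y ∈ t) :
    ∃ x ∈ s, R x y := by
  induction s generalizing t with
  | nil => cases t with
    | nil => simp at hy
    | cons y t => exact h.elim
  | cons x s ih => cases t with
    | nil => simp at hy
    | cons z t =>
      rcases List.mem_cons.1 hy with rfl | hy
      · exact ⟨x, by simp, h.1⟩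
      · obtain ⟨a, ha, hR⟩ := ih h.2 hy
        exact ⟨a, by simp [ha], hR⟩

theorem RowLe.of_append_singleton {s t : List α} {b : α} (h : RowLe R (s ++ [b]) t)
    (hl : t.length ≤ s.length) : RowLe R s t := by
  induction s generalizing t with
  | nil => cases t with
    | nil => exact RowLe.nil _
    | cons y t => simp at hl
  | cons x s ih => cases t with
    | nil => exact RowLe.nil _
    | cons z t => exact ⟨h.1, ih h.2 (by simpa using hl)⟩

theorem RowLe.colInsert_left [IsBumpRel R] {s s' t : List α} {b x : α} (h : RowLe R s t)
    (hs : colInsert R b s = (s', some x)) : RowLe R s' t := by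
  induction s generalizing t s' with
  | nil => simp [SuperKnuth.colInsert] at hs
  | cons y s ih =>
    rw [SuperKnuth.colInsert] at hs
    cases t with
    | nil => exact RowLe.nil _
    | cons z t =>
      split_ifs at hs with hb
      · simp only [Prod.mk.injEq, Option.some.injEq] at hs
        rw [← hs.1]
        exact ⟨IsBumpRel.trans hb h.1, h.2⟩
      · simp only [Prod.mk.injEq] at hs
        rw [← hs.1]
        exact ⟨h.1, ih h.2 (Prod.ext rfl hs.2)⟩

/-- The bumped letter x cannot sink below its old row, since it bumps its old right neighbour. It
lands beside b, or higher up beside an entry y that b does not bump; in the latter case R b x and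
`split` give R y x. -/
theorem RowLe.colInsert_both [IsBumpRel R] {s s' t : List α} {b x : α} (h : RowLe R s t)
    (hs : colInsert R b s = (s', some x)) : RowLe R s' (colInsert R x t).1 := by
  induction s generalizing t s' with
  | nil => simp [SuperKnuth.colInsert] at hs
  | cons y s ih =>
    have hbx := rel_of_colInsert hs
    rw [SuperKnuth.colInsert] at hs
    split_ifs at hs with hb
    · simp only [Prod.mk.injEq, Option.some.injEq] at hs
      obtain ⟨rfl, rfl⟩ := hs
      cases t with
      | nil => exact ⟨hbx, RowLe.nil _⟩
      | cons z t =>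
        rw [SuperKnuth.colInsert, if_pos h.1]
        exact ⟨hbx, h.2⟩
    · simp only [Prod.mk.injEq] at hs
      obtain ⟨rfl, hs⟩ := hs
      have hyx : R y x := (IsBumpRel.split y hbx).resolve_left hb
      cases t with
      | nil => exact ⟨hyx, RowLe.nil _⟩
      | cons z t =>
        rw [SuperKnuth.colInsert]
        split_ifs with hz
        · exact ⟨hyx, h.2.colInsert_left (Prod.ext rfl hs)⟩
        · exact ⟨h.1, ih h.2 (Prod.ext rfl hs)⟩

theorem RowLe.of_colInsert_left [IsBumpRel R] {s s' t : List α} {b x : α} (h : RowLe R s' t)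
    (hs : colInsert R b s = (s', some x)) (ht : ∀ w ∈ t, R x w) : RowLe R s t := by
  induction s generalizing t s' with
  | nil => simp [SuperKnuth.colInsert] at hs
  | cons y s ih =>
    rw [SuperKnuth.colInsert] at hs
    cases t with
    | nil => exact RowLe.nil _
    | cons z t =>
      split_ifs at hs with hb
      · simp only [Prod.mk.injEq, Option.some.injEq] at hs
        obtain ⟨rfl, rfl⟩ := hs
        exact ⟨ht z (by simp), h.2⟩
      · simp only [Prod.mk.injEq] at hs
        obtain ⟨rfl, hs⟩ := hs
        exact ⟨h.1, ih h.2 (Prod.ext rfl hs) fun w hw => ht w (by simp [hw])⟩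

/-- Undoes `RowLe.colInsert_both`; together they show that bumping and reverse bumping both respect
the row condition. If x landed above its old row, the rows in between are handled by
`RowLe.of_colInsert_left`, since x bumps all entries below the one it replaced. -/
theorem RowLe.of_colInsert_both [IsBumpRel R] {s s' t : List α} {b x : α}
    (h : RowLe R s' (colInsert R x t).1) (hs : colInsert R b s = (s', some x)) (hsc : IsCol R s)
    (htc : IsCol R t) : RowLe R s t := by
  induction s generalizing t s' with
  | nil => simp [SuperKnuth.colInsert] at hs
  | cons y s ih =>
    cases t with
    | nil => exact RowLe.nil _
    | cons z t =>
      rw [IsCol, List.pairwise_cons] at hsc htc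
      rw [SuperKnuth.colInsert] at hs h
      split_ifs at hs with hb
      · simp only [Prod.mk.injEq, Option.some.injEq] at hs
        obtain ⟨rfl, rfl⟩ := hs
        split_ifs at h with hz
        · exact ⟨hz, h.2⟩
        -- Otherwise the bumped letter would have landed below its old row, beside an entry of s
        -- that bumps it and lies underneath it, which a column forbids.
        · obtain ⟨w, hw, hwy⟩ := h.2.exists_rel (mem_colInsert y t)
          exact (hsc.1 w hw hwy).elim
      · simp only [Prod.mk.injEq] at hs
        obtain ⟨rfl, hs⟩ := hs
        split_ifs at h with hz
        · exact ⟨IsBumpRel.trans h.1 hz, h.2.of_colInsert_left (Prod.ext rfl hs) fun w hw =>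
            (IsBumpRel.split w hz).resolve_right (htc.1 w hw)⟩
        · exact ⟨h.1, ih h.2 (Prod.ext rfl hs) hsc.2 htc.2⟩

/-! ### Bumping -/

theorem colBump_cons_none {b : α} {c c' : List α} {T : List (List α)}
    (h : colInsert R b c = (c', none)) : colBump R (c :: T) b = c' :: T := by
  rw [colBump, h]

theorem colBump_cons_some {b x : α} {c c' : List α} {T : List (List α)}
    (h : colInsert R b c = (c', some x)) : colBump R (c :: T) b = c' :: colBump R T x := by
  rw [colBump, h]

theorem bumpCol_cons_none {b : α} {c c' : List α} {T : List (List α)}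
    (h : colInsert R b c = (c', none)) : bumpCol R (c :: T) b = 0 := by
  rw [bumpCol, h]

theorem bumpCol_cons_some {b x : α} {c c' : List α} {T : List (List α)}
    (h : colInsert R b c = (c', some x)) : bumpCol R (c :: T) b = bumpCol R T x + 1 := by
  rw [bumpCol, h]

theorem colInsert_eq_or (R : α → α → Prop) [DecidableRel R] (b : α) (c : List α) :
    (∃ c', colInsert R b c = (c', none)) ∨ ∃ c' x, colInsert R b c = (c', some x) := by
  rcases h : colInsert R b c with ⟨c', _ | x⟩
  · exact Or.inl ⟨c', rfl⟩
  · exact Or.inr ⟨c', x, rfl⟩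

theorem colBump_head [IsBumpRel R] {b x : α} {s s' : List α} {T : List (List α)}
    (h : (s :: T).IsChain (RowLe R)) (hs : colInsert R b s = (s', some x)) :
    ∀ t ∈ (colBump R T x).head?, RowLe R s' t := by
  cases T with
  | nil =>
    intro t ht
    have : t = [x] := by simpa [colBump, eq_comm] using ht
    subst this
    simpa [colInsert] using RowLe.colInsert_both (RowLe.nil s) hs
  | cons t T =>
    have := (List.isChain_cons_cons.1 h).1.colInsert_both hs
    intro r hr
    rcases colInsert_eq_or R x t with ⟨c', h'⟩ | ⟨c', y, h'⟩
    · rw [colBump_cons_none h'] at hr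
      simp only [List.head?_cons, Option.mem_def, Option.some.injEq] at hr
      rwa [h', hr] at this
    · rw [colBump_cons_some h'] at hr
      simp only [List.head?_cons, Option.mem_def, Option.some.injEq] at hr
      rwa [h', hr] at this

theorem IsTab.tail {c : List α} {T : List (List α)} (h : IsTab R (c :: T)) : IsTab R T :=
  ⟨fun d hd => h.ne_nil d (by simp [hd]), fun d hd => h.col d (by simp [hd]), h.row.tail⟩

theorem IsTab.nil : IsTab R ([] : List (List α)) := ⟨by simp, by simp, by simp⟩

theorem isTab_cons_iff {c : List α} {T : List (List α)} :
    IsTab R (c :: T) ↔ c ≠ [] ∧ IsCol R c ∧ (∀ t ∈ T.head?, RowLe R c t) ∧ IsTab R T := by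
  constructor
  · intro h
    exact ⟨h.ne_nil c (by simp), h.col c (by simp), (List.isChain_cons.1 h.row).1, h.tail⟩
  · rintro ⟨h1, h2, h3, h4⟩
    exact ⟨by simpa [h1] using h4.ne_nil, by simpa [h2] using h4.col,
      List.isChain_cons.2 ⟨h3, h4.row⟩⟩

theorem IsTab.colBump [IsBumpRel R] {T : List (List α)} (h : IsTab R T) (b : α) :
    IsTab R (colBump R T b) := by
  induction T generalizing b with
  | nil => simp [SuperKnuth.colBump, isTab_cons_iff, IsTab.nil, IsCol]
  | cons c T ih =>
    have h' := isTab_cons_iff.1 h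
    rcases colInsert_eq_or R b c with ⟨c', hc⟩ | ⟨c', x, hc⟩
    · rw [colBump_cons_none hc, isTab_cons_iff]
      refine ⟨?_, ?_, ?_, h'.2.2.2⟩
      · simpa [hc] using colInsert_ne_nil (R := R) b c
      · simpa [hc] using h'.2.1.colInsert b
      · intro t ht
        rw [(colInsert_none_eq hc).1]
        exact (h'.2.2.1 t ht).append _
    · rw [colBump_cons_some hc, isTab_cons_iff]
      refine ⟨?_, ?_, colBump_head h.row hc, ih h'.2.2.2 x⟩
      · simpa [hc] using colInsert_ne_nil (R := R) b c
      · simpa [hc] using h'.2.1.colInsert b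

theorem colLens_cons_zero (c : List α) (T : List (List α)) : colLens (c :: T) 0 = c.length := rfl

theorem colLens_cons_succ (c : List α) (T : List (List α)) (j : ℕ) :
    colLens (c :: T) (j + 1) = colLens T j := by simp [colLens]

theorem colLens_colBump (T : List (List α)) (b : α) (j : ℕ) :
    colLens (colBump R T b) j = colLens T j + if j = bumpCol R T b then 1 else 0 := by
  induction T generalizing b j with
  | nil =>
    cases j with
    | zero => simp [colBump, bumpCol, colLens]
    | succ j => simp [colBump, bumpCol, colLens]
  | cons c T ih =>
    rcases colInsert_eq_or R b c with ⟨c', hc⟩ | ⟨c', x, hc⟩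
    · rw [colBump_cons_none hc, bumpCol_cons_none hc, (colInsert_none_eq hc).1]
      cases j <;> simp [colLens]
    · rw [colBump_cons_some hc, bumpCol_cons_some hc]
      cases j with
      | zero => simp [colLens, colInsert_length_some hc]
      | succ j => simp [colLens_cons_succ, ih]

/-! ### The bumping lemma -/

/-- After the first insertion b is available as a victim for b'. Either b' bumps b itself, or it
bumps an entry above b which b could not bump; by `split` such an entry also bumps x. -/
theorem colInsert_rel_some [IsBumpRel R] {b b' x : α} {c c' : List α} (hb : R b' b)
    (hc : colInsert R b c = (c', some x)) :
    ∃ d x', colInsert R b' c' = (d, some x') ∧ R x' x := by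
  induction c generalizing c' with
  | nil => simp [colInsert] at hc
  | cons y c ih =>
    have hbx := rel_of_colInsert hc
    rw [colInsert] at hc
    split_ifs at hc with hy
    · simp only [Prod.mk.injEq, Option.some.injEq] at hc
      obtain ⟨rfl, rfl⟩ := hc
      exact ⟨b' :: c, b, by simp [colInsert, hb], hy⟩
    · simp only [Prod.mk.injEq] at hc
      obtain ⟨rfl, hc⟩ := hc
      by_cases hy' : R b' y
      · exact ⟨_, y, by rw [colInsert, if_pos hy'],
          (IsBumpRel.split y hbx).resolve_left hy⟩
      · obtain ⟨d, x', h1, h2⟩ := ih (Prod.ext rfl hc)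
        exact ⟨y :: d, x', by simp [colInsert, hy', h1], h2⟩

/-- Here b' passes b and everything above it, so its victim stood below x in the original column. -/
theorem colInsert_not_rel_some {b b' x x' : α} {c c' d : List α} (hcol : IsCol R c)
    (hb : ¬ R b' b) [IsBumpRel R]
    (hc : colInsert R b c = (c', some x)) (hd : colInsert R b' c' = (d, some x')) : ¬ R x' x := by
  rcases colInsert_cases R b c with ⟨h1, h2⟩ | ⟨p, y, q, rfl, h1, hx, h2⟩
  · simp [h2] at hc
  · simp only [h2, Prod.mk.injEq, Option.some.injEq] at hc
    obtain ⟨rfl, rfl⟩ := hc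
    rw [IsCol, List.pairwise_append] at hcol
    have hp : ∀ z ∈ p ++ [b], ¬ R b' z := by
      intro z hz
      simp only [List.mem_append, List.mem_singleton] at hz
      rcases hz with hz | rfl
      · intro h
        rcases IsBumpRel.split b h with h | h
        · exact hb h
        · exact h1 z hz h
      · exact hb
    have : p ++ b :: q = (p ++ [b]) ++ q := by simp
    rw [this, colInsert_append_of_forall R b' _ q hp] at hd
    simp only [Prod.mk.injEq] at hd
    have hq := mem_of_colInsert (R := R) (b := b') (x := x') (c := q) (Prod.ext rfl hd.2)
    exact (List.pairwise_cons.1 hcol.2.1).1 x' hq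

theorem colInsert_not_rel_none [IsBumpRel R] {b b' : α} {c c' : List α} (hb : ¬ R b' b)
    (hc : colInsert R b c = (c', none)) : ∃ d, colInsert R b' c' = (d, none) := by
  obtain ⟨rfl, h⟩ := colInsert_none_eq hc
  refine ⟨_, colInsert_eq_none_of_forall R b' _ ?_⟩
  intro z hz
  simp only [List.mem_append, List.mem_singleton] at hz
  rcases hz with hz | rfl
  · intro h'
    rcases IsBumpRel.split b h' with h' | h'
    · exact hb h'
    · exact h z hz h'
  · exact hb

/-- The relation between the two inserted letters is inherited by the letters they bump, column
after column. Where the first route ends, the second letter still finds something to bump and moves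
on. -/
theorem bumpCol_lt [IsBumpRel R] {T : List (List α)} {b b' : α} (hb : R b' b) :
    bumpCol R T b < bumpCol R (colBump R T b) b' := by
  induction T generalizing b b' with
  | nil => simp [bumpCol, colBump, colInsert, hb]
  | cons c T ih =>
    rcases colInsert_eq_or R b c with ⟨c', hc⟩ | ⟨c', x, hc⟩
    · rw [bumpCol_cons_none hc, colBump_cons_none hc]
      obtain ⟨rfl, h⟩ := colInsert_none_eq hc
      rcases colInsert_eq_or R b' (c ++ [b]) with ⟨d, hd⟩ | ⟨d, y, hd⟩
      · exact absurd hb ((colInsert_none_eq hd).2 b (by simp))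
      · rw [bumpCol_cons_some hd]; omega
    · rw [bumpCol_cons_some hc, colBump_cons_some hc]
      obtain ⟨d, x', hd, hx⟩ := colInsert_rel_some hb hc
      rw [bumpCol_cons_some hd]
      exact Nat.succ_lt_succ (ih hx)

/-- The failure of the relation is inherited in the same way, and where the first route ends the
second must end as well, unless it has ended before. -/
theorem bumpCol_le [IsBumpRel R] {T : List (List α)} (hT : ∀ c ∈ T, IsCol R c) {b b' : α}
    (hb : ¬ R b' b) : bumpCol R (colBump R T b) b' ≤ bumpCol R T b := by
  induction T generalizing b b' with
  | nil => simp [bumpCol, colBump, colInsert, hb]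
  | cons c T ih =>
    rcases colInsert_eq_or R b c with ⟨c', hc⟩ | ⟨c', x, hc⟩
    · rw [bumpCol_cons_none hc, colBump_cons_none hc]
      obtain ⟨d, hd⟩ := colInsert_not_rel_none hb hc
      rw [bumpCol_cons_none hd]
    · rw [bumpCol_cons_some hc, colBump_cons_some hc]
      rcases colInsert_eq_or R b' c' with ⟨d, hd⟩ | ⟨d, y, hd⟩
      · rw [bumpCol_cons_none hd]; omega
      · rw [bumpCol_cons_some hd]
        exact Nat.succ_le_succ (ih (fun e he => hT e (by simp [he]))
          (colInsert_not_rel_some (hT c (by simp)) hb hc hd))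

/-! ### Reverse bumping -/

theorem split_last_unique {β : Type*} {p : β → Prop} {l₁ l₂ r₁ r₂ : List β} {a b : β}
    (h : l₁ ++ a :: r₁ = l₂ ++ b :: r₂) (ha : p a) (hb : p b) (h₁ : ∀ x ∈ r₁, ¬ p x)
    (h₂ : ∀ x ∈ r₂, ¬ p x) : l₁ = l₂ ∧ a = b ∧ r₁ = r₂ := by
  induction l₁ generalizing l₂ with
  | nil =>
    cases l₂ with
    | nil => simpa using h
    | cons y l₂ =>
      simp only [List.nil_append, List.cons_append, List.cons.injEq] at h
      exact absurd hb (h₁ b (by simp [h.2]))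
  | cons x l₁ ih =>
    cases l₂ with
    | nil =>
      simp only [List.nil_append, List.cons_append, List.cons.injEq] at h
      exact absurd ha (h₂ a (by simp [← h.2]))
    | cons y l₂ =>
      simp only [List.cons_append, List.cons.injEq] at h
      obtain ⟨h3, h4, h5⟩ := ih h.2
      exact ⟨by rw [h.1, h3], h4, h5⟩

/-- In the new column b is the last entry that bumps x: what follows it stood below x in a column.
This identifies the place of the exchange. -/
theorem colInsert_injective {b b' x : α} {c c' d : List α} (hc : IsCol R c) (hc' : IsCol R c')
    (h : colInsert R b c = (d, some x)) (h' : colInsert R b' c' = (d, some x)) :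
    b = b' ∧ c = c' := by
  rcases colInsert_cases R b c with ⟨-, h2⟩ | ⟨p, y, q, rfl, -, hx, h2⟩
  · simp [h2] at h
  rcases colInsert_cases R b' c' with ⟨-, h2'⟩ | ⟨p', y', q', rfl, -, hx', h2'⟩
  · simp [h2'] at h'
  simp only [h2, h2', Prod.mk.injEq, Option.some.injEq] at h h'
  obtain ⟨rfl, rfl⟩ := h
  obtain ⟨h3, rfl⟩ := h'
  rw [IsCol, List.pairwise_append] at hc hc'
  obtain ⟨rfl, rfl, rfl⟩ := split_last_unique (p := fun z => R z y') h3 hx' hx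
    (List.pairwise_cons.1 hc'.2.1).1 (List.pairwise_cons.1 hc.2.1).1
  exact ⟨rfl, rfl⟩

/-- The column of the new cell tells where the route ended, hence in which columns a letter was
exchanged; each exchange is undone by `colInsert_injective`, from right to left. -/
theorem colBump_injective {T T' : List (List α)} (hT : IsTab R T) (hT' : IsTab R T') {b b' : α}
    (h : colBump R T b = colBump R T' b') (hcol : bumpCol R T b = bumpCol R T' b') :
    T = T' ∧ b = b' := by
  induction T generalizing T' b b' with
  | nil =>
    cases T' with
    | nil => simpa [colBump] using h
    | cons c' T' =>
      rcases colInsert_eq_or R b' c' with ⟨d, hd⟩ | ⟨d, x, hd⟩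
      · rw [colBump_cons_none hd, (colInsert_none_eq hd).1] at h
        -- Non-emptiness of the columns matters here: insertion into `[]` and into `[[]]` gives the
        -- same result.
        have hne := hT'.ne_nil c' (by simp)
        simp only [colBump, List.cons.injEq] at h
        rcases c' with _ | ⟨y, c'⟩
        · exact absurd rfl hne
        · simp at h
      · rw [bumpCol_cons_some hd] at hcol
        simp [bumpCol] at hcol
  | cons c T ih =>
    have ht := isTab_cons_iff.1 hT
    rcases colInsert_eq_or R b c with ⟨d, hd⟩ | ⟨d, x, hd⟩
    · cases T' with
      | nil =>
        rw [colBump_cons_none hd, (colInsert_none_eq hd).1] at h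
        simp only [colBump, List.cons.injEq] at h
        rcases c with _ | ⟨y, c⟩
        · exact absurd rfl ht.1
        · simp at h
      | cons c' T' =>
        rcases colInsert_eq_or R b' c' with ⟨d', hd'⟩ | ⟨d', x', hd'⟩
        · rw [colBump_cons_none hd, colBump_cons_none hd', (colInsert_none_eq hd).1,
            (colInsert_none_eq hd').1] at h
          simp only [List.cons.injEq] at h
          obtain ⟨h1, h2⟩ := List.append_inj' h.1 rfl
          simp only [List.cons.injEq, and_true] at h2
          exact ⟨by rw [h1, h.2], h2⟩
        · rw [bumpCol_cons_some hd', bumpCol_cons_none hd] at hcol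
          omega
    · cases T' with
      | nil =>
        rw [bumpCol_cons_some hd] at hcol
        simp [bumpCol] at hcol
      | cons c' T' =>
        have ht' := isTab_cons_iff.1 hT'
        rcases colInsert_eq_or R b' c' with ⟨d', hd'⟩ | ⟨d', x', hd'⟩
        · rw [bumpCol_cons_some hd, bumpCol_cons_none hd'] at hcol
          omega
        · rw [bumpCol_cons_some hd, bumpCol_cons_some hd'] at hcol
          rw [colBump_cons_some hd, colBump_cons_some hd'] at h
          simp only [List.cons.injEq] at h
          obtain ⟨rfl, rfl⟩ := ih ht.2.2.2 ht'.2.2.2 h.2 (by omega)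
          obtain ⟨rfl, rfl⟩ := colInsert_injective ht.2.1 ht'.2.1 hd (h.1 ▸ hd')
          exact ⟨rfl, rfl⟩

theorem exists_split_last {β : Type*} (p : β → Prop) (l : List β) (h : ∃ x ∈ l, p x) :
    ∃ l₁ a l₂, l = l₁ ++ a :: l₂ ∧ p a ∧ ∀ x ∈ l₂, ¬ p x := by
  induction l with
  | nil => simp at h
  | cons y l ih =>
    by_cases hl : ∃ x ∈ l, p x
    · obtain ⟨l₁, a, l₂, rfl, h1, h2⟩ := ih hl
      exact ⟨y :: l₁, a, l₂, rfl, h1, h2⟩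
    · push Not at hl
      obtain ⟨x, hx, hpx⟩ := h
      rcases List.mem_cons.1 hx with rfl | hx
      · exact ⟨[], x, l, rfl, hpx, hl⟩
      · exact absurd hpx (hl x hx)

theorem exists_colInsert [IsBumpRel R] {x : α} {d : List α} (hd : IsCol R d)
    (h : ∃ y ∈ d, R y x) : ∃ c b, IsCol R c ∧ colInsert R b c = (d, some x) := by
  obtain ⟨p, b, q, rfl, hb, hq⟩ := exists_split_last (fun y => R y x) d h
  rw [IsCol, List.pairwise_append] at hd
  have hp : ∀ y ∈ p, ¬ R b y := fun y hy => hd.2.2 y hy b (by simp)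
  refine ⟨p ++ x :: q, b, ?_, colInsert_eq_some R b x p q hp hb⟩
  rw [IsCol, List.pairwise_append]
  refine ⟨hd.1, List.pairwise_cons.2 ⟨hq, (List.pairwise_cons.1 hd.2.1).2⟩, ?_⟩
  intro y hy z hz
  rcases List.mem_cons.1 hz with rfl | hz
  · intro hzy
    exact hp y hy (IsBumpRel.trans hb hzy)
  · exact hd.2.2 y hy z (by simp [hz])

/-- The hypothesis says that the bottom cell of column a is a corner. It is removed, and its letter
is pushed back through the columns to the left, one exchange in each. -/
theorem exists_colBump [IsBumpRel R] {T : List (List α)} (hT : IsTab R T) {a : ℕ}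
    (ha : colLens T (a + 1) < colLens T a) :
    ∃ T' b, IsTab R T' ∧ colBump R T' b = T ∧ bumpCol R T' b = a := by
  induction T generalizing a with
  | nil => simp [colLens] at ha
  | cons c T ih =>
    obtain ⟨hne, hcol, hrow, hT'⟩ := isTab_cons_iff.1 hT
    cases a with
    | zero =>
      obtain ⟨c₀, b, rfl⟩ := List.eq_nil_or_concat c |>.resolve_left hne
      rw [colLens_cons_succ, colLens_cons_zero] at ha
      by_cases hc₀ : c₀ = []
      · subst hc₀
        have : T = [] := by
          cases T with
          | nil => rfl
          | cons t T =>
            have := List.length_pos_iff.2 (hT'.ne_nil t (by simp))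
            simp [colLens] at ha
            simp [ha] at this
        subst this
        exact ⟨[], b, IsTab.nil, rfl, rfl⟩
      · rw [List.concat_eq_append] at *
        rw [IsCol, List.pairwise_append] at hcol
        have hins : colInsert R b c₀ = (c₀ ++ [b], none) :=
          colInsert_eq_none_of_forall R b c₀ fun y hy => hcol.2.2 y hy b (by simp)
        refine ⟨c₀ :: T, b, isTab_cons_iff.2 ⟨hc₀, hcol.1, ?_, hT'⟩, colBump_cons_none hins,
          bumpCol_cons_none hins⟩
        intro t ht
        refine (hrow t ht).of_append_singleton ?_
        cases T with
        | nil => simp at ht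
        | cons t' T =>
          simp only [List.head?_cons, Option.mem_def, Option.some.injEq] at ht
          subst ht
          simp [colLens] at ha
          omega
    | succ a =>
      rw [colLens_cons_succ, colLens_cons_succ] at ha
      obtain ⟨T₂, x, h1, rfl, h3⟩ := ih hT' ha
      -- The letter x to be pushed back stands in the first column on the right of c, so its left
      -- neighbour in c bumps it; this gives a letter that x can displace backwards.
      have key : ∃ y ∈ c, R y x := by
        cases T₂ with
        | nil => exact (hrow [x] (by simp [colBump])).exists_rel (by simp)
        | cons t T₂ =>
          refine (hrow (colInsert R x t).1 ?_).exists_rel (mem_colInsert x t)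
          rcases colInsert_eq_or R x t with ⟨c', hc⟩ | ⟨c', y, hc⟩
          · simp [colBump_cons_none hc, hc]
          · simp [colBump_cons_some hc, hc]
      obtain ⟨c₀, b, hc₀, hins⟩ := exists_colInsert hcol key
      refine ⟨c₀ :: T₂, b, isTab_cons_iff.2 ⟨?_, hc₀, ?_, h1⟩, colBump_cons_some hins, ?_⟩
      · exact List.ne_nil_of_mem (mem_of_colInsert hins)
      · intro t ht
        cases T₂ with
        | nil => simp at ht
        | cons t' T₂ =>
          simp only [List.head?_cons, Option.mem_def, Option.some.injEq] at ht
          subst ht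
          refine RowLe.of_colInsert_both (hrow _ ?_) hins hc₀ (h1.col _ (by simp))
          rcases colInsert_eq_or R x t' with ⟨c', hc⟩ | ⟨c', y, hc⟩
          · simp [colBump_cons_none hc, hc]
          · simp [colBump_cons_some hc, hc]
      · rw [bumpCol_cons_some hins, h3]

theorem IsTab.colLens_anti {T : List (List α)} (hT : IsTab R T) (j : ℕ) :
    colLens T (j + 1) ≤ colLens T j := by
  induction T generalizing j with
  | nil => simp [colLens]
  | cons c T ih =>
    obtain ⟨-, -, hrow, hT'⟩ := isTab_cons_iff.1 hT
    cases j with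
    | zero =>
      cases T with
      | nil => simp [colLens]
      | cons t T => simpa [colLens] using (hrow t (by simp)).length_le
    | succ j => simpa [colLens_cons_succ] using ih hT' j

end Insertion

end SuperKnuth

namespace SuperKnuth

/-! ### Insertion of words: strips of new cells, passage through one column, restriction to small
letters -/

section Words

variable {α : Type*} (R : α → α → Prop) [DecidableRel R]

/-- The insertion tableau of a word. -/
def colP (w : List α) : List (List α) := w.foldl (colBump R) []

/-- The columns in which new cells appear when a word is inserted. -/
def insCols : List (List α) → List α → List ℕ
  | _, [] => []
  | T, b :: w => bumpCol R T b :: insCols (colBump R T b) w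

variable {R}

theorem IsTab.foldl [IsBumpRel R] {T : List (List α)} (hT : IsTab R T) (w : List α) :
    IsTab R (w.foldl (SuperKnuth.colBump R) T) := by
  induction w generalizing T with
  | nil => exact hT
  | cons b w ih => exact ih (hT.colBump b)

theorem isTab_colP [IsBumpRel R] (w : List α) : IsTab R (colP R w) := IsTab.nil.foldl w

theorem colLens_foldl (T : List (List α)) (w : List α) (j : ℕ) :
    colLens (w.foldl (colBump R) T) j = colLens T j + (insCols R T w).count j := by
  induction w generalizing T with
  | nil => simp [insCols]
  | cons b w ih =>
    rw [List.foldl_cons, ih, colLens_colBump, insCols, List.count_cons]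
    by_cases h : j = bumpCol R T b
    · simp [h]; omega
    · have : ¬ bumpCol R T b = j := fun h' => h h'.symm
      simp [h, this]

theorem insCols_strictMono [IsBumpRel R] (T : List (List α)) {w : List α}
    (hw : w.Pairwise fun x y => R y x) : (insCols R T w).Pairwise (· < ·) := by
  have : ∀ (w : List α) (T : List (List α)), (w.IsChain fun x y => R y x) →
      (insCols R T w).IsChain (· < ·) := by
    intro w
    induction w with
    | nil => intro T _; simp [insCols]
    | cons b w ih =>
      intro T hw
      cases w with
      | nil => simp [insCols]
      | cons b' w =>
        rw [List.isChain_cons_cons] at hw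
        have := ih (colBump R T b) hw.2
        rw [insCols, insCols, List.isChain_cons_cons]
        exact ⟨bumpCol_lt hw.1, by simpa [insCols] using this⟩
  exact (this w T hw.isChain).pairwise

theorem insCols_antitone [IsBumpRel R] {T : List (List α)} (hT : IsTab R T) {w : List α}
    (hw : w.Pairwise fun x y => ¬ R y x) : (insCols R T w).Pairwise (· ≥ ·) := by
  have : ∀ (w : List α) (T : List (List α)), IsTab R T → (w.IsChain fun x y => ¬ R y x) →
      (insCols R T w).IsChain (· ≥ ·) := by
    intro w
    induction w with
    | nil => intro T _ _; simp [insCols]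
    | cons b w ih =>
      intro T hT hw
      cases w with
      | nil => simp [insCols]
      | cons b' w =>
        rw [List.isChain_cons_cons] at hw
        have := ih (colBump R T b) (hT.colBump b) hw.2
        rw [insCols, insCols, List.isChain_cons_cons]
        exact ⟨bumpCol_le hT.col hw.1, by simpa [insCols] using this⟩
  exact (this w T hT hw.isChain).pairwise

/-- The sequence of columns of the new cells is exactly the information needed to run the insertion
backwards. -/
theorem foldl_colBump_injective [IsBumpRel R] {T T' : List (List α)} (hT : IsTab R T)
    (hT' : IsTab R T') {w w' : List α}
    (h : w.foldl (colBump R) T = w'.foldl (colBump R) T')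
    (hcols : insCols R T w = insCols R T' w') : T = T' ∧ w = w' := by
  induction w generalizing T T' w' with
  | nil =>
    cases w' with
    | nil => exact ⟨h, rfl⟩
    | cons b w' => simp [insCols] at hcols
  | cons b w ih =>
    cases w' with
    | nil => simp [insCols] at hcols
    | cons b' w' =>
      simp only [insCols, List.cons.injEq] at hcols
      obtain ⟨h1, rfl⟩ := ih (hT.colBump b) (hT'.colBump b') h hcols.2
      obtain ⟨rfl, rfl⟩ := colBump_injective hT hT' h1 hcols.1
      exact ⟨rfl, rfl⟩

theorem colLens_eq_zero_of_length_le {T : List (List α)} {j : ℕ} (h : T.length ≤ j) :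
    colLens T j = 0 := by
  simp [colLens, h]

/-- The last new cell lies outside the original shape. In the strip lemmas below this is what
permits comparing its column with an extremal one. -/
theorem last_col_lt {T₀ : List (List α)} {l : List α} {x : α} :
    colLens T₀ (bumpCol R (l.foldl (colBump R) T₀) x) <
      colLens ((l ++ [x]).foldl (colBump R) T₀) (bumpCol R (l.foldl (colBump R) T₀) x) := by
  rw [List.foldl_append, List.foldl_cons, List.foldl_nil, colLens_colBump, colLens_foldl]
  simp

/-- The difference of the two shapes is a horizontal strip: at most one cell in each column. Its
cells are removed by reverse bumping from right to left, and the bumping lemma, read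
contrapositively, shows that each letter bumps the ones before it. -/
theorem exists_foldl_of_horizontal [IsBumpRel R] {T : List (List α)} (hT : IsTab R T)
    (κ : ℕ → ℕ) (hκ : ∀ j, κ (j + 1) ≤ κ j) (h₁ : ∀ j, κ j ≤ colLens T j)
    (h₂ : ∀ j, colLens T j ≤ κ j + 1) :
    ∃ T₀, ∃ l : List α, IsTab R T₀ ∧ colLens T₀ = κ ∧ l.foldl (colBump R) T₀ = T ∧
      l.Pairwise fun x y => R y x := by
  obtain ⟨K, hK⟩ : ∃ K, ∀ j, K ≤ j → colLens T j = 0 :=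
    ⟨T.length, fun j => colLens_eq_zero_of_length_le⟩
  obtain ⟨N, hN⟩ : ∃ N, ∑ j ∈ Finset.range K, (colLens T j - κ j) = N := ⟨_, rfl⟩
  induction N generalizing T with
  | zero =>
    refine ⟨T, [], hT, ?_, rfl, by simp⟩
    funext j
    by_cases hj : j < K
    · have := Finset.sum_eq_zero_iff.1 hN j (by simpa using hj)
      have := h₁ j
      omega
    · have := hK j (by omega)
      have := h₁ j
      omega
  | succ N ih =>
    let S := (Finset.range K).filter fun j => κ j < colLens T j
    have hS : S.Nonempty := by
      by_contra hS
      rw [Finset.not_nonempty_iff_eq_empty, Finset.filter_eq_empty_iff] at hS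
      have : ∑ j ∈ Finset.range K, (colLens T j - κ j) = 0 :=
        Finset.sum_eq_zero fun j hj => by have := hS hj; omega
      omega
    -- The rightmost column with a cell outside κ. That cell is a corner, because column a + 1 has
    -- length at most κ (a + 1) ≤ κ a.
    let a := S.max' hS
    have haS : a ∈ S := S.max'_mem hS
    have ha : a < K ∧ κ a < colLens T a := by simpa [S] using haS
    have hmax : ∀ j, κ j < colLens T j → j ≤ a := by
      intro j hj
      refine S.le_max' j ?_
      have : j < K := by
        by_contra h
        have := hK j (by omega)
        omega
      simp [S, this, hj]
    have hrem : colLens T (a + 1) < colLens T a := by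
      have h3 := hκ a
      by_contra h
      have := hmax (a + 1) (by omega)
      omega
    obtain ⟨T₁, b, hT₁, rfl, hcol⟩ := exists_colBump hT hrem
    have hlen := colLens_colBump (R := R) T₁ b
    rw [hcol] at hlen
    have hlena : colLens (colBump R T₁ b) a = colLens T₁ a + 1 := by simp [hlen]
    have hlenj : ∀ j, j ≠ a → colLens (colBump R T₁ b) j = colLens T₁ j := by
      intro j hj; simp [hlen, hj]
    have h₁' : ∀ j, κ j ≤ colLens T₁ j := by
      intro j
      by_cases hj : j = a
      · subst hj; omega
      · have := h₁ j; rw [hlenj j hj] at this; exact this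
    have h₂' : ∀ j, colLens T₁ j ≤ κ j + 1 := by
      intro j
      have := h₂ j; rw [hlen] at this; omega
    obtain ⟨T₀, l, hT₀, hκ₀, rfl, hl⟩ := ih hT₁ h₁' h₂'
      (fun j hj => by have := hK j hj; rw [hlen] at this; omega) (by
        have : ∑ j ∈ Finset.range K, (colLens (colBump R T₁ b) j - κ j) =
            ∑ j ∈ Finset.range K, (colLens T₁ j - κ j) + 1 := by
          rw [← Finset.add_sum_erase _ _ (Finset.mem_range.2 ha.1),
            ← Finset.add_sum_erase _ (fun j => colLens T₁ j - κ j) (Finset.mem_range.2 ha.1),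
            Finset.sum_congr rfl (g := fun j => colLens T₁ j - κ j)]
          · have := h₁' a
            omega
          · intro j hj
            rw [hlenj j (Finset.ne_of_mem_erase hj)]
        omega)
    refine ⟨T₀, l ++ [b], hT₀, hκ₀, by simp, ?_⟩
    rw [List.pairwise_append]
    refine ⟨hl, by simp, ?_⟩
    rcases List.eq_nil_or_concat l with rfl | ⟨l', x, rfl⟩
    · simp
    · rw [List.concat_eq_append] at *
      have hlt := last_col_lt (R := R) (T₀ := T₀) (l := l') (x := x)
      set a₀ := bumpCol R (l'.foldl (colBump R) T₀) x
      have hne : a₀ ≠ a := by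
        intro h
        rw [h, hκ₀] at hlt
        have := h₂ a
        omega
      have hle : a₀ ≤ a := by
        refine hmax a₀ ?_
        rw [hlenj a₀ hne]
        rwa [hκ₀] at hlt
      -- Otherwise b would have ended weakly to the left of x. But x ended in another column than a,
      -- and to the left of it, a being the rightmost column of the strip.
      have hbx : R b x := by
        by_contra h
        have := bumpCol_le (R := R) (hT₀.foldl l').col h
        rw [List.foldl_append, List.foldl_cons, List.foldl_nil] at hcol
        omega
      intro y hy z hz
      simp only [List.mem_singleton] at hz
      subst hz
      rcases List.mem_append.1 hy with hy | hy
      · exact IsBumpRel.trans hbx ((List.pairwise_append.1 hl).2.2 y hy x (by simp))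
      · simp only [List.mem_singleton] at hy
        exact hy ▸ hbx

/-- The counterpart for vertical strips: `h₂` says that the strip has at most one cell in each row.
The cells are removed from left to right, and the other half of the bumping lemma applies. -/
theorem exists_foldl_of_vertical [IsBumpRel R] {T : List (List α)} (hT : IsTab R T)
    (κ : ℕ → ℕ) (h₁ : ∀ j, κ j ≤ colLens T j)
    (h₂ : ∀ j, colLens T (j + 1) ≤ κ j) :
    ∃ T₀, ∃ l : List α, IsTab R T₀ ∧ colLens T₀ = κ ∧ l.foldl (colBump R) T₀ = T ∧
      l.Pairwise fun x y => ¬ R y x := by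
  obtain ⟨K, hK⟩ : ∃ K, ∀ j, K ≤ j → colLens T j = 0 :=
    ⟨T.length, fun j => colLens_eq_zero_of_length_le⟩
  obtain ⟨N, hN⟩ : ∃ N, ∑ j ∈ Finset.range K, (colLens T j - κ j) = N := ⟨_, rfl⟩
  induction N generalizing T with
  | zero =>
    refine ⟨T, [], hT, ?_, rfl, by simp⟩
    funext j
    by_cases hj : j < K
    · have := Finset.sum_eq_zero_iff.1 hN j (by simpa using hj)
      have := h₁ j
      omega
    · have := hK j (by omega)
      have := h₁ j
      omega
  | succ N ih =>
    have hex : ∃ j, κ j < colLens T j := by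
      by_contra hS
      push Not at hS
      have : ∑ j ∈ Finset.range K, (colLens T j - κ j) = 0 :=
        Finset.sum_eq_zero fun j hj => by have := hS j; omega
      omega
    classical
    let a := Nat.find hex
    have ha : κ a < colLens T a := Nat.find_spec hex
    have haK : a < K := by
      by_contra h
      have := hK a (by omega)
      omega
    have hmin : ∀ j, κ j < colLens T j → a ≤ j := fun j hj => Nat.find_min' hex hj
    have hrem : colLens T (a + 1) < colLens T a := by
      have := h₂ a
      omega
    obtain ⟨T₁, b, hT₁, rfl, hcol⟩ := exists_colBump hT hrem
    have hlen := colLens_colBump (R := R) T₁ b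
    rw [hcol] at hlen
    have hlena : colLens (colBump R T₁ b) a = colLens T₁ a + 1 := by simp [hlen]
    have hlenj : ∀ j, j ≠ a → colLens (colBump R T₁ b) j = colLens T₁ j := by
      intro j hj; simp [hlen, hj]
    have h₁' : ∀ j, κ j ≤ colLens T₁ j := by
      intro j
      by_cases hj : j = a
      · rw [hj]; omega
      · have := h₁ j; rw [hlenj j hj] at this; exact this
    have h₂' : ∀ j, colLens T₁ (j + 1) ≤ κ j := by
      intro j
      have := h₂ j; rw [hlen] at this; omega
    obtain ⟨T₀, l, hT₀, hκ₀, rfl, hl⟩ := ih hT₁ h₁' h₂'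
      (fun j hj => by have := hK j hj; rw [hlen] at this; omega) (by
        have : ∑ j ∈ Finset.range K, (colLens (colBump R T₁ b) j - κ j) =
            ∑ j ∈ Finset.range K, (colLens T₁ j - κ j) + 1 := by
          rw [← Finset.add_sum_erase _ _ (Finset.mem_range.2 haK),
            ← Finset.add_sum_erase _ (fun j => colLens T₁ j - κ j) (Finset.mem_range.2 haK),
            Finset.sum_congr rfl (g := fun j => colLens T₁ j - κ j)]
          · have := h₁' a
            omega
          · intro j hj
            rw [hlenj j (Finset.ne_of_mem_erase hj)]
        omega)
    refine ⟨T₀, l ++ [b], hT₀, hκ₀, by simp, ?_⟩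
    rw [List.pairwise_append]
    refine ⟨hl, by simp, ?_⟩
    rcases List.eq_nil_or_concat l with rfl | ⟨l', x, rfl⟩
    · simp
    · rw [List.concat_eq_append] at *
      have hlt := last_col_lt (R := R) (T₀ := T₀) (l := l') (x := x)
      set a₀ := bumpCol R (l'.foldl (colBump R) T₀) x
      have hle : a ≤ a₀ := by
        refine hmin a₀ ?_
        rw [hκ₀] at hlt
        rw [hlen]
        omega
      -- If b bumped x, it would have ended strictly to the right of x, whereas a is the leftmost
      -- column of the strip.
      have hbx : ¬ R b x := by
        intro h
        have := bumpCol_lt (R := R) (T := l'.foldl (colBump R) T₀) h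
        rw [List.foldl_append, List.foldl_cons, List.foldl_nil] at hcol
        omega
      intro y hy z hz
      simp only [List.mem_singleton] at hz
      subst hz
      rcases List.mem_append.1 hy with hy | hy
      · intro h
        rcases IsBumpRel.split x h with h | h
        · exact hbx h
        · exact (List.pairwise_append.1 hl).2.2 y hy x (by simp) h
      · simp only [List.mem_singleton] at hy
        exact hy ▸ hbx

/-! ### Passing a word through one column -/

variable (R) in
/-- Insert a word into a column; the result is the final column and the word of bumped letters. -/
def passCol : List α → List α → List α × List α
  | c, [] => (c, [])
  | c, b :: w =>
    ((passCol (colInsert R b c).1 w).1, (colInsert R b c).2.toList ++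
      (passCol (colInsert R b c).1 w).2)

theorem passCol_cons_none {b : α} {c c' w : List α} (h : colInsert R b c = (c', none)) :
    passCol R c (b :: w) = passCol R c' w := by
  simp [passCol, h]

theorem passCol_cons_some {b x : α} {c c' w : List α} (h : colInsert R b c = (c', some x)) :
    passCol R c (b :: w) = ((passCol R c' w).1, x :: (passCol R c' w).2) := by
  simp [passCol, h]

theorem passCol_append (c w w' : List α) :
    passCol R c (w ++ w') =
      ((passCol R (passCol R c w).1 w').1,
        (passCol R c w).2 ++ (passCol R (passCol R c w).1 w').2) := by
  induction w generalizing c with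
  | nil => simp [passCol]
  | cons b w ih => simp [passCol, ih]

/-- The letters leaving the first column form the word inserted into the remaining columns. A
tableau can thus be computed one column at a time instead of one letter at a time. -/
theorem foldl_colBump_cons (c : List α) (T : List (List α)) (w : List α) :
    w.foldl (colBump R) (c :: T) =
      (passCol R c w).1 :: (passCol R c w).2.foldl (colBump R) T := by
  induction w generalizing c T with
  | nil => rfl
  | cons b w ih =>
    rw [List.foldl_cons]
    rcases colInsert_eq_or R b c with ⟨c', hc⟩ | ⟨c', x, hc⟩
    · rw [colBump_cons_none hc, ih, passCol_cons_none hc]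
    · rw [colBump_cons_some hc, ih, passCol_cons_some hc]
      rfl

theorem colP_eq_of_ne_nil {w : List α} (h : w ≠ []) :
    colP R w = (passCol R [] w).1 :: colP R (passCol R [] w).2 := by
  cases w with
  | nil => exact absurd rfl h
  | cons b w =>
    have : colP R (b :: w) = w.foldl (colBump R) [[b]] := rfl
    rw [this, foldl_colBump_cons]
    simp [passCol, colInsert, colP]

theorem passCol_length (c w : List α) :
    (passCol R c w).1.length + (passCol R c w).2.length = c.length + w.length := by
  induction w generalizing c with
  | nil => simp [passCol]
  | cons b w ih =>
    rcases colInsert_eq_or R b c with ⟨c', hc⟩ | ⟨c', x, hc⟩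
    · have h := ih c'
      rw [passCol_cons_none hc]
      simp only [(colInsert_none_eq hc).1, List.length_append, List.length_cons,
        List.length_nil] at h ⊢
      omega
    · have h := ih c'
      rw [passCol_cons_some hc]
      rw [colInsert_length_some hc] at h
      simp only [List.length_cons]
      omega

theorem passCol_length_le (c w : List α) : c.length ≤ (passCol R c w).1.length := by
  induction w generalizing c with
  | nil => simp [passCol]
  | cons b w ih =>
    rcases colInsert_eq_or R b c with ⟨c', hc⟩ | ⟨c', x, hc⟩
    · rw [passCol_cons_none hc]
      refine le_trans ?_ (ih c')
      simp [(colInsert_none_eq hc).1]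
    · rw [passCol_cons_some hc]
      exact (colInsert_length_some hc).symm.le.trans (ih c')

theorem passCol_snd_length_lt {w : List α} (h : w ≠ []) :
    (passCol R [] w).2.length < w.length := by
  cases w with
  | nil => exact absurd rfl h
  | cons b w =>
    have h1 := passCol_length (R := R) [] (b :: w)
    have h2 : 1 ≤ (passCol R [] (b :: w)).1.length := by
      simpa [passCol, colInsert] using passCol_length_le (R := R) [b] w
    simp only [List.length_nil] at h1
    omega

/-- Induction on the number of columns: the first letter meets an empty column and bumps nothing, so
the word that leaves the column is shorter. -/
theorem colP_induction {motive : List α → Prop} (nil : motive [])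
    (step : ∀ w, w ≠ [] → motive (passCol R [] w).2 → motive w) (w : List α) : motive w := by
  induction hn : w.length using Nat.strong_induction_on generalizing w with
  | _ n ih =>
    by_cases hw : w = []
    · exact hw ▸ nil
    · exact step w hw (ih _ (hn ▸ passCol_snd_length_lt hw) _ rfl)

/-! ### Restriction to small letters -/

theorem colInsert_filter_pos {p : α → Bool} (hp : ∀ x y, p x → ¬ p y → R x y ∧ ¬ R y x) {c : List α}
    (hc : IsCol R c) {b : α} (hb : p b) :
    colInsert R b (c.filter p) =
      ((colInsert R b c).1.filter p, (colInsert R b c).2.filter p) := by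
  induction c with
  | nil => simp [colInsert, hb]
  | cons y c ih =>
    rw [IsCol, List.pairwise_cons] at hc
    by_cases hy : p y
    · rw [List.filter_cons_of_pos hy]
      by_cases hby : R b y
      · simp [colInsert, hby, hb, hy, Option.filter]
      · simp only [colInsert, hby, if_false, ih hc.2]
        simp [hy]
    · rw [List.filter_cons_of_neg hy]
      have hby := (hp b y hb hy).1
      -- The head of the column is already a large letter, and no small letter may stand below it.
      have hnil : c.filter p = [] := by
        rw [List.filter_eq_nil_iff]
        intro z hz hpz
        exact hc.1 z hz (hp z y hpz hy).1
      simp [colInsert, hby, hb, hy, hnil, Option.filter]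

theorem colInsert_filter_neg {p : α → Bool} (hp : ∀ x y, p x → ¬ p y → R x y ∧ ¬ R y x) {c : List α}
    {b : α} (hb : ¬ p b) :
    (colInsert R b c).1.filter p = c.filter p ∧ (colInsert R b c).2.filter p = none := by
  induction c with
  | nil => simp [colInsert, hb]
  | cons y c ih =>
    by_cases hby : R b y
    · have hy : ¬ p y := fun hy => (hp y b hy hb).2 hby
      simp [colInsert, hby, hb, hy, Option.filter]
    · simp only [colInsert, hby, if_false]
      refine ⟨?_, ih.2⟩
      rw [List.filter_cons, List.filter_cons, ih.1]

theorem passCol_filter [IsBumpRel R] {p : α → Bool}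
    (hp : ∀ x y, p x → ¬ p y → R x y ∧ ¬ R y x) {c : List α} (hc : IsCol R c) (w : List α) :
    passCol R (c.filter p) (w.filter p) =
      ((passCol R c w).1.filter p, (passCol R c w).2.filter p) := by
  induction w generalizing c with
  | nil => simp [passCol]
  | cons b w ih =>
    have ih' := ih (hc.colInsert b)
    have hopt : ∀ o : Option α, o.toList.filter p = (o.filter p).toList := by
      intro o
      cases o with
      | none => rfl
      | some x => by_cases hx : p x <;> simp [hx, Option.filter]
    by_cases hb : p b
    · rw [List.filter_cons_of_pos hb]
      simp only [passCol, colInsert_filter_pos hp hc hb, ih', List.filter_append, hopt]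
    · rw [List.filter_cons_of_neg hb]
      have h := colInsert_filter_neg hp (c := c) hb
      rw [h.1] at ih'
      simp only [passCol, ih', List.filter_append, hopt, h.2]
      simp

/-- The letters satisfying p are the small ones: by `hp` they bump all others and are never bumped
by them. They therefore move as if the large letters were absent. -/
theorem colP_filter [IsBumpRel R] {p : α → Bool}
    (hp : ∀ x y, p x → ¬ p y → R x y ∧ ¬ R y x) (w : List α) (j : ℕ) :
    (colP R (w.filter p)).getD j [] = ((colP R w).getD j []).filter p := by
  induction w using colP_induction (R := R) generalizing j with
  | nil => simp [colP]
  | step w hw ih =>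
    have h := passCol_filter hp (c := []) (by simp [IsCol]) w
    rw [colP_eq_of_ne_nil hw]
    rw [List.filter_nil] at h
    by_cases hw' : w.filter p = []
    · rw [hw'] at h ⊢
      simp only [passCol, Prod.mk.injEq] at h
      cases j with
      | zero => simp [colP, ← h.1]
      | succ j =>
        rw [List.getD_cons_succ, ← ih, ← h.2]
        simp [colP]
    · rw [colP_eq_of_ne_nil hw', h]
      cases j with
      | zero => simp
      | succ j => rw [List.getD_cons_succ, List.getD_cons_succ, ih]

end Words

end SuperKnuth

namespace SuperKnuth

/-! ### Standardization, and the growth of shapes under insertion -/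

section Standardization

variable {α : Type*} {R : α → α → Prop} [DecidableRel R]

theorem mem_of_mem_colInsert {b y : α} {c : List α} (h : y ∈ (colInsert R b c).1) :
    y = b ∨ y ∈ c := by
  rcases colInsert_cases R b c with ⟨-, h2⟩ | ⟨p, x, q, rfl, -, -, h2⟩
  · rw [h2] at h
    simpa [or_comm] using h
  · rw [h2] at h
    simp only [List.mem_append, List.mem_cons] at h ⊢
    tauto

theorem mem_of_mem_colBump {b y : α} {T : List (List α)} {c : List α} (hc : c ∈ colBump R T b)
    (hy : y ∈ c) : y = b ∨ ∃ d ∈ T, y ∈ d := by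
  induction T generalizing b with
  | nil =>
    simp only [colBump, List.mem_singleton] at hc
    subst hc
    simpa using hy
  | cons d T ih =>
    rcases colInsert_eq_or R b d with ⟨d', hd⟩ | ⟨d', x, hd⟩
    · rw [colBump_cons_none hd] at hc
      rcases List.mem_cons.1 hc with rfl | hc
      · have := mem_of_mem_colInsert (R := R) (b := b) (y := y) (c := d) (by rwa [hd])
        rcases this with h | h
        · exact Or.inl h
        · exact Or.inr ⟨d, by simp, h⟩
      · exact Or.inr ⟨c, by simp [hc], hy⟩
    · rw [colBump_cons_some hd] at hc
      rcases List.mem_cons.1 hc with rfl | hc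
      · have := mem_of_mem_colInsert (R := R) (b := b) (y := y) (c := d) (by rwa [hd])
        rcases this with h | h
        · exact Or.inl h
        · exact Or.inr ⟨d, by simp, h⟩
      · rcases ih hc with rfl | ⟨e, he, hye⟩
        · exact Or.inr ⟨d, by simp, mem_of_colInsert hd⟩
        · exact Or.inr ⟨e, by simp [he], hye⟩

theorem colP_append_singleton (w : List α) (b : α) :
    colP R (w ++ [b]) = colBump R (colP R w) b := by
  simp [colP]

theorem mem_of_mem_colP {w : List α} {c : List α} {y : α} (hc : c ∈ colP R w) (hy : y ∈ c) :
    y ∈ w := by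
  induction w using List.reverseRecOn generalizing c with
  | nil => simp [colP] at hc
  | append_singleton w b ih =>
    rw [colP_append_singleton] at hc
    rcases mem_of_mem_colBump hc hy with rfl | ⟨d, hd, hyd⟩
    · simp
    · simp [ih hd hyd]

theorem mem_of_mem_passCol {c w : List α} {y : α} (h : y ∈ (passCol R c w).2) :
    y ∈ c ++ w := by
  induction w generalizing c with
  | nil => simp [passCol] at h
  | cons b w ih =>
    simp only [passCol, List.mem_append, Option.mem_toList] at h
    rcases h with h | h
    · have := mem_of_colInsert (R := R) (b := b) (c := c) (x := y) (Prod.ext rfl h)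
      simp [this]
    · have := ih h
      simp only [List.mem_append, List.mem_cons] at this ⊢
      rcases this with h | h
      · have := mem_of_mem_colInsert h
        tauto
      · tauto

section Map

variable {β : Type*} {S : β → β → Prop} [DecidableRel S] {f : β → α}

theorem colInsert_map (hS : ∀ x y, S x y ↔ R (f x) (f y)) (b : β) (c : List β) :
    colInsert R (f b) (c.map f) = ((colInsert S b c).1.map f, (colInsert S b c).2.map f) := by
  induction c with
  | nil => simp [colInsert]
  | cons y c ih =>
    by_cases h : S b y
    · simp [colInsert, h, (hS b y).1 h]
    · have h' := h
      rw [hS] at h'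
      simp [colInsert, h, h', ih]

theorem colBump_map (hS : ∀ x y, S x y ↔ R (f x) (f y)) (T : List (List β)) (b : β) :
    colBump R (T.map (List.map f)) (f b) = (colBump S T b).map (List.map f) := by
  induction T generalizing b with
  | nil => simp [colBump]
  | cons c T ih =>
    have h := colInsert_map hS b c
    rcases colInsert_eq_or S b c with ⟨c', hc⟩ | ⟨c', x, hc⟩
    · rw [hc] at h
      rw [colBump_cons_none hc, List.map_cons, colBump_cons_none h]
      rfl
    · rw [hc] at h
      rw [colBump_cons_some hc, List.map_cons, colBump_cons_some h, ih]
      rfl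

/-- Insertion sees only comparisons. This permits replacing the letters of a biword by pairwise
distinct triples carrying the same relation. -/
theorem colP_map (hS : ∀ x y, S x y ↔ R (f x) (f y)) (w : List β) :
    colP R (w.map f) = (colP S w).map (List.map f) := by
  induction w using List.reverseRecOn with
  | nil => rfl
  | append_singleton w b ih =>
    rw [List.map_append, List.map_singleton, colP_append_singleton, colP_append_singleton, ih,
      colBump_map hS]

theorem colLens_map (T : List (List β)) (f : β → α) : colLens (T.map (List.map f)) = colLens T := by
  funext j
  induction T generalizing j with
  | nil => simp [colLens]
  | cons c T ih =>
    cases j with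
    | zero => simp [colLens]
    | succ j => simpa [colLens] using ih j

end Map

section Congr

variable {S : α → α → Prop} [DecidableRel S]

theorem colInsert_congr {b : α} {c : List α} (h : ∀ x ∈ c, R b x ↔ S b x) :
    colInsert R b c = colInsert S b c := by
  induction c with
  | nil => rfl
  | cons y c ih =>
    simp only [List.mem_cons, forall_eq_or_imp] at h
    simp only [colInsert, h.1, ih h.2]

/-- Insertion asks only whether a later letter bumps an earlier one, so two relations that agree on
such pairs give the same result. The agreement is an invariant: when b takes the place of x, the
entries below x bump neither x nor, by transitivity, b, for both relations; and x, once expelled, is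
bumped by b and by the entries that stood above it, again for both. -/
theorem passCol_congr [IsBumpRel R] [IsBumpRel S] {c w : List α} (hc : IsCol R c)
    (h : (c ++ w).Pairwise fun x y => R y x ↔ S y x) :
    passCol R c w = passCol S c w ∧ (passCol R c w).2.Pairwise fun x y => R y x ↔ S y x := by
  induction w generalizing c with
  | nil => simp [passCol]
  | cons b w ih =>
    have hbc : ∀ x ∈ c, R b x ↔ S b x := fun x hx =>
      (List.pairwise_append.1 h).2.2 x hx b (by simp)
    have hcongr := colInsert_congr hbc
    have hcol := hc.colInsert b
    rcases colInsert_cases R b c with ⟨h1, h2⟩ | ⟨p, x, q, rfl, h1, hx, h2⟩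
    · rw [h2] at hcol
      have := ih hcol (by simpa using h)
      rw [passCol_cons_none h2, passCol_cons_none (h2 ▸ hcongr.symm)]
      exact this
    · rw [h2] at hcol
      have hSx : S b x := (hbc x (by simp)).1 hx
      have hSp : ∀ y ∈ p, ¬ S b y := fun y hy hS => h1 y hy ((hbc y (by simp [hy])).2 hS)
      rw [IsCol, List.pairwise_append, List.pairwise_cons] at hc
      simp only [List.append_assoc, List.cons_append, List.pairwise_append, List.pairwise_cons,
        List.mem_append, List.mem_cons] at h
      obtain ⟨hpp, ⟨hxall, hqq, ⟨hbw, hww⟩, hqbw⟩, hpall⟩ := h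
      have hqR : ∀ y ∈ q, ¬ R y x := hc.2.1.1
      have hqS : ∀ y ∈ q, ¬ S y x := fun y hy hS =>
        hqR y hy ((hxall y (Or.inl hy)).2 hS)
      have hpR : ∀ y ∈ p, R y x := fun y hy =>
        (IsBumpRel.split y hx).resolve_left (h1 y hy)
      have hpS : ∀ y ∈ p, S y x := fun y hy =>
        (IsBumpRel.split y hSx).resolve_left (hSp y hy)
      have := ih hcol (by
        simp only [List.append_assoc, List.cons_append, List.pairwise_append, List.pairwise_cons,
          List.mem_append, List.mem_cons]
        refine ⟨hpp, ⟨?_, hqq, hww, fun y hy z hz => hqbw y hy z (Or.inr hz)⟩, ?_⟩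
        · rintro y (hy | hy)
          · exact ⟨fun h => absurd (IsBumpRel.trans h hx) (hqR y hy),
              fun h => absurd (IsBumpRel.trans h hSx) (hqS y hy)⟩
          · exact hbw y hy
        · rintro y hy z (rfl | hz | hz)
          · exact hpall y hy z (Or.inr (Or.inr (Or.inl rfl)))
          · exact hpall y hy z (Or.inr (Or.inl hz))
          · exact hpall y hy z (Or.inr (Or.inr (Or.inr hz))))
      rw [passCol_cons_some h2, passCol_cons_some (h2 ▸ hcongr.symm), this.1]
      refine ⟨rfl, ?_⟩
      rw [List.pairwise_cons, ← this.1]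
      refine ⟨?_, this.2⟩
      intro y hy
      have := mem_of_mem_passCol hy
      simp only [List.mem_append, List.mem_cons] at this
      rcases this with (hy | rfl | hy) | hy
      · exact iff_of_true (hpR y hy) (hpS y hy)
      · exact iff_of_true hx hSx
      · exact iff_of_false (hqR y hy) (hqS y hy)
      · exact hxall y (Or.inr (Or.inr hy))

theorem colP_congr [IsBumpRel R] [IsBumpRel S] {w : List α}
    (h : w.Pairwise fun x y => R y x ↔ S y x) : colP R w = colP S w := by
  induction w using colP_induction (R := R) with
  | nil => rfl
  | step w hw ih =>
    have := passCol_congr (R := R) (S := S) (c := []) (by simp [IsCol]) (by simpa using h)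
    rw [colP_eq_of_ne_nil hw, colP_eq_of_ne_nil hw, ih this.2, this.1]

end Congr

/-! ### The local growth rule -/

/-- Put `p` at the bottom of the column number `a`. -/
def addAt : List (List α) → ℕ → α → List (List α)
  | [], _, p => [[p]]
  | c :: T, 0, p => (c ++ [p]) :: T
  | c :: T, a + 1, p => c :: addAt T a p

theorem colLens_addAt {T : List (List α)} {a : ℕ} (ha : a ≤ T.length) (p : α) (j : ℕ) :
    colLens (addAt T a p) j = colLens T j + if j = a then 1 else 0 := by
  induction T generalizing a j with
  | nil =>
    have : a = 0 := by simpa using ha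
    subst this
    cases j <;> simp [addAt, colLens]
  | cons c T ih =>
    cases a with
    | zero => cases j <;> simp [addAt, colLens]
    | succ a =>
      cases j with
      | zero => simp [addAt, colLens]
      | succ j =>
        rw [addAt, colLens_cons_succ, colLens_cons_succ, ih (by simpa using ha)]
        simp

theorem colBump_of_forall {T : List (List α)} {p : α} (h : ∀ c ∈ T, ∀ y ∈ c, ¬ R p y) :
    colBump R T p = addAt T 0 p := by
  cases T with
  | nil => rfl
  | cons c T =>
    rw [colBump_cons_none (colInsert_eq_none_of_forall R p c (h c (by simp)))]
    rfl

/-- Since p exceeds everything, z and its victims meet p only where the route would otherwise have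
ended. If this is the column of p, then p is bumped and, bumping nothing, goes to the bottom of the
next column; otherwise it stays. -/
theorem colBump_addAt {T : List (List α)} {p z : α} (hz : R z p)
    (hT : ∀ c ∈ T, ∀ y ∈ c, R y p ∧ ¬ R p y) {a : ℕ} (ha : a ≤ T.length) :
    colBump R (addAt T a p) z =
      addAt (colBump R T z) (if bumpCol R T z = a then a + 1 else a) p := by
  induction T generalizing z a with
  | nil =>
    have : a = 0 := by simpa using ha
    subst this
    simp [addAt, colBump, bumpCol, colInsert, hz]
  | cons c T ih =>
    have hT' : ∀ c ∈ T, ∀ y ∈ c, R y p ∧ ¬ R p y := fun d hd => hT d (by simp [hd])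
    have hc' := hT c (by simp)
    cases a with
    | zero =>
      rw [addAt]
      rcases colInsert_cases R z c with ⟨h1, h2⟩ | ⟨q, x, r, rfl, h1, hx, h2⟩
      · rw [bumpCol_cons_none h2, if_pos rfl, colBump_cons_none h2, addAt,
          colBump_cons_some (colInsert_eq_some R z p c [] h1 hz),
          colBump_of_forall fun d hd y hy => (hT' d hd y hy).2]
      · have h3 : colInsert R z (q ++ x :: r ++ [p]) = (q ++ z :: (r ++ [p]), some x) := by
          simpa using colInsert_eq_some R z x q (r ++ [p]) h1 hx
        rw [bumpCol_cons_some h2, colBump_cons_some h2, colBump_cons_some h3]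
        simp [addAt]
    | succ a =>
      rw [addAt]
      rcases colInsert_eq_or R z c with ⟨c', hc⟩ | ⟨c', x, hc⟩
      · rw [bumpCol_cons_none hc, colBump_cons_none hc, colBump_cons_none hc]
        simp [addAt]
      · rw [bumpCol_cons_some hc, colBump_cons_some hc, colBump_cons_some hc,
          ih (hc' x (mem_of_colInsert hc)).1 hT' (by simpa using ha)]
        by_cases h : bumpCol R T x = a
        · simp [h, addAt]
        · simp [h, addAt]

theorem length_le_colBump (T : List (List α)) (b : α) : T.length ≤ (colBump R T b).length := by
  induction T generalizing b with
  | nil => simp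
  | cons c T ih =>
    rcases colInsert_eq_or R b c with ⟨c', hc⟩ | ⟨c', x, hc⟩
    · rw [colBump_cons_none hc]; simp
    · rw [colBump_cons_some hc]; simpa using ih x

theorem bumpCol_lt_length (T : List (List α)) (b : α) :
    bumpCol R T b < (colBump R T b).length := by
  induction T generalizing b with
  | nil => simp [bumpCol, colBump]
  | cons c T ih =>
    rcases colInsert_eq_or R b c with ⟨c', hc⟩ | ⟨c', x, hc⟩
    · rw [colBump_cons_none hc, bumpCol_cons_none hc]; simp
    · rw [colBump_cons_some hc, bumpCol_cons_some hc]; simpa using ih x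

/-- The largest letter always sits at the bottom of some column and leaves the rest of the tableau
as it would be without it. -/
theorem exists_colP_eq_addAt {w₁ w₂ : List α} {p : α}
    (h : ∀ y ∈ w₁ ++ w₂, R y p ∧ ¬ R p y) :
    ∃ a ≤ (colP R (w₁ ++ w₂)).length,
      colP R (w₁ ++ p :: w₂) = addAt (colP R (w₁ ++ w₂)) a p := by
  induction w₂ using List.reverseRecOn with
  | nil =>
    refine ⟨0, Nat.zero_le _, ?_⟩
    rw [colP_append_singleton, List.append_nil, colBump_of_forall]
    intro c hc y hy
    exact (h y (by simpa using mem_of_mem_colP hc hy)).2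
  | append_singleton w₂ z ih =>
    obtain ⟨a, ha, h'⟩ := ih fun y hy => h y (by
      simp only [List.mem_append] at hy ⊢
      tauto)
    have e1 : w₁ ++ p :: (w₂ ++ [z]) = (w₁ ++ p :: w₂) ++ [z] := by simp
    have e2 : w₁ ++ (w₂ ++ [z]) = (w₁ ++ w₂) ++ [z] := by simp
    rw [e1, e2, colP_append_singleton, colP_append_singleton, h', colBump_addAt (h z (by simp)).1 ?_ ha]
    · refine ⟨_, ?_, rfl⟩
      have h1 := length_le_colBump (R := R) (colP R (w₁ ++ w₂)) z
      have h2 := bumpCol_lt_length (R := R) (colP R (w₁ ++ w₂)) z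
      split_ifs <;> omega
    · intro c hc y hy
      refine h y ?_
      have := mem_of_mem_colP hc hy
      simp only [List.mem_append] at this ⊢
      tauto

/-- The growth rule for the shape of an insertion tableau: `p` is the largest letter, `z` the last
one. -/
theorem colLens_growth {w₁ w₂ : List α} {p z : α}
    (h : ∀ y ∈ w₁ ++ w₂ ++ [z], R y p ∧ ¬ R p y) :
    ∃ a c, (∀ j, colLens (colP R (w₁ ++ p :: w₂)) j =
        colLens (colP R (w₁ ++ w₂)) j + if j = a then 1 else 0) ∧
      (∀ j, colLens (colP R (w₁ ++ w₂ ++ [z])) j =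
        colLens (colP R (w₁ ++ w₂)) j + if j = c then 1 else 0) ∧
      ∀ j, colLens (colP R (w₁ ++ p :: w₂ ++ [z])) j =
        colLens (colP R (w₁ ++ w₂)) j + (if j = c then 1 else 0) +
          if j = (if c = a then a + 1 else a) then 1 else 0 := by
  have h' : ∀ y ∈ w₁ ++ w₂, R y p ∧ ¬ R p y := fun y hy => h y (List.mem_append_left _ hy)
  obtain ⟨a, ha, e⟩ := exists_colP_eq_addAt h'
  refine ⟨a, bumpCol R (colP R (w₁ ++ w₂)) z, ?_, ?_, ?_⟩
  · intro j
    rw [e, colLens_addAt ha]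
  · intro j
    rw [colP_append_singleton, colLens_colBump]
  · intro j
    have h1 := length_le_colBump (R := R) (colP R (w₁ ++ w₂)) z
    have h2 := bumpCol_lt_length (R := R) (colP R (w₁ ++ w₂)) z
    rw [colP_append_singleton, e, colBump_addAt (h z (by simp)).1 _ ha, colLens_addAt,
      colLens_colBump]
    · split_ifs <;> omega
    · intro c hc y hy
      exact h' y (mem_of_mem_colP hc hy)

end Standardization

/-! ### The symmetry of the shape -/

instance isBumpRel_lt {γ A : Type*} [LinearOrder A] (f : γ → A) :
    IsBumpRel fun x y => f x < f y where
  trans := lt_trans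
  split y h := by
    rcases lt_or_ge (f y) _ with h' | h'
    · exact Or.inr h'
    · exact Or.inl (lt_of_lt_of_le h h')

theorem eq_of_indicator {κ : ℕ → ℕ} {a c : ℕ}
    (h : ∀ j, κ j + (if j = a then 1 else 0) = κ j + if j = c then 1 else 0) : a = c := by
  have := h a
  by_contra hne
  simp [hne] at this

/-- The list l is ordered by g and compared by f, while l' is ordered by f and compared by g: a
permutation and its inverse. Let p be the f-largest and q the g-largest element, so that each is the
last letter of one list and the largest of the other. The growth rule computes the full shape from
the three shapes obtained by omitting p, q or both, and it treats p and q alike. -/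
theorem colLens_symm {γ A B : Type*} [LinearOrder A] [LinearOrder B] (f : γ → A) (g : γ → B)
    {l l' : List γ} (hl : l.Pairwise fun x y => g x < g y)
    (hl' : l'.Pairwise fun x y => f x < f y) (hp : l.Perm l') :
    colLens (colP (fun x y => f x < f y) l) = colLens (colP (fun x y => g x < g y) l') := by
  induction hn : l.length using Nat.strong_induction_on generalizing l l' with
  | _ n ih =>
    rcases List.eq_nil_or_concat l with rfl | ⟨l₀, q, rfl⟩
    · rw [List.nil_perm.1 hp]
      rfl
    rcases List.eq_nil_or_concat l' with rfl | ⟨l₀', p, rfl⟩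
    · simp at hp
    rw [List.concat_eq_append] at hp hl hn
    rw [List.concat_eq_append] at hp hl'
    rw [List.concat_eq_append, List.concat_eq_append]
    have hq := List.pairwise_append.1 hl
    have hp' := List.pairwise_append.1 hl'
    have hqmax : ∀ y ∈ l₀, g y < g q := fun y hy => hq.2.2 y hy q (by simp)
    have hpmax : ∀ y ∈ l₀', f y < f p := fun y hy => hp'.2.2 y hy p (by simp)
    -- If they coincide, the element is last and largest in both lists and goes to the bottom of the
    -- first column in both tableaux.
    by_cases hpq : p = q
    · subst hpq
      have hperm : l₀.Perm l₀' := (List.perm_append_right_iff _).1 hp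
      have hlen : l₀.length < n := by simp [← hn]
      have h1 := ih _ hlen hq.1 hp'.1 hperm rfl
      rw [colP_append_singleton, colP_append_singleton, colBump_of_forall, colBump_of_forall]
      · funext j
        rw [colLens_addAt (Nat.zero_le _), colLens_addAt (Nat.zero_le _), h1]
      · intro c hc y hy
        exact (hqmax y (hperm.mem_iff.2 (mem_of_mem_colP hc hy))).asymm
      · intro c hc y hy
        exact (hpmax y (hperm.mem_iff.1 (mem_of_mem_colP hc hy))).asymm
    · have hpl : p ∈ l₀ := by
        have := hp.mem_iff.2 (List.mem_append_right l₀' (List.mem_singleton_self p))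
        rcases List.mem_append.1 this with h | h
        · exact h
        · exact absurd (by simpa using h) hpq
      have hql : q ∈ l₀' := by
        have := hp.mem_iff.1 (List.mem_append_right l₀ (List.mem_singleton_self q))
        rcases List.mem_append.1 this with h | h
        · exact h
        · exact absurd (by simpa [eq_comm] using h) hpq
      obtain ⟨l₁, l₂, rfl⟩ := List.append_of_mem hpl
      obtain ⟨l₁', l₂', rfl⟩ := List.append_of_mem hql
      have hall : (p :: q :: (l₁ ++ l₂)).Perm (p :: q :: (l₁' ++ l₂')) := by
        refine List.Perm.trans ?_ (hp.trans ?_)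
        · refine ((List.perm_middle (a := p)).append_right [q] |>.trans ?_).symm
          simp only [List.cons_append, List.perm_cons]
          exact List.perm_append_singleton _ _
        · refine (List.perm_append_singleton _ _).trans ?_
          exact (List.perm_middle (a := q)).cons _
      have hκ : (l₁ ++ l₂).Perm (l₁' ++ l₂') := by simpa using hall
      have hμ : (l₁ ++ l₂ ++ [q]).Perm (l₁' ++ q :: l₂') :=
        (List.perm_append_singleton _ _).trans ((hκ.cons q).trans List.perm_middle.symm)
      have hν : (l₁ ++ p :: l₂).Perm (l₁' ++ l₂' ++ [p]) :=
        List.perm_middle.trans ((hκ.cons p).trans (List.perm_append_singleton _ _).symm)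
      have s1 : (l₁ ++ l₂).Sublist (l₁ ++ p :: l₂) :=
        (List.sublist_cons_self p l₂).append_left l₁
      have s2 : (l₁' ++ l₂').Sublist (l₁' ++ q :: l₂') :=
        (List.sublist_cons_self q l₂').append_left l₁'
      simp only [List.length_append, List.length_cons, List.length_nil] at hn
      have i1 := ih (l₁ ++ l₂).length (by simp; omega) (hq.1.sublist s1) (hp'.1.sublist s2) hκ rfl
      have i2 := ih (l₁ ++ l₂ ++ [q]).length (by simp; omega)
        (hl.sublist (s1.append_right _)) hp'.1 hμ rfl
      have i3 := ih (l₁ ++ p :: l₂).length (by simp; omega) hq.1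
        (hl'.sublist (s2.append_right _)) hν rfl
      obtain ⟨a, c, h1, h2, h3⟩ := colLens_growth (R := fun x y => f x < f y) (w₁ := l₁)
        (w₂ := l₂) (p := p) (z := q) (fun y hy => by
          have := hpmax y (hμ.mem_iff.1 hy)
          exact ⟨this, this.asymm⟩)
      obtain ⟨a', c', h1', h2', h3'⟩ := colLens_growth (R := fun x y => g x < g y) (w₁ := l₁')
        (w₂ := l₂') (p := q) (z := p) (fun y hy => by
          have := hqmax y (hν.mem_iff.2 hy)
          exact ⟨this, this.asymm⟩)
      -- The largest letter of one list is the last letter of the other, so the roles of the two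
      -- added cells are exchanged.
      have hac : a = c' := by
        refine eq_of_indicator (κ := colLens (colP (fun x y => g x < g y) (l₁' ++ l₂'))) fun j => ?_
        rw [← h2', ← i3, h1, i1]
      have hca : c = a' := by
        refine eq_of_indicator (κ := colLens (colP (fun x y => g x < g y) (l₁' ++ l₂'))) fun j => ?_
        rw [← h1', ← i2, h2, i1]
      funext j
      rw [h3, h3', i1, hac, hca]
      by_cases h : a' = c'
      · subst h
        simp
      · have h' : ¬ c' = a' := fun e => h e.symm
        simp only [h, h', if_false]
        omega

end SuperKnuth

namespace SuperKnuth

/-! ### The bumping relation on letters -/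

section Letters

variable {m n u v : ℕ}

instance (m n : ℕ) : DecidableRel (RowRel m n) := fun x y => by
  unfold RowRel; infer_instance

theorem deg_eq_zero_or_one (b : Letter m n) : deg m n b = 0 ∨ deg m n b = 1 := by
  unfold deg; split_ifs <;> simp

/-- The column condition is the complement of the reversed row condition. This lets the single
relation `RowRel` govern tableaux and bumping alike. -/
theorem colRel_iff {x y : Letter m n} : ColRel m n x y ↔ ¬ RowRel m n y x := by
  have := deg_eq_zero_or_one x
  have := deg_eq_zero_or_one y
  unfold ColRel RowRel
  grind

instance isBumpRel_rowRel (m n : ℕ) : IsBumpRel (RowRel m n) where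
  trans {x y z} h1 h2 := by
    unfold RowRel at *
    grind
  split {x z} y h := by
    have := deg_eq_zero_or_one y
    unfold RowRel at *
    grind

instance isBumpRel_comap {γ α : Type*} (R : α → α → Prop) [IsBumpRel R] (f : γ → α) :
    IsBumpRel fun x y => R (f x) (f y) where
  trans := IsBumpRel.trans
  split y h := IsBumpRel.split (f y) h

theorem insertColumn_eq (b : Letter m n) (c : List (Letter m n)) :
    insertColumn m n b c = colInsert (RowRel m n) b c := by
  induction c with
  | nil => rfl
  | cons x c ih =>
    have : ((deg m n b = 0 ∧ b ≤ x) ∨ (deg m n b = 1 ∧ b < x)) ↔ RowRel m n b x := by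
      have := deg_eq_zero_or_one b
      unfold RowRel
      grind
    simp only [insertColumn, colInsert, ih, this]

theorem bump_eq (T : List (List (Letter m n))) (b : Letter m n) :
    bump m n T b = colBump (RowRel m n) T b := by
  induction T generalizing b with
  | nil => rfl
  | cons c T ih =>
    rcases colInsert_eq_or (RowRel m n) b c with ⟨c', hc⟩ | ⟨c', x, hc⟩
    · rw [colBump_cons_none hc, bump, insertColumn_eq, hc]
    · rw [colBump_cons_some hc, bump, insertColumn_eq, hc, ← ih]

theorem P_eq (w : List (Letter m n)) : P m n w = colP (RowRel m n) w := by
  unfold P colP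
  congr 1
  funext T b
  exact bump_eq T b

theorem isTab_P (w : List (Letter m n)) : IsTab (RowRel m n) (P m n w) := by
  rw [P_eq]; exact isTab_colP w

theorem P_append (w w' : List (Letter m n)) :
    P m n (w ++ w') = w'.foldl (colBump (RowRel m n)) (P m n w) := by
  simp [P_eq, colP]

theorem P_filter (q : ℕ) (w : List (Letter m n)) (j : ℕ) :
    (P m n (w.filter fun b => b.val < q)).getD j [] =
      ((P m n w).getD j []).filter fun b => b.val < q := by
  rw [P_eq, P_eq]
  refine colP_filter ?_ w j
  intro x y hx hy
  simp only [decide_eq_true_eq, not_lt] at hx hy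
  unfold RowRel
  grind

end Letters

/-! ### Blocks of a matrix -/

section Blocks

variable {m n u v : ℕ}

/-- The letters of `B_{m|n}` in the order in which they occur in the block of `j`. -/
def blockOrder (m n : ℕ) {u v : ℕ} (j : Letter u v) : List (Letter m n) :=
  if deg u v j = 0 then (List.finRange (m + n)).reverse else List.finRange (m + n)

/-- The part of the word `i` that stands over the letter `j`. -/
def SuperMatrix.block (A : SuperMatrix m n u v) (j : Letter u v) : List (Letter m n) :=
  (blockOrder m n j).flatMap fun b => List.replicate (A.entry b j) b

/-- The part of the word `i` that stands over the letters at positions less than `q`. -/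
def SuperMatrix.prefixWord (A : SuperMatrix m n u v) (q : ℕ) : List (Letter m n) :=
  ((List.finRange (u + v)).filter fun j => j.val < q).flatMap A.block

theorem SuperMatrix.wordPair_fst (A : SuperMatrix m n u v) :
    A.wordPair.1 = (List.finRange (u + v)).flatMap A.block := by
  simp only [wordPair, biword, List.map_flatMap, List.map_replicate]
  rfl

theorem SuperMatrix.wordPair_snd (A : SuperMatrix m n u v) :
    A.wordPair.2 = (List.finRange (u + v)).flatMap
      fun j => List.replicate (A.block j).length j := by
  simp only [wordPair, biword, List.map_flatMap, List.map_replicate]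
  congr 1
  funext j
  change (blockOrder m n j).flatMap _ = _
  unfold block
  induction blockOrder m n j with
  | nil => rfl
  | cons b l ih =>
    rw [List.flatMap_cons, ih, List.flatMap_cons, List.length_append, List.length_replicate,
      List.replicate_add]

theorem SuperMatrix.prefixWord_full (A : SuperMatrix m n u v) :
    A.prefixWord (u + v) = A.wordPair.1 := by
  rw [wordPair_fst, prefixWord, List.filter_eq_self.2]
  simp

theorem filter_finRange_succ {N q : ℕ} (hq : q < N) :
    ((List.finRange N).filter fun j => j.val < q + 1) =
      ((List.finRange N).filter fun j => j.val < q) ++ [(⟨q, hq⟩ : Fin N)] := by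
  have s1 : ((List.finRange N).filter fun j => j.val < q + 1).Pairwise (· < ·) :=
    (List.pairwise_lt_finRange N).filter _
  have s2 : (((List.finRange N).filter fun j => j.val < q) ++ [(⟨q, hq⟩ : Fin N)]).Pairwise (· < ·) := by
    rw [List.pairwise_append]
    refine ⟨(List.pairwise_lt_finRange N).filter _, by simp, ?_⟩
    intro x hx y hy
    simp only [List.mem_filter, List.mem_finRange, true_and, decide_eq_true_eq,
      List.mem_singleton] at hx hy
    subst hy
    exact hx
  have hperm := (List.perm_ext_iff_of_nodup (s1.imp ne_of_lt) (s2.imp ne_of_lt)).2 (by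
    intro a
    simp only [List.mem_filter, List.mem_finRange, true_and, decide_eq_true_eq, List.mem_append,
      List.mem_singleton, Fin.ext_iff]
    omega)
  exact hperm.eq_of_pairwise (fun x y _ _ h h' => absurd h h'.asymm) s1 s2

theorem SuperMatrix.prefixWord_succ (A : SuperMatrix m n u v) {q : ℕ} (hq : q < u + v) :
    A.prefixWord (q + 1) = A.prefixWord q ++ A.block ⟨q, hq⟩ := by
  rw [prefixWord, filter_finRange_succ hq, List.flatMap_append]
  simp [prefixWord]

theorem count_flatMap_replicate {ι : Type*} [DecidableEq ι] (l : List ι) (hl : l.Nodup)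
    (hl' : ∀ b, b ∈ l) (k : ι → ℕ) (b : ι) :
    (l.flatMap fun c => List.replicate (k c) c).count b = k b := by
  rw [List.count_flatMap]
  have : (List.count b ∘ fun c => List.replicate (k c) c) = fun c => if c = b then k b else 0 := by
    funext c
    simp only [Function.comp, List.count_replicate]
    by_cases h : c = b <;> simp [h]
  rw [this]
  exact sum_map_single l hl (hl' b) _

theorem nodup_blockOrder (j : Letter u v) : (blockOrder m n j).Nodup := by
  unfold blockOrder
  split_ifs
  · exact List.nodup_reverse.2 (List.nodup_finRange _)
  · exact List.nodup_finRange _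

theorem mem_blockOrder (j : Letter u v) (b : Letter m n) : b ∈ blockOrder m n j := by
  unfold blockOrder
  split_ifs <;> simp

theorem SuperMatrix.count_block (A : SuperMatrix m n u v) (j : Letter u v) (b : Letter m n) :
    (A.block j).count b = A.entry b j :=
  count_flatMap_replicate _ (nodup_blockOrder j) (mem_blockOrder j) (fun b => A.entry b j) b

/-- The property that characterizes the blocks. -/
def IsBlock (m n : ℕ) {u v : ℕ} (j : Letter u v) (l : List (Letter m n)) : Prop :=
  (deg u v j = 0 → l.Pairwise fun x y => RowRel m n y x) ∧
    (deg u v j = 1 → l.Pairwise fun x y => ¬ RowRel m n y x)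

theorem SuperMatrix.isBlock (A : SuperMatrix m n u v) (j : Letter u v) :
    IsBlock m n j (A.block j) := by
  unfold IsBlock block blockOrder
  constructor
  · intro hj
    rw [if_pos hj, List.pairwise_flatMap]
    constructor
    · intro b _
      rw [List.pairwise_replicate]
      by_cases hb : deg m n b = 0
      · exact Or.inr (Or.inr ⟨rfl, hb⟩)
      · exact Or.inl (A.le_one b j (by rwa [hj]))
    · rw [List.pairwise_reverse]
      refine (List.pairwise_lt_finRange _).imp ?_
      intro x y hxy a ha b hb
      rw [List.eq_of_mem_replicate ha, List.eq_of_mem_replicate hb]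
      exact Or.inl hxy
  · intro hj
    rw [if_neg (by omega), List.pairwise_flatMap]
    constructor
    · intro b _
      rw [List.pairwise_replicate]
      by_cases hb : deg m n b = 0
      · exact Or.inl (A.le_one b j (by omega))
      · exact Or.inr (by simp [RowRel, hb])
    · refine (List.pairwise_lt_finRange _).imp ?_
      intro x y hxy a ha b hb
      rw [List.eq_of_mem_replicate ha, List.eq_of_mem_replicate hb]
      unfold RowRel
      grind

/-- Both orders are antisymmetric, so a block is determined by its content. Hence matrices
correspond to arbitrary families of lists with the block property. -/
theorem IsBlock.eq_of_perm {j : Letter u v} {l l' : List (Letter m n)} (hl : IsBlock m n j l)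
    (hl' : IsBlock m n j l') (h : l.Perm l') : l = l' := by
  rcases deg_eq_zero_or_one j with hj | hj
  · refine h.eq_of_pairwise ?_ (hl.1 hj) (hl'.1 hj)
    intro a b _ _ h1 h2
    unfold RowRel at *
    grind
  · refine h.eq_of_pairwise ?_ (hl.2 hj) (hl'.2 hj)
    intro a b _ _ h1 h2
    rw [← colRel_iff] at h1 h2
    unfold ColRel at *
    grind

theorem IsBlock.count_le_one {j : Letter u v} {l : List (Letter m n)} (hl : IsBlock m n j l)
    {b : Letter m n} (hb : deg m n b ≠ deg u v j) : l.count b ≤ 1 := by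
  by_contra h
  have hsub : List.Sublist [b, b] l := List.replicate_sublist_iff.2 (by omega : 2 ≤ l.count b)
  rcases deg_eq_zero_or_one j with hj | hj
  · have := (hl.1 hj).sublist hsub
    simp [RowRel] at this
    omega
  · have := (hl.2 hj).sublist hsub
    have h2 := deg_eq_zero_or_one b
    simp [RowRel] at this
    omega

/-- The matrix with given blocks. -/
def matrixOfBlocks (l : Letter u v → List (Letter m n)) (hl : ∀ j, IsBlock m n j (l j)) :
    SuperMatrix m n u v :=
  ⟨fun b j => (l j).count b, fun _ j h => (hl j).count_le_one h⟩

theorem block_matrixOfBlocks (l : Letter u v → List (Letter m n)) (hl : ∀ j, IsBlock m n j (l j))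
    (j : Letter u v) : (matrixOfBlocks l hl).block j = l j := by
  refine ((matrixOfBlocks l hl).isBlock j).eq_of_perm (hl j) ?_
  rw [List.perm_iff_count]
  intro b
  rw [SuperMatrix.count_block]
  rfl

theorem SuperMatrix.ext_block {A B : SuperMatrix m n u v} (h : ∀ j, A.block j = B.block j) :
    A = B := by
  ext b j
  rw [← A.count_block, ← B.count_block, h]

/-! ### The two insertion tableaux of a matrix have the same shape -/

/-- The sign that reverses the order in the blocks of barred letters. -/
def sgn {m n : ℕ} (b : Letter m n) : ℤ := if deg m n b = 0 then -1 else 1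

/-- The biword of a matrix, with its pairs made distinct. -/
def SuperMatrix.expand (A : SuperMatrix m n u v) : List (Letter m n × Letter u v × ℕ) :=
  (List.finRange (u + v)).flatMap fun j => (blockOrder m n j).flatMap fun b =>
    (List.range (A.entry b j)).map fun t => (b, j, t)

/-- The biword of the transposed matrix, with its pairs made distinct. -/
def SuperMatrix.expandStar (A : SuperMatrix m n u v) : List (Letter m n × Letter u v × ℕ) :=
  (List.finRange (m + n)).flatMap fun b => (blockOrder u v b).flatMap fun j =>
    -- Several copies of one pair occur only if both letters have the same degree. A barred letter
    -- bumps its equals, so a later copy has to count as smaller; hence the reversed numbering.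
    (if deg m n b = 0 then (List.range (A.entry b j)).reverse else List.range (A.entry b j)).map
      fun t => (b, j, t)

/-- The order of the pairs in the biword of a matrix. -/
def keyCol (x : Letter m n × Letter u v × ℕ) : ℕ ×ₗ ℤ ×ₗ ℕ :=
  toLex (x.2.1.val, toLex (sgn x.2.1 * x.1.val, x.2.2))

/-- The order of the pairs in the biword of the transposed matrix. -/
def keyRow (x : Letter m n × Letter u v × ℕ) : ℕ ×ₗ ℤ ×ₗ ℤ :=
  toLex (x.1.val, toLex (sgn x.1 * x.2.1.val, sgn x.1 * x.2.2))

theorem keyCol_lt_iff {x y : Letter m n × Letter u v × ℕ} :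
    keyCol x < keyCol y ↔ x.2.1 < y.2.1 ∨ (x.2.1 = y.2.1 ∧
      (sgn x.2.1 * x.1.val < sgn x.2.1 * y.1.val ∨ (x.1 = y.1 ∧ x.2.2 < y.2.2))) := by
  unfold keyCol
  simp only [Prod.Lex.toLex_lt_toLex, ← Fin.ext_iff, Fin.val_fin_lt]
  refine or_congr Iff.rfl (and_congr_right fun h => ?_)
  rw [h]
  refine or_congr Iff.rfl (and_congr_left fun _ => ?_)
  unfold sgn
  split_ifs <;> rw [Fin.ext_iff] <;> omega

theorem keyRow_lt_iff {x y : Letter m n × Letter u v × ℕ} :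
    keyRow x < keyRow y ↔ x.1 < y.1 ∨ (x.1 = y.1 ∧
      (sgn x.1 * x.2.1.val < sgn x.1 * y.2.1.val ∨
        (x.2.1 = y.2.1 ∧ sgn x.1 * x.2.2 < sgn x.1 * y.2.2))) := by
  unfold keyRow
  simp only [Prod.Lex.toLex_lt_toLex, ← Fin.ext_iff, Fin.val_fin_lt]
  refine or_congr Iff.rfl (and_congr_right fun h => ?_)
  rw [h]
  refine or_congr Iff.rfl (and_congr_left fun _ => ?_)
  unfold sgn
  split_ifs <;> rw [Fin.ext_iff] <;> omega

theorem pairwise_blockOrder (j : Letter u v) :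
    (blockOrder m n j).Pairwise fun x y => sgn j * (x.val : ℤ) < sgn j * y.val := by
  unfold blockOrder sgn
  split_ifs
  · rw [List.pairwise_reverse]
    refine (List.pairwise_lt_finRange _).imp fun {x y} h => ?_
    have : x.val < y.val := h
    omega
  · refine (List.pairwise_lt_finRange _).imp fun {x y} h => ?_
    have : x.val < y.val := h
    omega

theorem SuperMatrix.pairwise_expand (A : SuperMatrix m n u v) :
    A.expand.Pairwise fun x y => keyCol x < keyCol y := by
  unfold expand
  simp only [keyCol_lt_iff]
  rw [List.pairwise_flatMap]
  constructor
  · intro j _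
    rw [List.pairwise_flatMap]
    constructor
    · intro b _
      rw [List.pairwise_map]
      refine List.pairwise_lt_range.imp fun {s t} h => ?_
      simp [h]
    · refine (pairwise_blockOrder j).imp fun {x y} h => ?_
      intro p hp q hq
      simp only [List.mem_map] at hp hq
      obtain ⟨s, -, rfl⟩ := hp
      obtain ⟨t, -, rfl⟩ := hq
      exact Or.inr ⟨rfl, Or.inl h⟩
  · refine (List.pairwise_lt_finRange _).imp fun {x y} h => ?_
    intro p hp q hq
    simp only [List.mem_flatMap, List.mem_map] at hp hq
    obtain ⟨b, -, s, -, rfl⟩ := hp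
    obtain ⟨c, -, t, -, rfl⟩ := hq
    exact Or.inl h

theorem SuperMatrix.pairwise_expandStar (A : SuperMatrix m n u v) :
    A.expandStar.Pairwise fun x y => keyRow x < keyRow y := by
  unfold expandStar
  simp only [keyRow_lt_iff]
  rw [List.pairwise_flatMap]
  constructor
  · intro b _
    rw [List.pairwise_flatMap]
    constructor
    · intro j _
      rw [List.pairwise_map]
      unfold sgn
      split_ifs
      · rw [List.pairwise_reverse]
        refine List.pairwise_lt_range.imp fun {s t} h => ?_
        simp [h]
      · refine List.pairwise_lt_range.imp fun {s t} h => ?_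
        simp [h]
    · refine (pairwise_blockOrder b).imp fun {x y} h => ?_
      intro p hp q hq
      simp only [List.mem_map] at hp hq
      obtain ⟨s, -, rfl⟩ := hp
      obtain ⟨t, -, rfl⟩ := hq
      exact Or.inr ⟨rfl, Or.inl h⟩
  · refine (List.pairwise_lt_finRange _).imp fun {x y} h => ?_
    intro p hp q hq
    simp only [List.mem_flatMap, List.mem_map] at hp hq
    obtain ⟨b, -, s, -, rfl⟩ := hp
    obtain ⟨c, -, t, -, rfl⟩ := hq
    exact Or.inl h

theorem SuperMatrix.mem_expand (A : SuperMatrix m n u v) (x : Letter m n × Letter u v × ℕ) :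
    x ∈ A.expand ↔ x.2.2 < A.entry x.1 x.2.1 := by
  obtain ⟨b, j, t⟩ := x
  simp [expand, mem_blockOrder]

theorem SuperMatrix.mem_expandStar (A : SuperMatrix m n u v) (x : Letter m n × Letter u v × ℕ) :
    x ∈ A.expandStar ↔ x.2.2 < A.entry x.1 x.2.1 := by
  obtain ⟨b, j, t⟩ := x
  simp only [expandStar, List.mem_flatMap, List.mem_finRange, List.mem_map, true_and]
  constructor
  · rintro ⟨b', j', -, t', ht, h⟩
    simp only [Prod.mk.injEq] at h
    obtain ⟨rfl, rfl, rfl⟩ := h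
    split_ifs at ht <;> simpa using ht
  · intro h
    refine ⟨b, j, mem_blockOrder _ _, t, ?_, rfl⟩
    split_ifs <;> simpa using h

theorem SuperMatrix.expand_perm (A : SuperMatrix m n u v) : A.expand.Perm A.expandStar := by
  refine (List.perm_ext_iff_of_nodup ?_ ?_).2 fun x => by rw [mem_expand, mem_expandStar]
  · exact A.pairwise_expand.imp fun {x y} h e => by simp [e] at h
  · exact A.pairwise_expandStar.imp fun {x y} h e => by simp [e] at h

theorem SuperMatrix.expand_map (A : SuperMatrix m n u v) :
    A.expand.map (fun x => x.1) = A.wordPair.1 := by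
  simp only [wordPair_fst, expand, List.map_flatMap, List.map_map]
  congr 1
  funext j
  congr 1
  funext b
  exact List.eq_replicate_iff.2 ⟨by simp, by simp⟩

theorem SuperMatrix.expandStar_map (A : SuperMatrix m n u v) :
    A.expandStar.map (fun x => x.2.1) = A.wordPairStar.1 := by
  simp only [wordPairStar, wordPair_fst, expandStar, List.map_flatMap, List.map_map]
  congr 1
  funext b
  congr 1
  funext j
  exact List.eq_replicate_iff.2 ⟨by split_ifs <;> simp [transpose], by simp⟩

/-- Along the biword, a later first letter bumps an earlier one precisely when its triple is smaller
for `keyRow`: ties between equal letters are broken consistently by the second letter and the copy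
number. The same holds along the transposed biword with `keyCol`. By `colP_congr` both tableaux
become insertion tableaux for strict orders, and `colLens_symm` applies. -/
theorem SuperMatrix.colLens_P₁_eq (A : SuperMatrix m n u v) :
    colLens A.P₁ = colLens A.P₂ := by
  have h1 : colP (fun x y : Letter m n × Letter u v × ℕ => RowRel m n x.1 y.1) A.expand =
      colP (fun x y => keyRow x < keyRow y) A.expand := by
    refine colP_congr (A.pairwise_expand.imp_of_mem fun {x y} hx hy h => ?_)
    rw [mem_expand] at hx hy
    rw [keyCol_lt_iff] at h
    rw [keyRow_lt_iff]
    have hle := A.le_one x.1 x.2.1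
    obtain ⟨b, j, s⟩ := x
    obtain ⟨c, k, t⟩ := y
    have := deg_eq_zero_or_one b
    have := deg_eq_zero_or_one j
    simp only [RowRel, sgn, Fin.lt_def, Fin.ext_iff] at *
    by_cases hbc : b = c <;> by_cases hjk : j = k
    -- Two different copies of one pair: the entry is at least 2, so by `hle` the two degrees agree.
    · subst hbc; subst hjk
      split_ifs at * <;> simp at * <;> omega
    · subst hbc
      have : j.val ≠ k.val := fun e => hjk (Fin.ext e)
      split_ifs at * <;> simp at * <;> omega
    · subst hjk
      have : b.val ≠ c.val := fun e => hbc (Fin.ext e)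
      split_ifs at * <;> simp at * <;> omega
    · have : j.val ≠ k.val := fun e => hjk (Fin.ext e)
      have : b.val ≠ c.val := fun e => hbc (Fin.ext e)
      split_ifs at * <;> simp at * <;> omega
  have h2 : colP (fun x y : Letter m n × Letter u v × ℕ => RowRel u v x.2.1 y.2.1) A.expandStar =
      colP (fun x y => keyCol x < keyCol y) A.expandStar := by
    have : IsBumpRel (fun x y : Letter m n × Letter u v × ℕ => RowRel u v x.2.1 y.2.1) :=
      isBumpRel_comap (RowRel u v) fun x : Letter m n × Letter u v × ℕ => x.2.1
    refine colP_congr (A.pairwise_expandStar.imp_of_mem fun {x y} hx hy h => ?_)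
    rw [mem_expandStar] at hx hy
    rw [keyRow_lt_iff] at h
    rw [keyCol_lt_iff]
    have hle := A.le_one x.1 x.2.1
    obtain ⟨b, j, s⟩ := x
    obtain ⟨c, k, t⟩ := y
    have := deg_eq_zero_or_one b
    have := deg_eq_zero_or_one j
    simp only [RowRel, sgn, Fin.lt_def, Fin.ext_iff] at *
    by_cases hbc : b = c <;> by_cases hjk : j = k
    · subst hbc; subst hjk
      split_ifs at * <;> simp at * <;> omega
    · subst hbc
      have : j.val ≠ k.val := fun e => hjk (Fin.ext e)
      split_ifs at * <;> simp at * <;> omega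
    · subst hjk
      have : b.val ≠ c.val := fun e => hbc (Fin.ext e)
      split_ifs at * <;> simp at * <;> omega
    · have : j.val ≠ k.val := fun e => hjk (Fin.ext e)
      have : b.val ≠ c.val := fun e => hbc (Fin.ext e)
      split_ifs at * <;> simp at * <;> omega
  unfold P₁ P₂
  rw [P_eq, P_eq, ← expand_map, ← expandStar_map,
    colP_map (S := fun x y : Letter m n × Letter u v × ℕ => RowRel m n x.1 y.1) fun _ _ => Iff.rfl,
    colP_map (S := fun x y : Letter m n × Letter u v × ℕ => RowRel u v x.2.1 y.2.1)
      fun _ _ => Iff.rfl, colLens_map, colLens_map, h1, h2]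
  exact colLens_symm keyRow keyCol A.pairwise_expand A.pairwise_expandStar A.expand_perm

/-- The matrix with the columns at positions `≥ q` replaced by zero. -/
def SuperMatrix.restrictCols (A : SuperMatrix m n u v) (q : ℕ) : SuperMatrix m n u v :=
  ⟨fun b j => if j.val < q then A.entry b j else 0, fun b j h => by
    have := A.le_one b j h
    split_ifs <;> omega⟩

theorem flatMap_filter_eq {ι β : Type*} (l : List ι) (p : ι → Bool) (f : ι → List β) :
    (l.filter p).flatMap f = l.flatMap fun i => if p i then f i else [] := by
  induction l with
  | nil => rfl
  | cons a l ih => by_cases h : p a <;> simp [h, ih]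

/-- Deleting the last columns truncates the word i and filters the word l. Equality of shapes for
the truncated matrix is what makes P₂ a recording tableau. -/
theorem SuperMatrix.wordPair_restrictCols (A : SuperMatrix m n u v) (q : ℕ) :
    (A.restrictCols q).wordPair.1 = A.prefixWord q := by
  rw [wordPair_fst, prefixWord, flatMap_filter_eq]
  congr 1
  funext j
  unfold block restrictCols
  by_cases h : j.val < q <;> simp [h]

theorem SuperMatrix.wordPairStar_restrictCols (A : SuperMatrix m n u v) (q : ℕ) :
    (A.restrictCols q).wordPairStar.1 = A.wordPairStar.1.filter fun j => j.val < q := by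
  simp only [wordPairStar, wordPair_fst, List.filter_flatMap, block]
  congr 1
  funext b
  rw [block]
  congr 1
  funext j
  rw [List.filter_replicate]
  unfold transpose restrictCols
  by_cases h : j.val < q <;> simp [h, Matrix.transpose]

/-- The tableau `P₂` records the growth of the shapes of the insertion tableaux. -/
theorem SuperMatrix.length_filter_P₂ (A : SuperMatrix m n u v) (q j : ℕ) :
    ((A.P₂.getD j []).filter fun b => b.val < q).length =
      colLens (P m n (A.prefixWord q)) j := by
  have := congrFun (A.restrictCols q).colLens_P₁_eq j
  unfold P₁ P₂ at this
  rw [wordPair_restrictCols, wordPairStar_restrictCols] at this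
  rw [this, colLens, P_filter]
  rfl

end Blocks

end SuperKnuth

namespace SuperKnuth

variable {m n u v : ℕ}

/-! ### A tableau is determined by the shapes of its restrictions -/

theorem IsCol.sorted_le {c : List (Letter m n)} (hc : IsCol (RowRel m n) c) :
    c.Pairwise (· ≤ ·) := by
  refine List.Pairwise.imp (fun {x y} h => ?_) hc
  unfold RowRel at h
  grind

theorem count_add_length_filter (c : List (Letter m n)) (b : Letter m n) :
    (c.filter fun x => x.val < b.val + 1).length =
      (c.filter fun x => x.val < b.val).length + c.count b := by
  induction c with
  | nil => simp
  | cons x c ih =>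
    simp only [List.filter_cons, List.count_cons, decide_eq_true_eq, beq_iff_eq, Fin.ext_iff]
    split_ifs <;> (try simp only [List.length_cons]) <;> omega

theorem col_eq_of_filter_length {c d : List (Letter m n)} (hc : IsCol (RowRel m n) c)
    (hd : IsCol (RowRel m n) d)
    (h : ∀ q : ℕ, (c.filter fun x => x.val < q).length = (d.filter fun x => x.val < q).length) :
    c = d := by
  refine List.Perm.eq_of_pairwise (fun _ _ _ _ => le_antisymm) hc.sorted_le hd.sorted_le ?_
  rw [List.perm_iff_count]
  intro b
  have h1 := count_add_length_filter c b
  have h2 := count_add_length_filter d b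
  have h3 := h (b.val + 1)
  have h4 := h b.val
  omega

theorem IsTab.isCol_getD {T : List (List (Letter m n))} (hT : IsTab (RowRel m n) T) (j : ℕ) :
    IsCol (RowRel m n) (T.getD j []) := by
  by_cases hj : j < T.length
  · rw [List.getD_eq_getElem _ _ hj]
    exact hT.col _ (List.getElem_mem hj)
  · rw [List.getD_eq_default _ _ (by omega)]
    simp [IsCol]

theorem eq_of_getD_eq {β : Type*} {T T' : List (List β)} (hT : ∀ c ∈ T, c ≠ [])
    (hT' : ∀ c ∈ T', c ≠ []) (h : ∀ j, T.getD j [] = T'.getD j []) : T = T' := by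
  have aux : ∀ {S S' : List (List β)}, (∀ c ∈ S', c ≠ []) →
      (∀ j, S.getD j [] = S'.getD j []) → S'.length ≤ S.length := by
    intro S S' hS' h
    by_contra hlt
    push Not at hlt
    have := h S.length
    rw [List.getD_eq_default _ _ le_rfl, List.getD_eq_getElem _ _ hlt] at this
    exact hS' _ (List.getElem_mem hlt) this.symm
  refine List.ext_getElem (le_antisymm (aux hT fun j => (h j).symm) (aux hT' h)) ?_
  intro j h1 h2
  rw [← List.getD_eq_getElem _ [] h1, ← List.getD_eq_getElem _ [] h2, h]

theorem IsTab.eq_of_filter_length {T T' : List (List (Letter m n))} (hT : IsTab (RowRel m n) T)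
    (hT' : IsTab (RowRel m n) T')
    (h : ∀ q j : ℕ, ((T.getD j []).filter fun x => x.val < q).length =
      ((T'.getD j []).filter fun x => x.val < q).length) : T = T' :=
  eq_of_getD_eq hT.ne_nil hT'.ne_nil fun j =>
    col_eq_of_filter_length (hT.isCol_getD j) (hT'.isCol_getD j) fun q => h q j

/-! ### The Robinson–Schensted–Knuth correspondence -/

theorem SuperMatrix.isTab_P₂ (A : SuperMatrix m n u v) : IsTab (RowRel u v) A.P₂ := isTab_P _

theorem SuperMatrix.isTab_P₁ (A : SuperMatrix m n u v) : IsTab (RowRel m n) A.P₁ := isTab_P _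

theorem SuperMatrix.P₂_eq_iff (A B : SuperMatrix m n u v) :
    A.P₂ = B.P₂ ↔ ∀ q, colLens (P m n (A.prefixWord q)) = colLens (P m n (B.prefixWord q)) := by
  constructor
  · intro h q
    funext j
    rw [← length_filter_P₂, ← length_filter_P₂, h]
  · intro h
    refine A.isTab_P₂.eq_of_filter_length B.isTab_P₂ fun q j => ?_
    rw [length_filter_P₂, length_filter_P₂, h]

/-- Within a block the columns of the new cells are strictly increasing or weakly decreasing,
according to the degree of j. Their multiset, which is the difference of two shapes, therefore
determines their order. -/
theorem IsBlock.insCols_eq {j : Letter u v} {l l' : List (Letter m n)}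
    (hl : IsBlock m n j l) (hl' : IsBlock m n j l') {T T' : List (List (Letter m n))}
    (hT : IsTab (RowRel m n) T) (hT' : IsTab (RowRel m n) T')
    (h : (insCols (RowRel m n) T l).Perm (insCols (RowRel m n) T' l')) :
    insCols (RowRel m n) T l = insCols (RowRel m n) T' l' := by
  rcases deg_eq_zero_or_one j with hj | hj
  · exact h.eq_of_pairwise (fun _ _ _ _ h1 h2 => absurd h1 h2.asymm)
      (insCols_strictMono T (hl.1 hj)) (insCols_strictMono T' (hl'.1 hj))
  · exact h.eq_of_pairwise (fun _ _ _ _ h1 h2 => le_antisymm h2 h1)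
      (insCols_antitone hT (hl.2 hj)) (insCols_antitone hT' (hl'.2 hj))

/-- The blocks are removed from the last to the first. P₂ fixes the shapes before and after each
block, hence the columns of its new cells, and reverse bumping yields the block and the smaller
tableau. -/
theorem SuperMatrix.injective_P (A B : SuperMatrix m n u v) (h₁ : A.P₁ = B.P₁)
    (h₂ : A.P₂ = B.P₂) : A = B := by
  rw [P₂_eq_iff] at h₂
  have step : ∀ q (hq : q < u + v),
      P m n (A.prefixWord (q + 1)) = P m n (B.prefixWord (q + 1)) →
      P m n (A.prefixWord q) = P m n (B.prefixWord q) ∧ A.block ⟨q, hq⟩ = B.block ⟨q, hq⟩ := by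
    intro q hq h
    rw [prefixWord_succ _ hq, prefixWord_succ _ hq, P_append, P_append] at h
    refine foldl_colBump_injective (isTab_P _) (isTab_P _) h ?_
    refine (A.isBlock ⟨q, hq⟩).insCols_eq (B.isBlock ⟨q, hq⟩) (isTab_P _) (isTab_P _) ?_
    rw [List.perm_iff_count]
    intro j
    have e1 := colLens_foldl (R := RowRel m n) (P m n (A.prefixWord q)) (A.block ⟨q, hq⟩) j
    have e2 := colLens_foldl (R := RowRel m n) (P m n (B.prefixWord q)) (B.block ⟨q, hq⟩) j
    rw [h, e2, h₂ q] at e1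
    omega
  have all : ∀ k, k ≤ u + v →
      P m n (A.prefixWord (u + v - k)) = P m n (B.prefixWord (u + v - k)) := by
    intro k
    induction k with
    | zero =>
      intro _
      rw [Nat.sub_zero, prefixWord_full, prefixWord_full]
      exact h₁
    | succ k ih =>
      intro hk
      have := ih (by omega)
      rw [show u + v - k = (u + v - (k + 1)) + 1 by omega] at this
      exact (step _ (by omega) this).1
  refine ext_block fun j => (step j.val j.isLt ?_).2
  have := all (u + v - (j.val + 1)) (by omega)
  rwa [show u + v - (u + v - (j.val + 1)) = j.val + 1 by omega] at this

theorem RowLe.length_filter_le {s t : List (Letter m n)} (h : RowLe (RowRel m n) s t)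
    {p p' : Letter m n → Bool} (hp : ∀ x y, RowRel m n x y → p' y → p x) :
    (t.filter p').length ≤ (s.filter p).length := by
  induction s generalizing t with
  | nil => cases t with
    | nil => simp
    | cons y t => exact h.elim
  | cons x s ih => cases t with
    | nil => simp
    | cons y t =>
      have := ih h.2
      by_cases hy : p' y
      · simp [hy, hp x y h.1 hy]
        exact this
      · rw [List.filter_cons_of_neg hy]
        refine this.trans ?_
        simp only [List.filter_cons]
        split_ifs <;> simp

theorem IsTab.rowLe_getD {T : List (List (Letter m n))} (hT : IsTab (RowRel m n) T) (j : ℕ) :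
    RowLe (RowRel m n) (T.getD j []) (T.getD (j + 1) []) := by
  by_cases hj : j + 1 < T.length
  · rw [List.getD_eq_getElem _ _ hj, List.getD_eq_getElem _ _ (by omega)]
    exact List.isChain_iff_getElem.1 hT.row j hj
  · have : T.getD (j + 1) [] = [] := List.getD_eq_default _ _ (by omega)
    rw [this]
    exact RowLe.nil _

theorem IsCol.count_le_one {c : List (Letter m n)} (hc : IsCol (RowRel m n) c) {b : Letter m n}
    (hb : deg m n b = 0) : c.count b ≤ 1 := by
  by_contra h
  have hsub : List.Sublist [b, b] c := List.replicate_sublist_iff.2 (by omega : 2 ≤ c.count b)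
  have := List.Pairwise.sublist hsub hc
  simp [RowRel, hb] at this

/-- The part of U with letters at positions less than q has shape `κ q`. Passing from q to q + 1
adds a horizontal strip if the letter at q is barred and a vertical strip if it is unbarred, so the
strip lemmas split off a block of the required kind. That the recording tableau is U follows from
the shapes of all prefixes. -/
theorem SuperMatrix.surjective_P {T : List (List (Letter m n))} {U : List (List (Letter u v))}
    (hT : IsTab (RowRel m n) T) (hU : IsTab (RowRel u v) U) (h : colLens T = colLens U) :
    ∃ A : SuperMatrix m n u v, A.P₁ = T ∧ A.P₂ = U := by
  let κ : ℕ → ℕ → ℕ := fun q j => ((U.getD j []).filter fun x => x.val < q).length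
  have hκfull : κ (u + v) = colLens U := by
    funext j
    simp [κ, colLens]
  have hκzero : κ 0 = fun _ => 0 := by
    funext j
    simp [κ]
  have step : ∀ q (hq : q < u + v) (S : List (List (Letter m n))), IsTab (RowRel m n) S →
      colLens S = κ (q + 1) → ∃ S₀, ∃ l : List (Letter m n), IsTab (RowRel m n) S₀ ∧
        colLens S₀ = κ q ∧ l.foldl (colBump (RowRel m n)) S₀ = S ∧ IsBlock m n (⟨q, hq⟩ : Letter u v) l := by
    intro q hq S hS hlen
    have hcount : ∀ j, κ (q + 1) j = κ q j + (U.getD j []).count ⟨q, hq⟩ := fun j =>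
      count_add_length_filter (U.getD j []) ⟨q, hq⟩
    rcases deg_eq_zero_or_one (⟨q, hq⟩ : Letter u v) with hd | hd
    · obtain ⟨S₀, l, h1, h2, h3, h4⟩ := exists_foldl_of_horizontal hS (κ q)
        (fun j => (hU.rowLe_getD j).length_filter_le fun x y hxy hy => by
          simp only [decide_eq_true_eq] at hy ⊢
          unfold RowRel at hxy
          have : x.val ≤ y.val := by
            rcases hxy with h | h
            · exact le_of_lt h
            · rw [h.1]
          omega)
        (fun j => by rw [hlen, hcount]; omega)
        (fun j => by
          rw [hlen, hcount]
          have := (hU.isCol_getD j).count_le_one hd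
          omega)
      exact ⟨S₀, l, h1, h2, h3, fun _ => h4, fun h => by omega⟩
    · obtain ⟨S₀, l, h1, h2, h3, h4⟩ := exists_foldl_of_vertical hS (κ q)
        (fun j => by rw [hlen, hcount]; omega)
        (fun j => by
          rw [hlen]
          refine (hU.rowLe_getD j).length_filter_le fun x y hxy hy => ?_
          simp only [decide_eq_true_eq] at hy ⊢
          unfold RowRel at hxy
          unfold deg at hxy hd
          simp only [Fin.lt_def, Fin.ext_iff] at hxy hd
          split_ifs at hxy hd <;> simp only [and_false, or_false, and_true] at hxy <;> omega)
      exact ⟨S₀, l, h1, h2, h3, fun h => by omega, fun _ => h4⟩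
  have main : ∀ q, q ≤ u + v → ∀ S : List (List (Letter m n)), IsTab (RowRel m n) S →
      colLens S = κ q → ∃ l : Letter u v → List (Letter m n),
        (∀ j, IsBlock m n j (l j)) ∧
        (∀ r, r ≤ q → colLens (P m n (((List.finRange (u + v)).filter
          fun j => j.val < r).flatMap l)) = κ r) ∧
        P m n (((List.finRange (u + v)).filter fun j => j.val < q).flatMap l) = S := by
    intro q
    induction q with
    | zero =>
      intro _ S hS hlen
      refine ⟨fun _ => [], fun j => ⟨by simp, by simp⟩, ?_, ?_⟩
      · intro r hr
        have : r = 0 := by omega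
        subst this
        funext j
        simp [P, colLens, hκzero]
      · rw [hκzero] at hlen
        cases S with
        | nil => simp [P]
        | cons c S =>
          have := congrFun hlen 0
          rw [colLens_cons_zero] at this
          exact absurd (List.length_eq_zero_iff.1 this) (hS.ne_nil c (by simp))
    | succ q ih =>
      intro hq S hS hlen
      have hq' : q < u + v := by omega
      obtain ⟨S₀, b, h1, h2, h3, h4⟩ := step q hq' S hS hlen
      obtain ⟨l, hl1, hl2, hl3⟩ := ih (by omega) S₀ h1 h2
      let l' := Function.update l (⟨q, hq'⟩ : Letter u v) b
      have hpre : ∀ r, r ≤ q → ((List.finRange (u + v)).filter fun j => j.val < r).flatMap l' =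
          ((List.finRange (u + v)).filter fun j => j.val < r).flatMap l := by
        intro r hr
        refine List.flatMap_congr fun j hj => ?_
        simp only [List.mem_filter, List.mem_finRange, true_and, decide_eq_true_eq] at hj
        refine Function.update_of_ne ?_ _ _
        intro e
        rw [e] at hj
        simp only at hj
        omega
      have hfull : P m n (((List.finRange (u + v)).filter fun j => j.val < q + 1).flatMap l') =
          S := by
        rw [filter_finRange_succ hq', List.flatMap_append, P_append, hpre q le_rfl, hl3]
        simp [l', h3]
      refine ⟨l', ?_, ?_, hfull⟩
      · intro j
        by_cases hj : j = ⟨q, hq'⟩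
        · rw [hj]; simpa [l'] using h4
        · simpa [l', Function.update_of_ne hj] using hl1 j
      · intro r hr
        rcases Nat.lt_or_eq_of_le hr with hr | rfl
        · rw [hpre r (by omega)]
          exact hl2 r (by omega)
        · rw [hfull, hlen]
  obtain ⟨l, h1, h2, h3⟩ := main (u + v) le_rfl T hT (by rw [h, hκfull])
  let A := matrixOfBlocks l h1
  have hpre : ∀ q, A.prefixWord q = ((List.finRange (u + v)).filter fun j => j.val < q).flatMap l :=
    fun q => List.flatMap_congr fun j _ => block_matrixOfBlocks l h1 j
  refine ⟨A, ?_, ?_⟩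
  · rw [P₁, ← prefixWord_full, hpre, h3]
  · refine A.isTab_P₂.eq_of_filter_length hU fun q j => ?_
    rw [length_filter_P₂]
    by_cases hq : q ≤ u + v
    · rw [hpre, h2 q hq]
    · have e : A.prefixWord q = A.prefixWord (u + v) := by
        unfold prefixWord
        congr 1
        refine List.filter_congr fun j _ => ?_
        have := j.isLt
        simp
        omega
      rw [e, hpre, h2 (u + v) le_rfl, hκfull]
      unfold colLens
      rw [List.filter_eq_self.2]
      intro x _
      have := x.isLt
      simp
      omega

/-! ### Tableaux and shapes -/

theorem rowLe_iff {s t : List (Letter m n)} :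
    RowLe (RowRel m n) s t ↔ t.length ≤ s.length ∧ ∀ (k : ℕ) (x y : Letter m n),
      s[k]? = some x → t[k]? = some y → RowRel m n x y := by
  induction s generalizing t with
  | nil => cases t with
    | nil => simp [RowLe.nil]
    | cons y t => simp [RowLe]
  | cons x s ih => cases t with
    | nil => simp [RowLe.nil]
    | cons y t =>
      rw [RowLe, ih]
      constructor
      · rintro ⟨h1, h2, h3⟩
        refine ⟨by simpa using h2, ?_⟩
        intro k a b ha hb
        cases k with
        | zero =>
          simp only [List.getElem?_cons_zero, Option.some.injEq] at ha hb
          rwa [← ha, ← hb]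
        | succ k => exact h3 k a b (by simpa using ha) (by simpa using hb)
      · rintro ⟨h1, h2⟩
        exact ⟨h2 0 x y rfl rfl, by simpa using h1, fun k a b ha hb =>
          h2 (k + 1) a b (by simpa using ha) (by simpa using hb)⟩

theorem isCol_iff {c : List (Letter m n)} :
    IsCol (RowRel m n) c ↔ c.IsChain (ColRel m n) := by
  have : IsTrans (Letter m n) (ColRel m n) := ⟨by
    intro x y z h1 h2
    unfold ColRel at *
    grind⟩
  rw [List.isChain_iff_pairwise]
  exact ⟨fun h => h.imp fun h => colRel_iff.2 h, fun h => h.imp fun h => colRel_iff.1 h⟩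

theorem isTableau_iff {μ : YoungDiagram} {T : List (List (Letter m n))} :
    IsTableau m n μ T ↔ IsTab (RowRel m n) T ∧ colLens T = μ.colLen := by
  constructor
  · intro h
    refine ⟨⟨fun c hc e => h.nonempty (e ▸ hc), fun c hc => isCol_iff.2 (h.col c hc), ?_⟩,
      funext h.shape⟩
    have := h.row
    rw [List.isChain_iff_getElem] at this ⊢
    intro j hj
    refine rowLe_iff.2 ⟨?_, this j hj⟩
    have h1 := h.shape j
    have h2 := h.shape (j + 1)
    rw [List.getD_eq_getElem _ _ hj] at h2
    rw [List.getD_eq_getElem _ _ (by omega)] at h1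
    rw [h1, h2]
    exact μ.colLen_anti _ _ (by omega)
  · rintro ⟨h, hs⟩
    refine ⟨fun hm => h.ne_nil _ hm rfl, fun j => congrFun hs j,
      fun c hc => isCol_iff.1 (h.col c hc), ?_⟩
    exact h.row.imp fun s t hst => (rowLe_iff.1 hst).2

theorem exists_shape {α : Type*} {R : α → α → Prop} [DecidableRel R] {T : List (List α)}
    (hT : IsTab R T) : ∃ μ : YoungDiagram, colLens T = μ.colLen := by
  have hanti : Antitone (colLens T) := antitone_nat_of_succ_le hT.colLens_anti
  let w := T.map List.length
  have hget : ∀ j (hj : j < w.length), w[j] = colLens T j := by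
    intro j hj
    simp only [w, List.length_map] at hj
    simp [w, colLens, hj]
  have hw : w.SortedGE := by
    rw [List.sortedGE_iff_getElem_ge_getElem_of_le]
    intro i j hi hj hij
    rw [hget, hget]
    exact hanti hij
  -- The lengths at hand are those of columns, whereas `ofRowLens` builds rows.
  refine ⟨(YoungDiagram.ofRowLens w hw).transpose, ?_⟩
  funext j
  refine le_antisymm ?_ ?_ <;> rw [← not_lt] <;> intro h
  · have h1 := YoungDiagram.mem_iff_lt_colLen.not.2 (lt_irrefl
      ((YoungDiagram.ofRowLens w hw).transpose.colLen j))
    rw [YoungDiagram.mem_transpose, Prod.swap_prod_mk, YoungDiagram.mem_ofRowLens] at h1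
    refine h1 ?_
    have hj : j < w.length := by
      by_contra hj
      rw [colLens_eq_zero_of_length_le (by simpa [w] using hj)] at h
      omega
    exact ⟨hj, by simpa [hget] using h⟩
  · have h1 := YoungDiagram.mem_iff_lt_colLen.2 h
    rw [YoungDiagram.mem_transpose, Prod.swap_prod_mk, YoungDiagram.mem_ofRowLens] at h1
    obtain ⟨hj, h2⟩ := h1
    simp only [hget] at h2
    omega

theorem eq_of_colLen_eq {μ ν : YoungDiagram} (h : μ.colLen = ν.colLen) : μ = ν := by
  ext ⟨i, j⟩
  rw [YoungDiagram.mem_cells, YoungDiagram.mem_cells, YoungDiagram.mem_iff_lt_colLen,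
    YoungDiagram.mem_iff_lt_colLen, h]

end SuperKnuth

namespace SuperKnuth

variable {m n : ℕ}

/-! ### The crystal of words -/

theorem lo_ne_hi (i : Index m n) : lo m n i ≠ hi m n i := by
  simp [lo, hi, Fin.ext_iff]

theorem form_root (i : Index m n) (x : Weight m n) :
    form m n (root m n i) x =
      (-1) ^ deg m n (lo m n i) * x (lo m n i) - (-1) ^ deg m n (hi m n i) * x (hi m n i) := by
  unfold form root
  have : ∀ b, (-1 : ℤ) ^ deg m n b * ((Pi.single (lo m n i) 1 - Pi.single (hi m n i) 1 :
      Weight m n) b * x b) =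
      (if b = lo m n i then (-1) ^ deg m n b * x b else 0) -
        (if b = hi m n i then (-1) ^ deg m n b * x b else 0) := by
    intro b
    simp only [Pi.sub_apply, Pi.single_apply]
    split_ifs <;> ring
  rw [Finset.sum_congr rfl fun b _ => this b, Finset.sum_sub_distrib]
  simp

/-- The signs in the form and in the coroot cancel, except at the odd root, where the two letters
have different degrees and their coefficients add up. -/
theorem coroot_eq (i : Index m n) (x : Weight m n) :
    coroot m n i x = if i.val + 1 = m then x (lo m n i) + x (hi m n i)
      else x (lo m n i) - x (hi m n i) := by
  unfold coroot
  rw [form_root]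
  unfold deg lo hi
  simp only
  split_ifs <;> omega

theorem wordWt_cons (b : Letter m n) (w : List (Letter m n)) :
    wordWt m n (b :: w) = letterWt m n b + wordWt m n w := by
  funext c
  simp only [wordWt, letterWt, List.count_cons, Pi.add_apply, Pi.single_apply, beq_iff_eq]
  split_ifs with h1 h2 h2 <;> simp_all [add_comm]

theorem letter_cases (i : Index m n) (b : Letter m n) :
    b = lo m n i ∨ b = hi m n i ∨ (b ≠ lo m n i ∧ b ≠ hi m n i) := by
  tauto

theorem coroot_add (i : Index m n) (x y : Weight m n) :
    coroot m n i (x + y) = coroot m n i x + coroot m n i y := by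
  simp only [coroot_eq, Pi.add_apply]
  split_ifs <;> ring

theorem coroot_letterWt_lo (i : Index m n) : coroot m n i (letterWt m n (lo m n i)) = 1 := by
  rw [coroot_eq]
  have := lo_ne_hi i
  simp [letterWt, this.symm]

theorem coroot_letterWt_hi (i : Index m n) :
    coroot m n i (letterWt m n (hi m n i)) = if i.val + 1 = m then 1 else -1 := by
  rw [coroot_eq]
  have := lo_ne_hi i
  simp [letterWt, this]

theorem coroot_letterWt_other {i : Index m n} {b : Letter m n} (h1 : b ≠ lo m n i)
    (h2 : b ≠ hi m n i) : coroot m n i (letterWt m n b) = 0 := by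
  rw [coroot_eq]
  simp [letterWt, h1.symm, h2.symm]

/-- Replaces the coroots of words in the tensor product rule by φ - ε. From here on the rule for
even indices is truncated arithmetic in ε and φ. -/
theorem word_string (i : Index m n) (hi' : i.val + 1 ≠ m) (w : List (Letter m n)) :
    (wordPhi m n i w : ℤ) - wordEps m n i w = coroot m n i (wordWt m n w) := by
  induction w with
  | nil =>
    rw [coroot_eq]
    simp [wordPhi, wordEps, wordWt]
  | cons b w ih =>
    have h0 := lo_ne_hi i
    rw [wordWt_cons, coroot_add, ← ih]
    simp only [wordPhi, wordEps, letterEps, letterPhi, if_neg hi', ← ih]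
    rcases letter_cases i b with rfl | rfl | ⟨h1, h2⟩
    · simp only [coroot_letterWt_lo, if_true, if_neg h0]
      split_ifs <;> push_cast <;> omega
    · simp only [coroot_letterWt_hi, if_true, if_neg h0.symm, if_neg hi']
      split_ifs <;> push_cast <;> omega
    · simp only [coroot_letterWt_other h1 h2, if_neg h1, if_neg h2]
      split_ifs <;> push_cast <;> omega

/-- This and the next formulas are the bracketing rule for one more letter on the left: ε counts the
uncancelled letters `hi`, φ the uncancelled letters `lo`. For indices before 0 a new `lo` cancels a
`hi` on its right, for indices after 0 a new `hi` cancels a `lo` on its right; for the index 0 the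
leftmost of the two letters decides alone. -/
theorem wordEps_lo_even {i : Index m n} (h : i.val + 1 < m) (w : List (Letter m n)) :
    wordEps m n i (lo m n i :: w) = wordEps m n i w - 1 := by
  have h0 := lo_ne_hi i
  simp only [wordEps, h, if_true, letterEps, if_neg h0, coroot_letterWt_lo]
  push_cast
  omega

theorem wordEps_hi_even {i : Index m n} (h : i.val + 1 < m) (w : List (Letter m n)) :
    wordEps m n i (hi m n i :: w) = wordEps m n i w + 1 := by
  have h1 : ¬ i.val + 1 = m := by omega
  simp only [wordEps, h, if_true, letterEps, coroot_letterWt_hi, if_neg h1]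
  push_cast
  omega

theorem wordPhi_lo_even {i : Index m n} (h : i.val + 1 < m) (w : List (Letter m n)) :
    wordPhi m n i (lo m n i :: w) = wordPhi m n i w + (1 - wordEps m n i w) := by
  have h1 : ¬ i.val + 1 = m := by omega
  have := word_string i h1 w
  simp only [wordPhi, h, if_true, letterPhi, ← this]
  push_cast
  omega

theorem wordPhi_hi_even {i : Index m n} (h : i.val + 1 < m) (w : List (Letter m n)) :
    wordPhi m n i (hi m n i :: w) = wordPhi m n i w := by
  have h0 := lo_ne_hi i
  have h1 : ¬ i.val + 1 = m := by omega
  have := word_string i h1 w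
  simp only [wordPhi, h, if_true, letterPhi, ← this, if_neg h0.symm]
  push_cast
  omega

theorem wordEps_lo_odd {i : Index m n} (h : m < i.val + 1) (w : List (Letter m n)) :
    wordEps m n i (lo m n i :: w) = wordEps m n i w := by
  have h0 := lo_ne_hi i
  have h1 : ¬ i.val + 1 = m := by omega
  have h2 : ¬ i.val + 1 < m := by omega
  have := word_string i h1 w
  simp only [wordEps, h1, h2, if_false, letterEps, if_neg h0, ← this]
  push_cast
  omega

theorem wordEps_hi_odd {i : Index m n} (h : m < i.val + 1) (w : List (Letter m n)) :
    wordEps m n i (hi m n i :: w) = wordEps m n i w + (1 - wordPhi m n i w) := by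
  have h1 : ¬ i.val + 1 = m := by omega
  have h2 : ¬ i.val + 1 < m := by omega
  have := word_string i h1 w
  simp only [wordEps, h1, h2, if_false, letterEps, if_true, ← this]
  push_cast
  omega

theorem wordPhi_lo_odd {i : Index m n} (h : m < i.val + 1) (w : List (Letter m n)) :
    wordPhi m n i (lo m n i :: w) = wordPhi m n i w + 1 := by
  have h1 : ¬ i.val + 1 = m := by omega
  have h2 : ¬ i.val + 1 < m := by omega
  simp only [wordPhi, h1, h2, if_false, letterPhi, if_true, coroot_letterWt_lo]
  push_cast
  omega

theorem wordPhi_hi_odd {i : Index m n} (h : m < i.val + 1) (w : List (Letter m n)) :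
    wordPhi m n i (hi m n i :: w) = wordPhi m n i w - 1 := by
  have h0 := lo_ne_hi i
  have h1 : ¬ i.val + 1 = m := by omega
  have h2 : ¬ i.val + 1 < m := by omega
  simp only [wordPhi, h1, h2, if_false, letterPhi, if_neg h0.symm, coroot_letterWt_hi]
  push_cast
  omega

theorem wordEps_lo_zero {i : Index m n} (h : i.val + 1 = m) (w : List (Letter m n)) :
    wordEps m n i (lo m n i :: w) = 0 := by
  simp [wordEps, h, letterEps, lo_ne_hi, coroot_letterWt_lo]

theorem wordEps_hi_zero {i : Index m n} (h : i.val + 1 = m) (w : List (Letter m n)) :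
    wordEps m n i (hi m n i :: w) = 1 := by
  simp [wordEps, h, letterEps, coroot_letterWt_hi]

theorem wordPhi_lo_zero {i : Index m n} (h : i.val + 1 = m) (w : List (Letter m n)) :
    wordPhi m n i (lo m n i :: w) = 1 := by
  simp [wordPhi, h, letterPhi, coroot_letterWt_lo]

theorem wordPhi_hi_zero {i : Index m n} (h : i.val + 1 = m) (w : List (Letter m n)) :
    wordPhi m n i (hi m n i :: w) = 0 := by
  simp [wordPhi, h, letterPhi, (lo_ne_hi i).symm, coroot_letterWt_hi]

theorem wordEps_other {i : Index m n} {b : Letter m n} (h1 : b ≠ lo m n i) (h2 : b ≠ hi m n i)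
    (w : List (Letter m n)) : wordEps m n i (b :: w) = wordEps m n i w := by
  simp only [wordEps, letterEps, if_neg h2, coroot_letterWt_other h1 h2]
  by_cases h : i.val + 1 = m
  · simp [h]
  · have := word_string i h w
    rw [← this]
    split_ifs <;> push_cast <;> omega

theorem wordPhi_other {i : Index m n} {b : Letter m n} (h1 : b ≠ lo m n i) (h2 : b ≠ hi m n i)
    (w : List (Letter m n)) : wordPhi m n i (b :: w) = wordPhi m n i w := by
  simp only [wordPhi, letterPhi, if_neg h1, coroot_letterWt_other h1 h2]
  by_cases h : i.val + 1 = m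
  · simp [h]
  · have := word_string i h w
    rw [← this]
    split_ifs <;> push_cast <;> omega

theorem type_cases (i : Index m n) : i.val + 1 < m ∨ i.val + 1 = m ∨ m < i.val + 1 := by omega

/-- `e_i` and `f_i` act on the left factor of `x ⊗ y`. -/
def EActsLeft (i : Index m n) (x y : List (Letter m n)) : Prop :=
  (i.val + 1 < m ∧ wordEps m n i y ≤ wordPhi m n i x) ∨
    (i.val + 1 = m ∧ 0 < wordEps m n i x + wordPhi m n i x) ∨
    (m < i.val + 1 ∧ wordPhi m n i y < wordEps m n i x)

/-! The operators on `b ⊗ w` when `b` carries an `i`-arrow. -/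

theorem wordE_lo {i : Index m n} (w : List (Letter m n)) :
    wordE m n i (lo m n i :: w) =
      if (i.val + 1 < m ∧ wordEps m n i w ≤ 1) ∨ i.val + 1 = m then none
      else (wordE m n i w).map (lo m n i :: ·) := by
  have h0 := lo_ne_hi i
  simp only [wordE, letterPhi, letterEps, letterE, coroot_letterWt_lo, if_true, if_neg h0]
  by_cases h : (i.val + 1 < m ∧ wordEps m n i w ≤ 1) ∨ i.val + 1 = m
  · rw [if_pos h, if_pos (by omega)]; rfl
  · rw [if_neg h, if_neg (by omega)]

theorem wordE_hi {i : Index m n} (w : List (Letter m n)) :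
    wordE m n i (hi m n i :: w) =
      if (i.val + 1 < m ∧ wordEps m n i w = 0) ∨ i.val + 1 = m ∨
        (m < i.val + 1 ∧ wordPhi m n i w = 0) then some (lo m n i :: w)
      else (wordE m n i w).map (hi m n i :: ·) := by
  have h0 := lo_ne_hi i
  simp only [wordE, letterPhi, letterEps, letterE, coroot_letterWt_hi, if_true, if_neg h0.symm]
  by_cases h : i.val + 1 = m
  · simp [h]
  · simp only [h, if_false, false_and, false_or]
    by_cases h' : (i.val + 1 < m ∧ wordEps m n i w = 0) ∨ (m < i.val + 1 ∧ wordPhi m n i w = 0)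
    · rw [if_pos h', if_pos (by omega)]; rfl
    · rw [if_neg h', if_neg (by omega)]

theorem wordF_lo {i : Index m n} (w : List (Letter m n)) :
    wordF m n i (lo m n i :: w) =
      if (i.val + 1 < m ∧ wordEps m n i w = 0) ∨ i.val + 1 = m ∨
        (m < i.val + 1 ∧ wordPhi m n i w = 0) then some (hi m n i :: w)
      else (wordF m n i w).map (lo m n i :: ·) := by
  have h0 := lo_ne_hi i
  simp only [wordF, letterPhi, letterEps, letterF, coroot_letterWt_lo, if_true, if_neg h0]
  by_cases h' : (i.val + 1 < m ∧ wordEps m n i w = 0) ∨ i.val + 1 = m ∨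
      (m < i.val + 1 ∧ wordPhi m n i w = 0)
  · rw [if_pos h', if_pos (by omega)]; rfl
  · rw [if_neg h', if_neg (by omega)]

theorem wordF_hi {i : Index m n} (w : List (Letter m n)) :
    wordF m n i (hi m n i :: w) =
      if i.val + 1 = m ∨ (m < i.val + 1 ∧ wordPhi m n i w ≤ 1) then none
      else (wordF m n i w).map (hi m n i :: ·) := by
  have h0 := lo_ne_hi i
  simp only [wordF, letterPhi, letterEps, letterF, coroot_letterWt_hi, if_true, if_neg h0.symm]
  by_cases h : i.val + 1 = m
  · simp [h]
  · simp only [h, if_false, false_and, false_or]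
    by_cases h' : m < i.val + 1 ∧ wordPhi m n i w ≤ 1
    · rw [if_pos h', if_pos (by omega)]; rfl
    · rw [if_neg h', if_neg (by omega)]

theorem wordE_eq_none_iff (i : Index m n) (w : List (Letter m n)) :
    wordE m n i w = none ↔ wordEps m n i w = 0 := by
  induction w with
  | nil => simp [wordE, wordEps]
  | cons b w ih =>
    rcases letter_cases i b with rfl | rfl | ⟨h1, h2⟩
    · rw [wordE_lo]
      rcases type_cases i with h | h | h
      · rw [wordEps_lo_even h]
        split_ifs with hc
        · simp only [true_iff]; omega
        · rw [Option.map_eq_none_iff, ih]; omega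
      · rw [wordEps_lo_zero h, if_pos (by omega)]; simp
      · rw [wordEps_lo_odd h, if_neg (by omega), Option.map_eq_none_iff, ih]
    · rw [wordE_hi]
      rcases type_cases i with h | h | h
      · rw [wordEps_hi_even h]
        split_ifs with hc
        · simp
        · have : wordEps m n i w ≠ 0 := by omega
          simp [ih, this]
      · rw [wordEps_hi_zero h, if_pos (by omega)]; simp
      · rw [wordEps_hi_odd h]
        split_ifs with hc
        · simp only [false_iff]; omega
        · rw [Option.map_eq_none_iff, ih]; omega
    · simp only [wordE, letterPhi, letterEps, letterE, coroot_letterWt_other h1 h2, if_neg h1,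
        if_neg h2, wordEps_other h1 h2]
      split_ifs with hc
      · simp only [Option.map_none, true_iff]; omega
      · rw [Option.map_eq_none_iff, ih]

theorem wordF_eq_none_iff (i : Index m n) (w : List (Letter m n)) :
    wordF m n i w = none ↔ wordPhi m n i w = 0 := by
  induction w with
  | nil => simp [wordF, wordPhi]
  | cons b w ih =>
    rcases letter_cases i b with rfl | rfl | ⟨h1, h2⟩
    · rw [wordF_lo]
      rcases type_cases i with h | h | h
      · rw [wordPhi_lo_even h]
        split_ifs with hc
        · simp only [false_iff]; omega
        · rw [Option.map_eq_none_iff, ih]; omega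
      · rw [wordPhi_lo_zero h, if_pos (by omega)]; simp
      · rw [wordPhi_lo_odd h]
        split_ifs with hc
        · simp
        · have : wordPhi m n i w ≠ 0 := by omega
          simp [ih, this]
    · rw [wordF_hi]
      rcases type_cases i with h | h | h
      · rw [wordPhi_hi_even h, if_neg (by omega), Option.map_eq_none_iff, ih]
      · rw [wordPhi_hi_zero h, if_pos (by omega)]; simp
      · rw [wordPhi_hi_odd h]
        split_ifs with hc
        · simp only [true_iff]; omega
        · rw [Option.map_eq_none_iff, ih]; omega
    · simp only [wordF, letterPhi, letterEps, letterF, coroot_letterWt_other h1 h2, if_neg h1,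
        if_neg h2, wordPhi_other h1 h2]
      split_ifs with hc
      · simp only [Option.map_none, true_iff]; omega
      · rw [Option.map_eq_none_iff, ih]

theorem wordE_other {i : Index m n} {b : Letter m n} (h1 : b ≠ lo m n i) (h2 : b ≠ hi m n i)
    (w : List (Letter m n)) : wordE m n i (b :: w) = (wordE m n i w).map (b :: ·) := by
  simp only [wordE, letterPhi, letterEps, letterE, coroot_letterWt_other h1 h2, if_neg h1,
    if_neg h2]
  split_ifs with hc
  -- The rule selects the inert letter b only when ε_i of w is zero, so both sides vanish.
  · have := (wordE_eq_none_iff i w).2 (by omega)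
    simp [this]
  · rfl

theorem wordF_other {i : Index m n} {b : Letter m n} (h1 : b ≠ lo m n i) (h2 : b ≠ hi m n i)
    (w : List (Letter m n)) : wordF m n i (b :: w) = (wordF m n i w).map (b :: ·) := by
  simp only [wordF, letterPhi, letterEps, letterF, coroot_letterWt_other h1 h2, if_neg h1,
    if_neg h2]
  split_ifs with hc
  · have := (wordF_eq_none_iff i w).2 (by omega)
    simp [this]
  · rfl

theorem wordE_eps {i : Index m n} {w w' : List (Letter m n)} (h : wordE m n i w = some w') :
    wordEps m n i w' + 1 = wordEps m n i w ∧ wordPhi m n i w' = wordPhi m n i w + 1 := by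
  induction w generalizing w' with
  | nil => simp [wordE] at h
  | cons b w ih =>
    rcases letter_cases i b with rfl | rfl | ⟨h1, h2⟩
    · rw [wordE_lo] at h
      split_ifs at h with hc
      obtain ⟨w', h', rfl⟩ := Option.map_eq_some_iff.1 h
      have := ih h'
      rcases type_cases i with ht | ht | ht
      · rw [wordEps_lo_even ht, wordPhi_lo_even ht, wordEps_lo_even ht, wordPhi_lo_even ht]; omega
      · omega
      · rw [wordEps_lo_odd ht, wordPhi_lo_odd ht, wordEps_lo_odd ht, wordPhi_lo_odd ht]; omega
    · rw [wordE_hi] at h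
      split_ifs at h with hc
      · simp only [Option.some.injEq] at h
        subst h
        rcases type_cases i with ht | ht | ht
        · rw [wordEps_lo_even ht, wordPhi_lo_even ht, wordEps_hi_even ht, wordPhi_hi_even ht]; omega
        · rw [wordEps_lo_zero ht, wordPhi_lo_zero ht, wordEps_hi_zero ht, wordPhi_hi_zero ht]
          omega
        · rw [wordEps_lo_odd ht, wordPhi_lo_odd ht, wordEps_hi_odd ht, wordPhi_hi_odd ht]; omega
      · obtain ⟨w', h', rfl⟩ := Option.map_eq_some_iff.1 h
        have := ih h'
        rcases type_cases i with ht | ht | ht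
        · rw [wordEps_hi_even ht, wordPhi_hi_even ht, wordEps_hi_even ht, wordPhi_hi_even ht]; omega
        · omega
        · rw [wordEps_hi_odd ht, wordPhi_hi_odd ht, wordEps_hi_odd ht, wordPhi_hi_odd ht]; omega
    · rw [wordE_other h1 h2] at h
      obtain ⟨w', h', rfl⟩ := Option.map_eq_some_iff.1 h
      have := ih h'
      rw [wordEps_other h1 h2, wordPhi_other h1 h2, wordEps_other h1 h2, wordPhi_other h1 h2]
      exact this

theorem wordE_wt {i : Index m n} {w w' : List (Letter m n)} (h : wordE m n i w = some w') :
    wordWt m n w' = wordWt m n w + root m n i := by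
  have key : letterWt m n (lo m n i) = letterWt m n (hi m n i) + root m n i := by
    simp [letterWt, root]
  induction w generalizing w' with
  | nil => simp [wordE] at h
  | cons b w ih =>
    have rec' : ∀ w', (wordE m n i w).map (b :: ·) = some w' →
        wordWt m n w' = wordWt m n (b :: w) + root m n i := by
      intro w' h
      obtain ⟨w', h', rfl⟩ := Option.map_eq_some_iff.1 h
      rw [wordWt_cons, wordWt_cons, ih h', add_assoc]
    rcases letter_cases i b with rfl | rfl | ⟨h1, h2⟩
    · rw [wordE_lo] at h
      split_ifs at h
      exact rec' w' h
    · rw [wordE_hi] at h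
      split_ifs at h
      · simp only [Option.some.injEq] at h
        subst h
        rw [wordWt_cons, wordWt_cons, key]
        abel
      · exact rec' w' h
    · rw [wordE_other h1 h2] at h
      exact rec' w' h

theorem wordE_length {i : Index m n} {w w' : List (Letter m n)} (h : wordE m n i w = some w') :
    w'.length = w.length := by
  induction w generalizing w' with
  | nil => simp [wordE] at h
  | cons b w ih =>
    have rec' : ∀ w', (wordE m n i w).map (b :: ·) = some w' → w'.length = (b :: w).length := by
      intro w' h
      obtain ⟨w', h', rfl⟩ := Option.map_eq_some_iff.1 h
      simp [ih h']
    rcases letter_cases i b with rfl | rfl | ⟨h1, h2⟩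
    · rw [wordE_lo] at h
      split_ifs at h
      exact rec' w' h
    · rw [wordE_hi] at h
      split_ifs at h
      · simp only [Option.some.injEq] at h
        subst h
        simp
      · exact rec' w' h
    · rw [wordE_other h1 h2] at h
      exact rec' w' h

theorem wordF_of_wordE {i : Index m n} {w w' : List (Letter m n)} (h : wordE m n i w' = some w) :
    wordF m n i w = some w' := by
  induction w' generalizing w with
  | nil => simp [wordE] at h
  | cons b w' ih =>
    rcases letter_cases i b with rfl | rfl | ⟨h1, h2⟩
    · rw [wordE_lo] at h
      split_ifs at h with hc
      obtain ⟨w, h', rfl⟩ := Option.map_eq_some_iff.1 h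
      have := wordE_eps h'
      rw [wordF_lo, if_neg (by omega), ih h']
      rfl
    · rw [wordE_hi] at h
      split_ifs at h with hc
      · simp only [Option.some.injEq] at h
        subst h
        rw [wordF_lo, if_pos hc]
      · obtain ⟨w, h', rfl⟩ := Option.map_eq_some_iff.1 h
        have := wordE_eps h'
        rw [wordF_hi, if_neg (by omega), ih h']
        rfl
    · rw [wordE_other h1 h2] at h
      obtain ⟨w, h', rfl⟩ := Option.map_eq_some_iff.1 h
      rw [wordF_other h1 h2, ih h']
      rfl

theorem wordF_phi {i : Index m n} {w w' : List (Letter m n)} (h : wordF m n i w = some w') :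
    wordEps m n i w' = wordEps m n i w + 1 ∧ wordPhi m n i w' + 1 = wordPhi m n i w := by
  induction w generalizing w' with
  | nil => simp [wordF] at h
  | cons b w ih =>
    rcases letter_cases i b with rfl | rfl | ⟨h1, h2⟩
    · rw [wordF_lo] at h
      split_ifs at h with hc
      · simp only [Option.some.injEq] at h
        subst h
        rcases type_cases i with ht | ht | ht
        · rw [wordEps_lo_even ht, wordPhi_lo_even ht, wordEps_hi_even ht, wordPhi_hi_even ht]; omega
        · rw [wordEps_lo_zero ht, wordPhi_lo_zero ht, wordEps_hi_zero ht, wordPhi_hi_zero ht]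
          omega
        · rw [wordEps_lo_odd ht, wordPhi_lo_odd ht, wordEps_hi_odd ht, wordPhi_hi_odd ht]; omega
      · obtain ⟨w', h', rfl⟩ := Option.map_eq_some_iff.1 h
        have := ih h'
        rcases type_cases i with ht | ht | ht
        · rw [wordEps_lo_even ht, wordPhi_lo_even ht, wordEps_lo_even ht, wordPhi_lo_even ht]; omega
        · omega
        · rw [wordEps_lo_odd ht, wordPhi_lo_odd ht, wordEps_lo_odd ht, wordPhi_lo_odd ht]; omega
    · rw [wordF_hi] at h
      split_ifs at h with hc
      obtain ⟨w', h', rfl⟩ := Option.map_eq_some_iff.1 h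
      have := ih h'
      rcases type_cases i with ht | ht | ht
      · rw [wordEps_hi_even ht, wordPhi_hi_even ht, wordEps_hi_even ht, wordPhi_hi_even ht]; omega
      · omega
      · rw [wordEps_hi_odd ht, wordPhi_hi_odd ht, wordEps_hi_odd ht, wordPhi_hi_odd ht]; omega
    · rw [wordF_other h1 h2] at h
      obtain ⟨w', h', rfl⟩ := Option.map_eq_some_iff.1 h
      have := ih h'
      rw [wordEps_other h1 h2, wordPhi_other h1 h2, wordEps_other h1 h2, wordPhi_other h1 h2]
      exact this

theorem wordE_of_wordF {i : Index m n} {w w' : List (Letter m n)} (h : wordF m n i w = some w') :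
    wordE m n i w' = some w := by
  induction w generalizing w' with
  | nil => simp [wordF] at h
  | cons b w ih =>
    rcases letter_cases i b with rfl | rfl | ⟨h1, h2⟩
    · rw [wordF_lo] at h
      split_ifs at h with hc
      · simp only [Option.some.injEq] at h
        subst h
        rw [wordE_hi, if_pos hc]
      · obtain ⟨w', h', rfl⟩ := Option.map_eq_some_iff.1 h
        have := wordF_phi h'
        rw [wordE_lo, if_neg (by omega), ih h']
        rfl
    · rw [wordF_hi] at h
      split_ifs at h with hc
      obtain ⟨w', h', rfl⟩ := Option.map_eq_some_iff.1 h
      have := wordF_phi h'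
      rw [wordE_hi, if_neg (by omega), ih h']
      rfl
    · rw [wordF_other h1 h2] at h
      obtain ⟨w', h', rfl⟩ := Option.map_eq_some_iff.1 h
      rw [wordE_other h1 h2, ih h']
      rfl

theorem wordF_iff_wordE {i : Index m n} {w w' : List (Letter m n)} :
    wordF m n i w = some w' ↔ wordE m n i w' = some w :=
  ⟨wordE_of_wordF, wordF_of_wordE⟩

theorem word_odd_string (i : Index m n) (h : i.val + 1 = m) (w : List (Letter m n)) :
    0 ≤ coroot m n i (wordWt m n w) ∧ wordPhi m n i w + wordEps m n i w =
      if coroot m n i (wordWt m n w) = 0 then 0 else 1 := by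
  induction w with
  | nil =>
    rw [coroot_eq]
    simp [wordPhi, wordEps, wordWt]
  | cons b w ih =>
    rw [wordWt_cons, coroot_add]
    rcases letter_cases i b with rfl | rfl | ⟨h1, h2⟩
    · rw [wordEps_lo_zero h, wordPhi_lo_zero h, coroot_letterWt_lo, if_neg (by omega)]
      omega
    · rw [wordEps_hi_zero h, wordPhi_hi_zero h, coroot_letterWt_hi, if_pos h, if_neg (by omega)]
      omega
    · rw [wordEps_other h1 h2, wordPhi_other h1 h2, coroot_letterWt_other h1 h2, zero_add]
      exact ih

theorem isCrystal_words (m n : ℕ) : IsCrystal (words m n) where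
  even_string i b h := word_string i h b
  odd_nonneg i b h := (word_odd_string i h b).1
  odd_string i b h := (word_odd_string i h b).2
  e_spec i b b' h := ⟨(wordE_eps h).1, (wordE_eps h).2, wordE_wt h⟩
  f_spec i b b' h := ⟨(wordF_phi h).1, (wordF_phi h).2, by
    have := wordE_wt (wordE_of_wordF h)
    exact eq_sub_of_add_eq this.symm⟩
  f_iff_e i b b' := wordF_iff_wordE

end SuperKnuth

namespace SuperKnuth

variable {m n : ℕ}

/-! ### The tensor product rule for concatenation -/

/-- The definitions peel off one letter at a time. This and its companions give the rule for two
arbitrary factors, which is the associativity needed to cut words anywhere. -/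
theorem word_append_even {i : Index m n} (h : i.val + 1 < m) (x y : List (Letter m n)) :
    wordEps m n i (x ++ y) = wordEps m n i x + (wordEps m n i y - wordPhi m n i x) ∧
      wordPhi m n i (x ++ y) = wordPhi m n i y + (wordPhi m n i x - wordEps m n i y) := by
  induction x with
  | nil => simp [wordEps, wordPhi]
  | cons b x ih =>
    rw [List.cons_append]
    rcases letter_cases i b with rfl | rfl | ⟨h1, h2⟩
    · simp only [wordEps_lo_even h, wordPhi_lo_even h]; omega
    · simp only [wordEps_hi_even h, wordPhi_hi_even h]; omega
    · simp only [wordEps_other h1 h2, wordPhi_other h1 h2]; exact ih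

theorem word_append_odd {i : Index m n} (h : m < i.val + 1) (x y : List (Letter m n)) :
    wordEps m n i (x ++ y) = wordEps m n i y + (wordEps m n i x - wordPhi m n i y) ∧
      wordPhi m n i (x ++ y) = wordPhi m n i x + (wordPhi m n i y - wordEps m n i x) := by
  induction x with
  | nil => simp [wordEps, wordPhi]
  | cons b x ih =>
    rw [List.cons_append]
    rcases letter_cases i b with rfl | rfl | ⟨h1, h2⟩
    · simp only [wordEps_lo_odd h, wordPhi_lo_odd h]; omega
    · simp only [wordEps_hi_odd h, wordPhi_hi_odd h]; omega
    · simp only [wordEps_other h1 h2, wordPhi_other h1 h2]; exact ih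

theorem word_append_zero {i : Index m n} (h : i.val + 1 = m) (x y : List (Letter m n)) :
    wordEps m n i (x ++ y) =
        (if 0 < wordEps m n i x + wordPhi m n i x then wordEps m n i x else wordEps m n i y) ∧
      wordPhi m n i (x ++ y) =
        (if 0 < wordEps m n i x + wordPhi m n i x then wordPhi m n i x else wordPhi m n i y) := by
  induction x with
  | nil => simp [wordEps, wordPhi]
  | cons b x ih =>
    rw [List.cons_append]
    rcases letter_cases i b with rfl | rfl | ⟨h1, h2⟩
    · simp [wordEps_lo_zero h, wordPhi_lo_zero h]
    · simp [wordEps_hi_zero h, wordPhi_hi_zero h]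
    · simp only [wordEps_other h1 h2, wordPhi_other h1 h2]; exact ih

theorem word_append_congr {i : Index m n} {x x' y y' : List (Letter m n)}
    (h1 : wordEps m n i x = wordEps m n i x') (h2 : wordPhi m n i x = wordPhi m n i x')
    (h3 : wordEps m n i y = wordEps m n i y') (h4 : wordPhi m n i y = wordPhi m n i y') :
    wordEps m n i (x ++ y) = wordEps m n i (x' ++ y') ∧
      wordPhi m n i (x ++ y) = wordPhi m n i (x' ++ y') := by
  rcases type_cases i with h | h | h
  · simp only [word_append_even h, h1, h2, h3, h4, and_self]
  · simp only [word_append_zero h, h1, h2, h3, h4, and_self]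
  · simp only [word_append_odd h, h1, h2, h3, h4, and_self]

open Classical in
theorem wordE_append (i : Index m n) (x y : List (Letter m n)) :
    wordE m n i (x ++ y) = if EActsLeft i x y then (wordE m n i x).map (· ++ y)
      else (wordE m n i y).map (x ++ ·) := by
  induction x with
  | nil =>
    rw [List.nil_append]
    split_ifs with h
    · have : wordE m n i y = none := by
        rw [wordE_eq_none_iff]
        simp only [EActsLeft, wordPhi, wordEps] at h
        omega
      simp [this, wordE]
    · simp
  | cons b x ih =>
    rw [List.cons_append]
    rcases letter_cases i b with rfl | rfl | ⟨h1, h2⟩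
    · rw [wordE_lo, wordE_lo, ih]
      rcases type_cases i with h | h | h
      · have e := word_append_even h x y
        have e1 : EActsLeft i x y ↔ wordEps m n i y ≤ wordPhi m n i x := by
          unfold EActsLeft; omega
        have e2 : EActsLeft i (lo m n i :: x) y ↔
            wordEps m n i y ≤ wordPhi m n i x + (1 - wordEps m n i x) := by
          unfold EActsLeft; rw [wordPhi_lo_even h]; omega
        have c1 : ((i.val + 1 < m ∧ wordEps m n i (x ++ y) ≤ 1) ∨ i.val + 1 = m) ↔
            wordEps m n i (x ++ y) ≤ 1 := by omega
        have c2 : ((i.val + 1 < m ∧ wordEps m n i x ≤ 1) ∨ i.val + 1 = m) ↔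
            wordEps m n i x ≤ 1 := by omega
        simp only [e1, e2, c1, c2]
        split_ifs <;> first | omega | simp [Function.comp_def]
      · have c : (i.val + 1 < m ∧ wordEps m n i (x ++ y) ≤ 1) ∨ i.val + 1 = m := Or.inr h
        have c' : (i.val + 1 < m ∧ wordEps m n i x ≤ 1) ∨ i.val + 1 = m := Or.inr h
        have e2 : EActsLeft i (lo m n i :: x) y := by
          unfold EActsLeft; rw [wordPhi_lo_zero h]; omega
        simp [c, c', e2]
      · have c : ¬ ((i.val + 1 < m ∧ wordEps m n i (x ++ y) ≤ 1) ∨ i.val + 1 = m) := by omega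
        have c' : ¬ ((i.val + 1 < m ∧ wordEps m n i x ≤ 1) ∨ i.val + 1 = m) := by omega
        have e2 : EActsLeft i (lo m n i :: x) y ↔ EActsLeft i x y := by
          unfold EActsLeft; rw [wordPhi_lo_odd h, wordEps_lo_odd h]; omega
        simp only [c, c', e2, if_false]
        split_ifs <;> simp [Function.comp_def]
    · rw [wordE_hi, wordE_hi, ih]
      rcases type_cases i with h | h | h
      · have e := word_append_even h x y
        have e1 : EActsLeft i x y ↔ wordEps m n i y ≤ wordPhi m n i x := by
          unfold EActsLeft; omega
        have e2 : EActsLeft i (hi m n i :: x) y ↔ wordEps m n i y ≤ wordPhi m n i x := by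
          unfold EActsLeft; rw [wordPhi_hi_even h]; omega
        have c1 : ((i.val + 1 < m ∧ wordEps m n i (x ++ y) = 0) ∨ i.val + 1 = m ∨
          (m < i.val + 1 ∧ wordPhi m n i (x ++ y) = 0)) ↔ wordEps m n i (x ++ y) = 0 := by omega
        have c2 : ((i.val + 1 < m ∧ wordEps m n i x = 0) ∨ i.val + 1 = m ∨
          (m < i.val + 1 ∧ wordPhi m n i x = 0)) ↔ wordEps m n i x = 0 := by omega
        simp only [e1, e2, c1, c2]
        split_ifs <;> first | omega | simp [Function.comp_def]
      · have c : (i.val + 1 < m ∧ wordEps m n i (x ++ y) = 0) ∨ i.val + 1 = m ∨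
          (m < i.val + 1 ∧ wordPhi m n i (x ++ y) = 0) := by omega
        have c' : (i.val + 1 < m ∧ wordEps m n i x = 0) ∨ i.val + 1 = m ∨
          (m < i.val + 1 ∧ wordPhi m n i x = 0) := by omega
        have e2 : EActsLeft i (hi m n i :: x) y := by
          unfold EActsLeft; rw [wordEps_hi_zero h]; omega
        rw [if_pos c, if_pos c', if_pos e2]
        rfl
      · have e := word_append_odd h x y
        have e1 : EActsLeft i x y ↔ wordPhi m n i y < wordEps m n i x := by
          unfold EActsLeft; omega
        have e2 : EActsLeft i (hi m n i :: x) y ↔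
            wordPhi m n i y < wordEps m n i x + (1 - wordPhi m n i x) := by
          unfold EActsLeft; rw [wordEps_hi_odd h]; omega
        have c1 : ((i.val + 1 < m ∧ wordEps m n i (x ++ y) = 0) ∨ i.val + 1 = m ∨
          (m < i.val + 1 ∧ wordPhi m n i (x ++ y) = 0)) ↔ wordPhi m n i (x ++ y) = 0 := by omega
        have c2 : ((i.val + 1 < m ∧ wordEps m n i x = 0) ∨ i.val + 1 = m ∨
          (m < i.val + 1 ∧ wordPhi m n i x = 0)) ↔ wordPhi m n i x = 0 := by omega
        simp only [e1, e2, c1, c2]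
        split_ifs <;> first | omega | simp [Function.comp_def]
    · have e2 : EActsLeft i (b :: x) y ↔ EActsLeft i x y := by
        unfold EActsLeft; rw [wordPhi_other h1 h2, wordEps_other h1 h2]
      rw [wordE_other h1 h2, wordE_other h1 h2, ih]
      simp only [e2]
      split_ifs <;> simp [Function.comp_def]

theorem wordE_append_iff {i : Index m n} {x y x' y' : List (Letter m n)}
    (hl : x'.length = x.length) :
    wordE m n i (x ++ y) = some (x' ++ y') ↔
      (EActsLeft i x y ∧ wordE m n i x = some x' ∧ y' = y) ∨
        (¬ EActsLeft i x y ∧ x' = x ∧ wordE m n i y = some y') := by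
  rw [wordE_append]
  split_ifs with h
  · simp only [Option.map_eq_some_iff, h, true_and, not_true, false_and, or_false]
    constructor
    · rintro ⟨a, ha, e⟩
      obtain ⟨rfl, rfl⟩ := List.append_inj e (by rw [wordE_length ha, hl])
      exact ⟨ha, rfl⟩
    · rintro ⟨ha, rfl⟩
      exact ⟨_, ha, rfl⟩
  · simp only [Option.map_eq_some_iff, h, false_and, not_false_iff, true_and, false_or]
    constructor
    · rintro ⟨a, ha, e⟩
      obtain ⟨rfl, rfl⟩ := List.append_inj e hl.symm
      exact ⟨rfl, ha⟩
    · rintro ⟨rfl, ha⟩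
      exact ⟨_, ha, rfl⟩

theorem EActsLeft_congr {i : Index m n} {x x' y y' : List (Letter m n)}
    (h1 : wordEps m n i x = wordEps m n i x') (h2 : wordPhi m n i x = wordPhi m n i x')
    (h3 : wordEps m n i y = wordEps m n i y') (h4 : wordPhi m n i y = wordPhi m n i y') :
    EActsLeft i x y ↔ EActsLeft i x' y' := by
  unfold EActsLeft
  rw [h1, h2, h3, h4]

/-- Replace the right factor by one with the same `ε_i`, `φ_i`. -/
theorem wordE_congr_right {i : Index m n} {x x' y y' z z' : List (Letter m n)}
    (h : wordE m n i (x ++ y) = some (x' ++ y')) (hl : x'.length = x.length)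
    (hε : wordEps m n i y = wordEps m n i z) (hφ : wordPhi m n i y = wordPhi m n i z)
    (h1 : y' = y → z' = z) (h2 : wordE m n i y = some y' → wordE m n i z = some z') :
    wordE m n i (x ++ z) = some (x' ++ z') := by
  rw [wordE_append_iff hl] at h ⊢
  rw [EActsLeft_congr rfl rfl hε hφ] at h
  rcases h with ⟨ha, hx, hy⟩ | ⟨ha, hx, hy⟩
  · exact Or.inl ⟨ha, hx, h1 hy⟩
  · exact Or.inr ⟨ha, hx, h2 hy⟩

/-- Replace the left factor by one with the same `ε_i`, `φ_i`. -/
theorem wordE_congr_left {i : Index m n} {x x' y y' z z' : List (Letter m n)}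
    (h : wordE m n i (x ++ y) = some (x' ++ y')) (hl : x'.length = x.length)
    (hlz : z'.length = z.length)
    (hε : wordEps m n i x = wordEps m n i z) (hφ : wordPhi m n i x = wordPhi m n i z)
    (h1 : x' = x → z' = z) (h2 : wordE m n i x = some x' → wordE m n i z = some z') :
    wordE m n i (z ++ y) = some (z' ++ y') := by
  rw [wordE_append_iff hl] at h
  rw [wordE_append_iff hlz]
  rw [EActsLeft_congr hε hφ rfl rfl] at h
  rcases h with ⟨ha, hx, hy⟩ | ⟨ha, hx, hy⟩
  · exact Or.inl ⟨ha, h2 hx, hy⟩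
  · exact Or.inr ⟨ha, h1 hx, hy⟩

/-! ### Knuth moves -/

theorem rowRel_iff_val {x y : Letter m n} :
    RowRel m n x y ↔ x.val < y.val ∨ (x.val = y.val ∧ x.val < m) := by
  unfold RowRel deg
  rw [Fin.lt_def, Fin.ext_iff]
  split_ifs with h <;> simp [h]

end SuperKnuth

namespace SuperKnuth

variable {m n : ℕ}

theorem wordE_nil (i : Index m n) : wordE m n i [] = none := rfl

theorem wordEps_nil (i : Index m n) : wordEps m n i [] = 0 := rfl

theorem wordPhi_nil (i : Index m n) : wordPhi m n i [] = 0 := rfl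

theorem letter_cases_val (i : Index m n) (b : Letter m n) :
    (b = lo m n i ∧ b.val = i.val) ∨ (b = hi m n i ∧ b.val = i.val + 1) ∨
      ((b ≠ lo m n i ∧ b ≠ hi m n i) ∧ b.val ≠ i.val ∧ b.val ≠ i.val + 1) := by
  simp only [lo, hi, ne_eq, Fin.ext_iff]
  omega

theorem wordEps_lo {i : Index m n} (w : List (Letter m n)) :
    wordEps m n i (lo m n i :: w) =
      if i.val + 1 < m then wordEps m n i w - 1 else if i.val + 1 = m then 0
      else wordEps m n i w := by
  split_ifs with h h'
  exacts [wordEps_lo_even h w, wordEps_lo_zero h' w, wordEps_lo_odd (by omega) w]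

theorem wordEps_hi {i : Index m n} (w : List (Letter m n)) :
    wordEps m n i (hi m n i :: w) =
      if i.val + 1 < m then wordEps m n i w + 1 else if i.val + 1 = m then 1
      else wordEps m n i w + (1 - wordPhi m n i w) := by
  split_ifs with h h'
  exacts [wordEps_hi_even h w, wordEps_hi_zero h' w, wordEps_hi_odd (by omega) w]

theorem wordPhi_lo {i : Index m n} (w : List (Letter m n)) :
    wordPhi m n i (lo m n i :: w) =
      if i.val + 1 < m then wordPhi m n i w + (1 - wordEps m n i w) else if i.val + 1 = m then 1
      else wordPhi m n i w + 1 := by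
  split_ifs with h h'
  exacts [wordPhi_lo_even h w, wordPhi_lo_zero h' w, wordPhi_lo_odd (by omega) w]

theorem wordPhi_hi {i : Index m n} (w : List (Letter m n)) :
    wordPhi m n i (hi m n i :: w) =
      if i.val + 1 < m then wordPhi m n i w else if i.val + 1 = m then 0
      else wordPhi m n i w - 1 := by
  split_ifs with h h'
  exacts [wordPhi_hi_even h w, wordPhi_hi_zero h' w, wordPhi_hi_odd (by omega) w]

theorem type_cases_eq (i : Index m n) :
    ((i.val + 1 < m ∧ (i.val + 1 < m) = True ∧ (i.val + 1 = m) = False ∧ (m < i.val + 1) = False) ∨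
      (i.val + 1 = m ∧ (i.val + 1 < m) = False ∧ (i.val + 1 = m) = True ∧ (m < i.val + 1) = False)) ∨
      (m < i.val + 1 ∧ (i.val + 1 < m) = False ∧ (i.val + 1 = m) = False ∧ (m < i.val + 1) = True) := by
  simp only [eq_iff_iff, iff_true, iff_false]
  omega

set_option linter.unusedSimpArgs false in
-- Two-letter words fall into rows and columns according to whether the second letter bumps the
-- first, and neither class is left by e_i. A finite check over the three types of index and the
-- positions of both letters relative to the arrow.
theorem wordE_pair {i : Index m n} {x y x' y' : Letter m n}
    (h : wordE m n i [x, y] = some [x', y']) : RowRel m n y' x' ↔ RowRel m n y x := by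
  have hlo : (lo m n i).val = i.val := rfl
  have hhi : (hi m n i).val = i.val + 1 := rfl
  simp only [rowRel_iff_val]
  rcases type_cases_eq i with (⟨ht, t1, t2, t3⟩ | ⟨ht, t1, t2, t3⟩) | ⟨ht, t1, t2, t3⟩
  all_goals
    rcases letter_cases_val i x with ⟨hx, vx⟩ | ⟨hx, vx⟩ | ⟨hx, vx⟩
    all_goals
      rcases letter_cases_val i y with ⟨hy, vy⟩ | ⟨hy, vy⟩ | ⟨hy, vy⟩
      all_goals
        simp only [wordE_lo, wordE_hi, wordE_nil, wordEps_nil, wordPhi_nil, t1, t2, t3,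
          wordEps_lo, wordEps_hi, wordPhi_lo, wordPhi_hi,
          wordE_other, wordEps_other, wordPhi_other, hx, hy, true_and, false_and,
          or_false, false_or, if_true, if_false, Option.map_some, Option.map_none, ne_eq,
          not_false_iff, reduceCtorEq, Nat.reduceAdd, Nat.reduceSub, Nat.reduceLeDiff,
          Nat.reduceEqDiff, OfNat.ofNat_ne_zero, OfNat.zero_ne_ofNat, one_ne_zero, and_self,
          or_self, Option.some.injEq, List.cons.injEq, and_true, Nat.zero_le, zero_add,
          zero_tsub, tsub_zero, tsub_self, le_refl] at h
        try (obtain ⟨rfl, rfl⟩ := h; omega)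

set_option linter.unusedSimpArgs false in
-- One of the two super Knuth relations. In an insertion it carries an expelled letter x to the
-- left, past an entry y that stays above z.
theorem word_swap_left (i : Index m n) {x y z : Letter m n} (h1 : ¬ RowRel m n z y) (h2 : RowRel m n z x) :
    wordEps m n i [y, x, z] = wordEps m n i [x, y, z] ∧ wordPhi m n i [y, x, z] = wordPhi m n i [x, y, z] := by
  simp only [rowRel_iff_val] at h1 h2
  rcases type_cases_eq i with (⟨ht, t1, t2, t3⟩ | ⟨ht, t1, t2, t3⟩) | ⟨ht, t1, t2, t3⟩
  all_goals
    rcases letter_cases_val i x with ⟨hx, vx⟩ | ⟨hx, vx⟩ | ⟨hx, vx⟩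
    all_goals
      rcases letter_cases_val i y with ⟨hy, vy⟩ | ⟨hy, vy⟩ | ⟨hy, vy⟩
      all_goals
        rcases letter_cases_val i z with ⟨hz, vz⟩ | ⟨hz, vz⟩ | ⟨hz, vz⟩
        all_goals
          simp only [wordE_lo, wordE_hi, wordE_nil, wordEps_nil, wordPhi_nil, t1, t2, t3,
            wordEps_lo, wordEps_hi, wordPhi_lo, wordPhi_hi,
            wordE_other, wordEps_other, wordPhi_other, hx, hy, hz, true_and, false_and,
            or_false, false_or, if_true, if_false, Option.map_some, Option.map_none, ne_eq,
            not_false_iff, reduceCtorEq, Nat.reduceAdd, Nat.reduceSub, Nat.reduceLeDiff,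
            Nat.reduceEqDiff, OfNat.ofNat_ne_zero, OfNat.zero_ne_ofNat, one_ne_zero, and_self,
            or_self, Option.some.injEq, List.cons.injEq, and_true, Nat.zero_le, zero_add,
            zero_tsub, tsub_zero, tsub_self, le_refl]
          try omega

set_option linter.unusedSimpArgs false in
-- The conditions are imposed on the primed letters as well, because e_i can turn an instance of one
-- Knuth relation into an instance of the other.
theorem wordE_swap_left {i : Index m n} {x y z x' y' z' : Letter m n} (h1 : ¬ RowRel m n z y) (h2 : RowRel m n z x)
    (h1' : ¬ RowRel m n z' y') (h2' : RowRel m n z' x')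
    (h : wordE m n i [y, x, z] = some [y', x', z']) : wordE m n i [x, y, z] = some [x', y', z'] := by
  have hlo : (lo m n i).val = i.val := rfl
  have hhi : (hi m n i).val = i.val + 1 := rfl
  simp only [rowRel_iff_val] at h1 h2 h1' h2'
  rcases type_cases_eq i with (⟨ht, t1, t2, t3⟩ | ⟨ht, t1, t2, t3⟩) | ⟨ht, t1, t2, t3⟩
  all_goals
    rcases letter_cases_val i x with ⟨hx, vx⟩ | ⟨hx, vx⟩ | ⟨hx, vx⟩
    all_goals
      rcases letter_cases_val i y with ⟨hy, vy⟩ | ⟨hy, vy⟩ | ⟨hy, vy⟩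
      all_goals
        rcases letter_cases_val i z with ⟨hz, vz⟩ | ⟨hz, vz⟩ | ⟨hz, vz⟩
        all_goals
          first
          | (exfalso; omega)
          | (simp only [wordE_lo, wordE_hi, wordE_nil, wordEps_nil, wordPhi_nil, t1, t2, t3,
              wordEps_lo, wordEps_hi, wordPhi_lo, wordPhi_hi,
              wordE_other, wordEps_other, wordPhi_other, hx, hy, hz, true_and, false_and,
              or_false, false_or, if_true, if_false, Option.map_some, Option.map_none, ne_eq,
              not_false_iff, reduceCtorEq, Nat.reduceAdd, Nat.reduceSub, Nat.reduceLeDiff,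
              Nat.reduceEqDiff, OfNat.ofNat_ne_zero, OfNat.zero_ne_ofNat, one_ne_zero, and_self,
              or_self, Option.some.injEq, List.cons.injEq, and_true, Nat.zero_le, zero_add,
              zero_tsub, tsub_zero, tsub_self, le_refl] at h ⊢ <;>
              (obtain ⟨rfl, rfl, rfl⟩ := h
               first
               | (simp only [hx, hy, hz, and_true, and_self]; done)
               | (exfalso; omega)))

set_option linter.unusedSimpArgs false in
-- The other super Knuth relation. In an insertion it lets the new letter x climb past z towards the
-- entry y that it bumps.
theorem word_swap_right (i : Index m n) {x y z : Letter m n} (h1 : ¬ RowRel m n z y) (h2 : RowRel m n x y) :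
    wordEps m n i [y, z, x] = wordEps m n i [y, x, z] ∧ wordPhi m n i [y, z, x] = wordPhi m n i [y, x, z] := by
  simp only [rowRel_iff_val] at h1 h2
  rcases type_cases_eq i with (⟨ht, t1, t2, t3⟩ | ⟨ht, t1, t2, t3⟩) | ⟨ht, t1, t2, t3⟩
  all_goals
    rcases letter_cases_val i x with ⟨hx, vx⟩ | ⟨hx, vx⟩ | ⟨hx, vx⟩
    all_goals
      rcases letter_cases_val i y with ⟨hy, vy⟩ | ⟨hy, vy⟩ | ⟨hy, vy⟩
      all_goals
        rcases letter_cases_val i z with ⟨hz, vz⟩ | ⟨hz, vz⟩ | ⟨hz, vz⟩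
        all_goals
          simp only [wordE_lo, wordE_hi, wordE_nil, wordEps_nil, wordPhi_nil, t1, t2, t3,
            wordEps_lo, wordEps_hi, wordPhi_lo, wordPhi_hi,
            wordE_other, wordEps_other, wordPhi_other, hx, hy, hz, true_and, false_and,
            or_false, false_or, if_true, if_false, Option.map_some, Option.map_none, ne_eq,
            not_false_iff, reduceCtorEq, Nat.reduceAdd, Nat.reduceSub, Nat.reduceLeDiff,
            Nat.reduceEqDiff, OfNat.ofNat_ne_zero, OfNat.zero_ne_ofNat, one_ne_zero, and_self,
            or_self, Option.some.injEq, List.cons.injEq, and_true, Nat.zero_le, zero_add,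
            zero_tsub, tsub_zero, tsub_self, le_refl]
          try omega

set_option linter.unusedSimpArgs false in
theorem wordE_swap_right {i : Index m n} {x y z x' y' z' : Letter m n} (h1 : ¬ RowRel m n z y) (h2 : RowRel m n x y)
    (h1' : ¬ RowRel m n z' y') (h2' : RowRel m n x' y')
    (h : wordE m n i [y, z, x] = some [y', z', x']) : wordE m n i [y, x, z] = some [y', x', z'] := by
  have hlo : (lo m n i).val = i.val := rfl
  have hhi : (hi m n i).val = i.val + 1 := rfl
  simp only [rowRel_iff_val] at h1 h2 h1' h2'
  rcases type_cases_eq i with (⟨ht, t1, t2, t3⟩ | ⟨ht, t1, t2, t3⟩) | ⟨ht, t1, t2, t3⟩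
  all_goals
    rcases letter_cases_val i x with ⟨hx, vx⟩ | ⟨hx, vx⟩ | ⟨hx, vx⟩
    all_goals
      rcases letter_cases_val i y with ⟨hy, vy⟩ | ⟨hy, vy⟩ | ⟨hy, vy⟩
      all_goals
        rcases letter_cases_val i z with ⟨hz, vz⟩ | ⟨hz, vz⟩ | ⟨hz, vz⟩
        all_goals
          first
          | (exfalso; omega)
          | (simp only [wordE_lo, wordE_hi, wordE_nil, wordEps_nil, wordPhi_nil, t1, t2, t3,
              wordEps_lo, wordEps_hi, wordPhi_lo, wordPhi_hi,
              wordE_other, wordEps_other, wordPhi_other, hx, hy, hz, true_and, false_and,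
              or_false, false_or, if_true, if_false, Option.map_some, Option.map_none, ne_eq,
              not_false_iff, reduceCtorEq, Nat.reduceAdd, Nat.reduceSub, Nat.reduceLeDiff,
              Nat.reduceEqDiff, OfNat.ofNat_ne_zero, OfNat.zero_ne_ofNat, one_ne_zero, and_self,
              or_self, Option.some.injEq, List.cons.injEq, and_true, Nat.zero_le, zero_add,
              zero_tsub, tsub_zero, tsub_self, le_refl] at h ⊢ <;>
              (obtain ⟨rfl, rfl, rfl⟩ := h
               first
               | (simp only [hx, hy, hz, and_true, and_self]; done)
               | (exfalso; omega)))

end SuperKnuth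

namespace SuperKnuth

variable {m n : ℕ}

/-! ### Chains are stable -/

theorem wordE_length_eq_cons {i : Index m n} {x : Letter m n} {t w' : List (Letter m n)}
    (h : wordE m n i (x :: t) = some w') : ∃ x' t', w' = x' :: t' ∧ t'.length = t.length := by
  have := wordE_length h
  match w', this with
  | x' :: t', h => exact ⟨x', t', rfl, by simpa using h⟩

theorem wordE_cons_iff {i : Index m n} {x x' : Letter m n} {t t' : List (Letter m n)} :
    wordE m n i (x :: t) = some (x' :: t') ↔
      (EActsLeft i [x] t ∧ wordE m n i [x] = some [x'] ∧ t' = t) ∨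
        (¬ EActsLeft i [x] t ∧ x' = x ∧ wordE m n i t = some t') := by
  have := wordE_append_iff (i := i) (x := [x]) (x' := [x']) (y := t) (y' := t') rfl
  simpa using this

/-- Two adjacent letters form a factor of the word, so they are either untouched or changed by e_i
acting on them as a two-letter word. -/
theorem wordE_isChain {S : Letter m n → Letter m n → Prop} {i : Index m n}
    (hS : ∀ {x y x' y'}, wordE m n i [x, y] = some [x', y'] → (S x' y' ↔ S x y))
    {w w' : List (Letter m n)} (h : wordE m n i w = some w') : w'.IsChain S ↔ w.IsChain S := by
  induction w generalizing w' with
  | nil => simp [wordE] at h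
  | cons x t ih =>
    obtain ⟨x', t', rfl, ht⟩ := wordE_length_eq_cons h
    match t, t', ht with
    | [], [], _ => simp
    | y :: t, y' :: t', ht =>
      have hl := ht
      simp only [List.length_cons, Nat.add_right_cancel_iff] at hl
      rw [List.isChain_cons_cons, List.isChain_cons_cons]
      refine and_congr ?_ ?_
      · have h' : wordE m n i ([x, y] ++ t) = some ([x', y'] ++ t') := h
        rw [wordE_append_iff (x := [x, y]) (x' := [x', y']) rfl] at h'
        rcases h' with ⟨-, h', -⟩ | ⟨-, h', -⟩
        · exact hS h'
        · simp only [List.cons.injEq, and_true] at h'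
          rw [h'.1, h'.2]
      · rcases wordE_cons_iff.1 h with ⟨-, -, h'⟩ | ⟨-, -, h'⟩
        · rw [h']
        · exact ih h'

theorem isCol_iff_isChain {c : List (Letter m n)} :
    IsCol (RowRel m n) c ↔ c.IsChain fun x y => ¬ RowRel m n y x := by
  have : IsTrans (Letter m n) fun x y => ¬ RowRel m n y x :=
    ⟨fun x y z h1 h2 h => (IsBumpRel.split y h).elim h2 h1⟩
  exact List.isChain_iff_pairwise.symm

theorem wordE_isCol {i : Index m n} {w w' : List (Letter m n)} (h : wordE m n i w = some w') :
    IsCol (RowRel m n) w' ↔ IsCol (RowRel m n) w := by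
  rw [isCol_iff_isChain, isCol_iff_isChain]
  exact wordE_isChain (fun h => not_congr (wordE_pair h)) h

theorem wordE_isRow {i : Index m n} {w w' : List (Letter m n)} (h : wordE m n i w = some w') :
    (w'.Pairwise fun x y => RowRel m n y x) ↔ w.Pairwise fun x y => RowRel m n y x := by
  have : IsTrans (Letter m n) fun x y => RowRel m n y x :=
    ⟨fun x y z h1 h2 => IsBumpRel.trans h2 h1⟩
  rw [← List.isChain_iff_pairwise, ← List.isChain_iff_pairwise]
  exact wordE_isChain (fun h => wordE_pair h) h

/-! ### Column insertion commutes with the crystal operators -/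

/-- The bumped letter followed by the new column, as a word. -/
def outWord (p : List (Letter m n) × Option (Letter m n)) : List (Letter m n) := p.2.toList ++ p.1

/-- If b bumps the head y, it bumps everything below y too, by `split`. It can therefore climb to
the second place through Knuth relations whose middle letter in size is the entry just above. -/
theorem word_bubble (i : Index m n) {y b : Letter m n} {c : List (Letter m n)}
    (hc : IsCol (RowRel m n) (y :: c)) (hb : RowRel m n b y) :
    wordEps m n i (y :: (c ++ [b])) = wordEps m n i (y :: b :: c) ∧
      wordPhi m n i (y :: (c ++ [b])) = wordPhi m n i (y :: b :: c) := by
  induction c generalizing y with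
  | nil => simp
  | cons z c ih =>
    have hzy : ¬ RowRel m n z y := List.rel_of_pairwise_cons hc (by simp)
    have hbz : RowRel m n b z := (IsBumpRel.split z hb).resolve_right hzy
    have h1 := ih hc.of_cons hbz
    have h2 : wordEps m n i ([y] ++ (z :: (c ++ [b]))) = wordEps m n i ([y] ++ (z :: b :: c)) ∧ _ :=
      word_append_congr rfl rfl h1.1 h1.2
    have h3 := word_swap_right i hzy hb
    have h4 : wordEps m n i ([y, z, b] ++ c) = wordEps m n i ([y, b, z] ++ c) ∧ _ :=
      word_append_congr h3.1 h3.2 rfl rfl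
    exact ⟨h2.1.trans h4.1, h2.2.trans h4.2⟩

theorem wordE_bubble {i : Index m n} {y b y' b' : Letter m n} {c c' : List (Letter m n)}
    (hl : c'.length = c.length)
    (hc : IsCol (RowRel m n) (y :: c)) (hb : RowRel m n b y)
    (hc' : IsCol (RowRel m n) (y' :: c')) (hb' : RowRel m n b' y')
    (h : wordE m n i (y :: (c ++ [b])) = some (y' :: (c' ++ [b']))) :
    wordE m n i (y :: b :: c) = some (y' :: b' :: c') := by
  induction c generalizing y y' c' with
  | nil =>
    obtain rfl := List.length_eq_zero_iff.1 hl
    exact h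
  | cons z c ih =>
    match c', hl with
    | z' :: c', hl =>
      have hzy : ¬ RowRel m n z y := List.rel_of_pairwise_cons hc (by simp)
      have hbz : RowRel m n b z := (IsBumpRel.split z hb).resolve_right hzy
      have hzy' : ¬ RowRel m n z' y' := List.rel_of_pairwise_cons hc' (by simp)
      have hbz' : RowRel m n b' z' := (IsBumpRel.split z' hb').resolve_right hzy'
      have hl' : c'.length = c.length := by simpa using hl
      have e1 := word_bubble i hc.of_cons hbz
      have h1 : wordE m n i ([y] ++ (z :: b :: c)) = some ([y'] ++ (z' :: b' :: c')) := by
        refine wordE_congr_right (y := z :: (c ++ [b])) (y' := z' :: (c' ++ [b'])) h rfl e1.1 e1.2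
          ?_ (ih hl' hc.of_cons hbz hc'.of_cons hbz')
        intro e
        obtain ⟨rfl, e'⟩ := List.cons_eq_cons.1 e
        obtain ⟨rfl, e''⟩ := List.append_inj e' hl'
        rw [(List.cons_eq_cons.1 e'').1]
      have e2 := word_swap_right i hzy hb
      refine wordE_congr_left (x := [y, z, b]) (x' := [y', z', b']) (z := [y, b, z])
        (z' := [y', b', z']) h1 rfl rfl e2.1 e2.2 ?_ (wordE_swap_right hzy hb hzy' hb')
      intro e
      simp only [List.cons.injEq, and_true] at e
      rw [e.1, e.2.1, e.2.2]

/-- Provides a hypothesis of the left Knuth relation. The new head is b, or an old head that b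
failed to bump; in the latter case `split` applies. -/
theorem colInsert_head_rel {R : Letter m n → Letter m n → Prop} [DecidableRel R] [IsBumpRel R]
    {b x z : Letter m n} {c d : List (Letter m n)} (hc : IsCol R c)
    (h : colInsert R b c = (z :: d, some x)) : R z x := by
  match c with
  | [] => simp [colInsert] at h
  | y :: c =>
    rw [colInsert] at h
    split_ifs at h with hb
    · simp only [Prod.mk.injEq, List.cons.injEq, Option.some.injEq] at h
      obtain ⟨⟨rfl, -⟩, rfl⟩ := h
      exact hb
    · simp only [Prod.mk.injEq, List.cons.injEq] at h
      obtain ⟨⟨rfl, -⟩, h⟩ := h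
      have hx : colInsert R b c = ((colInsert R b c).1, some x) := by rw [← h]
      exact (IsBumpRel.split y (rel_of_colInsert hx)).resolve_left hb

/-- The word of a column followed by a letter and the word of the result of the insertion have
the same `ε_i`, `φ_i`. -/
theorem word_colInsert (i : Index m n) (b : Letter m n) {c : List (Letter m n)}
    (hc : IsCol (RowRel m n) c) :
    wordEps m n i (c ++ [b]) = wordEps m n i (outWord (colInsert (RowRel m n) b c)) ∧
      wordPhi m n i (c ++ [b]) = wordPhi m n i (outWord (colInsert (RowRel m n) b c)) := by
  induction c with
  | nil => simp [colInsert, outWord]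
  | cons y c ih =>
    have h1 := ih hc.of_cons
    have hcol := IsCol.colInsert hc b
    rw [colInsert] at hcol ⊢
    split_ifs at hcol ⊢ with hb
    -- Here the head y itself is expelled: b climbs the whole column and stops just after y.
    · exact word_bubble i hc hb
    · rcases hins : colInsert (RowRel m n) b c with ⟨d, o⟩
      rw [hins] at h1 hcol
      have h2 : wordEps m n i ([y] ++ (c ++ [b])) = wordEps m n i ([y] ++ outWord (d, o)) ∧ _ :=
        word_append_congr rfl rfl h1.1 h1.2
      match o with
      | none => exact h2
      | some x =>
        match d with
        | [] => exact absurd (congrArg Prod.fst hins) (colInsert_ne_nil b c)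
        | z :: d =>
          have hzx := colInsert_head_rel hc.of_cons hins
          have hzy : ¬ RowRel m n z y := List.rel_of_pairwise_cons hcol (by simp)
          -- The letter x expelled from the rest of the column still has to pass the head y, which
          -- stays.
          have h3 := word_swap_left i hzy hzx
          have h4 : wordEps m n i ([y, x, z] ++ d) = wordEps m n i ([x, y, z] ++ d) ∧ _ :=
            word_append_congr h3.1 h3.2 rfl rfl
          exact ⟨h2.1.trans h4.1, h2.2.trans h4.2⟩

theorem wordE_singleton {i : Index m n} {x x' : Letter m n} :
    wordE m n i [x] = some [x'] ↔ x = hi m n i ∧ x' = lo m n i := by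
  have h0 := lo_ne_hi i
  rcases letter_cases i x with rfl | rfl | ⟨h1, h2⟩
  · simp [wordE_lo, wordE_nil, h0]
  · rw [wordE_hi, if_pos (by have := type_cases i; simp only [wordEps_nil, wordPhi_nil, and_true]; omega)]
    simp [eq_comm]
  · simp [wordE_other h1 h2, wordE_nil, h2]

/-- A word without `lo` and `hi` has `ε_i = φ_i = 0`. -/
theorem word_eq_zero_of_forall {i : Index m n} {c : List (Letter m n)}
    (h : ∀ x ∈ c, x ≠ lo m n i ∧ x ≠ hi m n i) : wordEps m n i c = 0 ∧ wordPhi m n i c = 0 := by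
  induction c with
  | nil => exact ⟨rfl, rfl⟩
  | cons x c ih =>
    have hx := h x (by simp)
    rw [wordEps_other hx.1 hx.2, wordPhi_other hx.1 hx.2]
    exact ih fun y hy => h y (by simp [hy])

theorem wordPhi_eq_zero_of_forall {i : Index m n} {c : List (Letter m n)}
    (h : ∀ x ∈ c, x ≠ lo m n i) : wordPhi m n i c = 0 := by
  induction c with
  | nil => rfl
  | cons x c ih =>
    have ih := ih fun y hy => h y (by simp [hy])
    rcases letter_cases i x with rfl | rfl | ⟨h1, h2⟩
    · exact absurd rfl (h _ (by simp))
    · rcases type_cases i with ht | ht | ht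
      · rw [wordPhi_hi_even ht, ih]
      · rw [wordPhi_hi_zero ht]
      · rw [wordPhi_hi_odd ht, ih]
    · rw [wordPhi_other h1 h2, ih]

theorem lo_val (i : Index m n) : (lo m n i).val = i.val := rfl

theorem hi_val (i : Index m n) : (hi m n i).val = i.val + 1 := rfl

/-- A column whose letters lie above `lo` and with `ε_i ≠ 0` begins with `hi`. -/
theorem exists_eq_hi_cons {i : Index m n} {c : List (Letter m n)} (hc : IsCol (RowRel m n) c)
    (hlo : ∀ z ∈ c, i.val < z.val) (hε : 0 < wordEps m n i c) : ∃ c₂, c = hi m n i :: c₂ := by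
  match c with
  | [] => simp [wordEps_nil] at hε
  | z :: c =>
    refine ⟨c, ?_⟩
    by_contra hz
    have hz' : z ≠ hi m n i := fun e => hz (by rw [e])
    have : wordEps m n i (z :: c) = 0 := by
      refine (word_eq_zero_of_forall fun x hx => ?_).1
      have h1 := hlo z (by simp)
      have h2 : z.val ≠ i.val + 1 := fun e => hz' (Fin.ext e)
      have h3 : z.val ≤ x.val := by
        rcases List.mem_cons.1 hx with rfl | hx
        · exact le_rfl
        · have := List.rel_of_pairwise_cons hc hx
          rw [rowRel_iff_val] at this
          omega
      constructor
      · rintro rfl; rw [lo_val] at h3; omega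
      · rintro rfl; rw [hi_val] at h3; omega
    omega

/-- First case in which e_i alters the route: b stops bumping the head. An unbarred letter does not
bump its equal, so this happens after 0, when the head drops to b = `lo`; the tensor product rule
then forces a second `hi` right below, which takes over the role of the head. -/
theorem wordE_colInsert_exit {i : Index m n} {y b y' b' : Letter m n} {c c' : List (Letter m n)}
    (hl : c'.length = c.length) (hc : IsCol (RowRel m n) (y :: c)) (hb : RowRel m n b y)
    (hb' : ¬ RowRel m n b' y')
    (h : wordE m n i (y :: (c ++ [b])) = some (y' :: (c' ++ [b']))) :
    m < i.val + 1 ∧ ∃ c₂, c = hi m n i :: c₂ ∧ c' = c ∧ y = hi m n i ∧ y' = lo m n i ∧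
      b = lo m n i ∧ b' = b ∧ wordPhi m n i c₂ = 0 := by
  have hz : ∀ z ∈ c, y.val ≤ z.val := fun z hz => by
    have := List.rel_of_pairwise_cons hc hz
    rw [rowRel_iff_val] at this
    omega
  rw [rowRel_iff_val] at hb hb'
  rcases wordE_cons_iff.1 h with ⟨ha, h1, h2⟩ | ⟨ha, rfl, h1⟩
  · rw [wordE_singleton] at h1
    obtain ⟨rfl, rfl⟩ := h1
    obtain ⟨rfl, e⟩ := List.append_inj h2 hl
    obtain rfl := (List.cons_eq_cons.1 e).1
    rw [hi_val] at hb hz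
    rw [lo_val] at hb'
    have hlo : ∀ z ∈ c', z ≠ lo m n i := by
      rintro _ hz' rfl
      have := hz _ hz'
      rw [lo_val] at this
      omega
    have hφ := wordPhi_eq_zero_of_forall hlo
    rcases type_cases i with ht | ht | ht
    · have hbh : b' = hi m n i := Fin.ext (by rw [hi_val]; omega)
      subst hbh
      have e1 := word_append_even ht c' [hi m n i]
      have e2 : wordEps m n i [hi m n i] = 1 := by rw [wordEps_hi_even ht]; rfl
      have e3 : wordPhi m n i [hi m n i] = 0 := by rw [wordPhi_hi_even ht]; rfl
      unfold EActsLeft at ha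
      omega
    · omega
    · have hbh : b' = lo m n i := Fin.ext (by rw [lo_val]; omega)
      subst hbh
      have e1 := word_append_odd ht c' [lo m n i]
      have e2 : wordEps m n i [hi m n i] = 1 := by rw [wordEps_hi_odd ht]; rfl
      have e3 : wordPhi m n i [lo m n i] = 1 := by rw [wordPhi_lo_odd ht]; rfl
      unfold EActsLeft at ha
      obtain ⟨c₂, rfl⟩ := exists_eq_hi_cons hc.of_cons (fun z hz' => by have := hz z hz'; omega)
        (by omega : 0 < wordEps m n i c')
      exact ⟨ht, c₂, rfl, rfl, rfl, rfl, rfl, rfl,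
        wordPhi_eq_zero_of_forall fun z hz' => hlo z (by simp [hz'])⟩
  · rw [wordE_append_iff hl] at h1
    rcases h1 with ⟨-, -, e⟩ | ⟨-, -, e⟩
    · obtain rfl := (List.cons_eq_cons.1 e).1
      exact absurd hb hb'
    · rw [wordE_singleton] at e
      obtain ⟨rfl, rfl⟩ := e
      rw [hi_val] at hb
      rw [lo_val] at hb'
      omega

/-- The opposite case: b starts bumping the head. A barred letter bumps its equal, so this happens
before 0, when b drops from `hi` to the head `lo`; the tensor product rule forces a `hi` right below
the head, which b bumped before. -/
theorem wordE_colInsert_enter {i : Index m n} {y b y' b' : Letter m n} {c c' : List (Letter m n)}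
    (hl : c'.length = c.length) (hc : IsCol (RowRel m n) (y :: c)) (hb : ¬ RowRel m n b y)
    (hb' : RowRel m n b' y')
    (h : wordE m n i (y :: (c ++ [b])) = some (y' :: (c' ++ [b']))) :
    i.val + 1 < m ∧ ∃ c₂, c = hi m n i :: c₂ ∧ c' = c ∧ y = lo m n i ∧ y' = lo m n i ∧
      b = hi m n i ∧ b' = lo m n i ∧ wordEps m n i c₂ = 0 := by
  have hz : ∀ z ∈ c, ¬ RowRel m n z y := fun z hz => List.rel_of_pairwise_cons hc hz
  simp only [rowRel_iff_val] at hb hb' hz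
  rcases wordE_cons_iff.1 h with ⟨ha, h1, h2⟩ | ⟨ha, rfl, h1⟩
  · rw [wordE_singleton] at h1
    obtain ⟨rfl, rfl⟩ := h1
    obtain ⟨rfl, e⟩ := List.append_inj h2 hl
    obtain rfl := (List.cons_eq_cons.1 e).1
    rw [hi_val] at hb
    rw [lo_val] at hb'
    omega
  · rw [wordE_append_iff hl] at h1
    rcases h1 with ⟨-, -, e⟩ | ⟨ha', rfl, e⟩
    · obtain rfl := (List.cons_eq_cons.1 e).1
      exact absurd hb' hb
    · rw [wordE_singleton] at e
      obtain ⟨rfl, rfl⟩ := e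
      rw [hi_val] at hb
      rw [lo_val] at hb'
      rcases type_cases i with ht | ht | ht
      · have hy : y' = lo m n i := Fin.ext (by rw [lo_val]; omega)
        subst hy
        have e1 := word_append_even ht c' [hi m n i]
        have e2 : wordEps m n i [hi m n i] = 1 := by rw [wordEps_hi_even ht]; rfl
        have e3 : wordPhi m n i [lo m n i] = 1 := by rw [wordPhi_lo_even ht]; rfl
        unfold EActsLeft at ha ha'
        obtain ⟨c₂, rfl⟩ := exists_eq_hi_cons hc.of_cons
          (fun z hz' => by have := hz z hz'; rw [lo_val] at this; omega)
          (by omega : 0 < wordEps m n i c')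
        refine ⟨ht, c₂, rfl, rfl, rfl, rfl, rfl, rfl, ?_⟩
        refine (word_eq_zero_of_forall fun x hx => ?_).1
        have := List.rel_of_pairwise_cons hc.of_cons hx
        rw [rowRel_iff_val, hi_val] at this
        constructor
        · rintro rfl; rw [lo_val] at this; omega
        · rintro rfl; rw [hi_val] at this; omega
      · have h3 : y' = lo m n i ∨ y' = hi m n i := by
          rw [Fin.ext_iff, Fin.ext_iff, lo_val, hi_val]
          omega
        exfalso
        refine ha (Or.inr (Or.inl ⟨ht, ?_⟩))
        rcases h3 with rfl | rfl
        · rw [wordPhi_lo_zero ht]; omega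
        · rw [wordEps_hi_zero ht]; omega
      · have hy : y' = hi m n i := Fin.ext (by rw [hi_val]; omega)
        subst hy
        have hlo : ∀ z ∈ c', z ≠ lo m n i := by
          rintro _ hz' rfl
          have := hz _ hz'
          rw [lo_val, hi_val] at this
          omega
        have hφ := wordPhi_eq_zero_of_forall hlo
        have e1 := word_append_odd ht c' [hi m n i]
        have e2 : wordEps m n i [hi m n i] = 1 := by rw [wordEps_hi_odd ht]; rfl
        have e3 : wordPhi m n i [hi m n i] = 0 := by rw [wordPhi_hi_odd ht]; rfl
        unfold EActsLeft at ha ha'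
        omega

theorem rowRel_lo_hi (i : Index m n) : RowRel m n (lo m n i) (hi m n i) := by
  rw [rowRel_iff_val, lo_val, hi_val]; omega

/-- Insertion into one column commutes with e_i. If b bumps the head both before and after,
`wordE_bubble` applies; if it does so neither before nor after, induction and a left Knuth relation
do. The two mixed cases are explicit columns. Equality of `isSome` says that the shape does not
change. -/
theorem wordE_colInsert {i : Index m n} {b b' : Letter m n} {c c' : List (Letter m n)}
    (hl : c'.length = c.length) (hc : IsCol (RowRel m n) c) (hc' : IsCol (RowRel m n) c')
    (h : wordE m n i (c ++ [b]) = some (c' ++ [b'])) :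
    (colInsert (RowRel m n) b' c').2.isSome = (colInsert (RowRel m n) b c).2.isSome ∧
      wordE m n i (outWord (colInsert (RowRel m n) b c)) =
        some (outWord (colInsert (RowRel m n) b' c')) := by
  induction c generalizing c' with
  | nil =>
    obtain rfl := List.length_eq_zero_iff.1 hl
    simpa [colInsert, outWord] using h
  | cons y c ih =>
    match c', hl with
    | y' :: c', hl =>
    have hl' : c'.length = c.length := by simpa using hl
    by_cases hb : RowRel m n b y <;> by_cases hb' : RowRel m n b' y'
    · simp only [colInsert, if_pos hb, if_pos hb', outWord, Option.isSome_some, true_and]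
      exact wordE_bubble hl' hc hb hc' hb' h
    · obtain ⟨ht, c₂, rfl, rfl, rfl, rfl, rfl, rfl, hφ⟩ := wordE_colInsert_exit hl' hc hb hb' h
      have h1 := rowRel_lo_hi i
      simp only [colInsert, if_pos h1, if_neg hb', outWord, Option.isSome_some, true_and,
        Option.toList_some, List.singleton_append]
      have t1 : ¬ (i.val + 1 < m) := by omega
      have t2 : ¬ (i.val + 1 = m) := by omega
      rw [wordE_hi, if_neg, wordE_lo, if_neg, wordE_hi, if_pos]
      · rfl
      · exact Or.inr (Or.inr ⟨ht, hφ⟩)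
      · simp [t1, t2]
      · rw [wordPhi_lo_odd ht]
        omega
    · obtain ⟨ht, c₂, rfl, rfl, rfl, rfl, rfl, rfl, hφ⟩ := wordE_colInsert_enter hl' hc hb hb' h
      have h1 : RowRel m n (hi m n i) (hi m n i) := by
        rw [rowRel_iff_val, hi_val]; omega
      simp only [colInsert, if_pos h1, if_pos hb', if_neg hb, outWord, Option.isSome_some,
        true_and, Option.toList_some, List.singleton_append]
      rw [wordE_hi, if_pos]
      left
      rw [wordEps_lo_even ht, wordEps_hi_even ht]
      omega
    · have e1 := word_colInsert i b hc.of_cons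
      have hcol := IsCol.colInsert hc b
      have hcol' := IsCol.colInsert hc' b'
      simp only [colInsert, if_neg hb, if_neg hb'] at hcol hcol' ⊢
      have key : (colInsert (RowRel m n) b' c').2.isSome = (colInsert (RowRel m n) b c).2.isSome ∧
          wordE m n i ([y] ++ outWord (colInsert (RowRel m n) b c)) =
            some ([y'] ++ outWord (colInsert (RowRel m n) b' c')) := by
        have e2 : c' ++ [b'] = c ++ [b] → c' = c ∧ b' = b := fun e => by
          obtain ⟨rfl, e'⟩ := List.append_inj e hl'
          exact ⟨rfl, (List.cons_eq_cons.1 e').1⟩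
        constructor
        · rcases wordE_cons_iff.1 h with ⟨-, -, e⟩ | ⟨-, -, e⟩
          · rw [(e2 e).1, (e2 e).2]
          · exact (ih hl' hc.of_cons hc'.of_cons e).1
        · refine wordE_congr_right (y := c ++ [b]) (y' := c' ++ [b']) h rfl e1.1 e1.2 ?_
            fun e => (ih hl' hc.of_cons hc'.of_cons e).2
          intro e
          rw [(e2 e).1, (e2 e).2]
      obtain ⟨hs, key⟩ := key
      refine ⟨hs, ?_⟩
      rcases hins : colInsert (RowRel m n) b c with ⟨d, o⟩
      rcases hins' : colInsert (RowRel m n) b' c' with ⟨d', o'⟩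
      rw [hins] at hs key hcol
      rw [hins'] at hs key hcol'
      match o, o', hs with
      | none, none, _ => exact key
      | some x, some x', _ =>
        match d, d' with
        | [], _ => exact absurd (congrArg Prod.fst hins) (colInsert_ne_nil b c)
        | z :: d, [] => exact absurd (congrArg Prod.fst hins') (colInsert_ne_nil b' c')
        | z :: d, z' :: d' =>
          have hzx := colInsert_head_rel hc.of_cons hins
          have hzy : ¬ RowRel m n z y := List.rel_of_pairwise_cons hcol (by simp)
          have hzx' := colInsert_head_rel hc'.of_cons hins'
          have hzy' : ¬ RowRel m n z' y' := List.rel_of_pairwise_cons hcol' (by simp)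
          have e3 := word_swap_left i hzy hzx
          refine wordE_congr_left (x := [y, x, z]) (x' := [y', x', z']) (z := [x, y, z])
            (z' := [x', y', z']) key rfl rfl e3.1 e3.2 ?_ (wordE_swap_left hzy hzx hzy' hzx')
          intro e
          simp only [List.cons.injEq, and_true] at e
          rw [e.1, e.2.1, e.2.2]

end SuperKnuth

namespace SuperKnuth

variable {m n : ℕ}

/-! ### Bumping commutes with the crystal operators -/

/-- The column reading of a list of columns. -/
def tabWord (T : List (List (Letter m n))) : List (Letter m n) := T.reverse.flatten

theorem tabWord_cons (c : List (Letter m n)) (T : List (List (Letter m n))) :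
    tabWord (c :: T) = tabWord T ++ c := by
  simp [tabWord]

theorem length_tabWord_eq {T T' : List (List (Letter m n))}
    (h : T'.map List.length = T.map List.length) : (tabWord T').length = (tabWord T).length := by
  simp only [tabWord, List.length_flatten, List.map_reverse, h]

theorem tabWord_injective {T T' : List (List (Letter m n))}
    (h : T'.map List.length = T.map List.length) (hw : tabWord T' = tabWord T) : T' = T := by
  induction T generalizing T' with
  | nil => simpa using h
  | cons c T ih =>
    match T' with
    | [] => simp at h
    | c' :: T' =>
      simp only [List.map_cons, List.cons.injEq] at h
      rw [tabWord_cons, tabWord_cons] at hw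
      obtain ⟨h1, h2⟩ := List.append_inj hw (length_tabWord_eq h.2)
      rw [ih h.2 h1, h2]

theorem word_colBump (i : Index m n) (b : Letter m n) {T : List (List (Letter m n))}
    (hT : ∀ c ∈ T, IsCol (RowRel m n) c) :
    wordEps m n i (tabWord T ++ [b]) = wordEps m n i (tabWord (colBump (RowRel m n) T b)) ∧
      wordPhi m n i (tabWord T ++ [b]) = wordPhi m n i (tabWord (colBump (RowRel m n) T b)) := by
  induction T generalizing b with
  | nil => simp [colBump, tabWord]
  | cons c T ih =>
    have e1 := word_colInsert i b (hT c (by simp))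
    have e2 := word_append_congr (i := i) (x := tabWord T) rfl rfl e1.1 e1.2
    rw [tabWord_cons, List.append_assoc]
    rcases hins : colInsert (RowRel m n) b c with ⟨d, o⟩
    rw [hins] at e2
    match o with
    | none =>
      rw [colBump_cons_none hins, tabWord_cons]
      exact e2
    | some x =>
      rw [colBump_cons_some hins, tabWord_cons]
      have e3 := ih x fun c hc => hT c (by simp [hc])
      have e4 := word_append_congr (i := i) (y := d) e3.1 e3.2 rfl rfl
      simp only [outWord, Option.toList_some, ← List.append_assoc] at e2
      rw [List.append_assoc] at e2
      exact ⟨e2.1.trans e4.1, e2.2.trans e4.2⟩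

/-- Columns are read from right to left, so the first column is the last factor, next to the
inserted letter, and the expelled letter comes out directly after the word of the remaining columns,
ready for the induction. The tensor product rule lets one factor be replaced at a time. -/
theorem wordE_colBump {i : Index m n} {b b' : Letter m n} {T T' : List (List (Letter m n))}
    (hl : T'.map List.length = T.map List.length) (hT : ∀ c ∈ T, IsCol (RowRel m n) c)
    (hT' : ∀ c ∈ T', IsCol (RowRel m n) c)
    (h : wordE m n i (tabWord T ++ [b]) = some (tabWord T' ++ [b'])) :
    (colBump (RowRel m n) T' b').map List.length = (colBump (RowRel m n) T b).map List.length ∧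
      wordE m n i (tabWord (colBump (RowRel m n) T b)) =
        some (tabWord (colBump (RowRel m n) T' b')) := by
  induction T generalizing T' b b' with
  | nil =>
    obtain rfl : T' = [] := by simpa using hl
    simpa [colBump, tabWord] using h
  | cons c T ih =>
    match T' with
    | [] => simp at hl
    | c' :: T' =>
    simp only [List.map_cons, List.cons.injEq] at hl
    obtain ⟨hlc, hl⟩ := hl
    have hc := hT c (by simp)
    have hc' := hT' c' (by simp)
    have hT1 : ∀ c ∈ T, IsCol (RowRel m n) c := fun c hc => hT c (by simp [hc])
    have hT1' : ∀ c ∈ T', IsCol (RowRel m n) c := fun c hc => hT' c (by simp [hc])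
    have hlw := length_tabWord_eq hl
    rw [tabWord_cons, tabWord_cons, List.append_assoc, List.append_assoc] at h
    have e1 := word_colInsert i b hc
    have e2 : c' ++ [b'] = c ++ [b] → c' = c ∧ b' = b := fun e => by
      obtain ⟨rfl, e'⟩ := List.append_inj e hlc
      exact ⟨rfl, (List.cons_eq_cons.1 e').1⟩
    have hs : (colInsert (RowRel m n) b' c').2.isSome = (colInsert (RowRel m n) b c).2.isSome := by
      rcases (wordE_append_iff hlw).1 h with ⟨-, -, e⟩ | ⟨-, -, e⟩
      · rw [(e2 e).1, (e2 e).2]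
      · exact (wordE_colInsert hlc hc hc' e).1
    have key : wordE m n i (tabWord T ++ outWord (colInsert (RowRel m n) b c)) =
        some (tabWord T' ++ outWord (colInsert (RowRel m n) b' c')) := by
      refine wordE_congr_right h hlw e1.1 e1.2 ?_ fun e => (wordE_colInsert hlc hc hc' e).2
      intro e
      rw [(e2 e).1, (e2 e).2]
    rcases hins : colInsert (RowRel m n) b c with ⟨d, o⟩
    rcases hins' : colInsert (RowRel m n) b' c' with ⟨d', o'⟩
    rw [hins, hins'] at hs key
    match o, o', hs with
    | none, none, _ =>
      rw [colBump_cons_none hins, colBump_cons_none hins', tabWord_cons, tabWord_cons]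
      refine ⟨?_, key⟩
      rw [(colInsert_none_eq hins).1, (colInsert_none_eq hins').1]
      simp [hl, hlc]
    | some x, some x', _ =>
      rw [colBump_cons_some hins, colBump_cons_some hins', tabWord_cons, tabWord_cons]
      simp only [outWord, Option.toList_some] at key
      rw [← List.append_assoc, ← List.append_assoc] at key
      have hx : tabWord T' ++ [x'] = tabWord T ++ [x] → T' = T ∧ x' = x := fun e => by
        obtain ⟨e3, e4⟩ := List.append_inj e hlw
        exact ⟨tabWord_injective hl e3, (List.cons_eq_cons.1 e4).1⟩
      have e3 := word_colBump i x hT1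
      have hlen : (colBump (RowRel m n) T' x').map List.length =
          (colBump (RowRel m n) T x).map List.length := by
        rcases (wordE_append_iff (by simp [hlw])).1 key with ⟨-, e, -⟩ | ⟨-, e, -⟩
        · exact (ih hl hT1 hT1' e).1
        · rw [(hx e).1, (hx e).2]
      refine ⟨?_, ?_⟩
      · rw [List.map_cons, List.map_cons, colInsert_length_some hins, colInsert_length_some hins',
          hlc, hlen]
      · refine wordE_congr_left key (by simp [hlw]) (length_tabWord_eq hlen) e3.1 e3.2 ?_
          fun e => (ih hl hT1 hT1' e).2
        intro e
        rw [(hx e).1, (hx e).2]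

theorem word_P (i : Index m n) (w : List (Letter m n)) :
    wordEps m n i (tabWord (P m n w)) = wordEps m n i w ∧
      wordPhi m n i (tabWord (P m n w)) = wordPhi m n i w := by
  induction w using List.reverseRecOn with
  | nil => exact ⟨rfl, rfl⟩
  | append_singleton w b ih =>
    have e1 := word_colBump i b (isTab_P w).col
    have e2 := word_append_congr (i := i) (y := [b]) ih.1 ih.2 rfl rfl
    have e3 : P m n (w ++ [b]) = colBump (RowRel m n) (P m n w) b := by
      rw [P_eq, P_eq, colP_append_singleton]
    rw [e3]
    exact ⟨e1.1.symm.trans e2.1, e1.2.symm.trans e2.2⟩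

/-- By the tensor product rule e_i acts on the last letter or on the word before it. That word may
be replaced by the word of its tableau, and what remains is a single bumping. -/
theorem wordE_P {i : Index m n} {w w' : List (Letter m n)} (h : wordE m n i w = some w') :
    (P m n w').map List.length = (P m n w).map List.length ∧
      wordE m n i (tabWord (P m n w)) = some (tabWord (P m n w')) := by
  induction w using List.reverseRecOn generalizing w' with
  | nil => simp [wordE_nil] at h
  | append_singleton w b ih =>
    have hl := wordE_length h
    rcases List.eq_nil_or_concat w' with rfl | ⟨w', b', rfl⟩
    · simp at hl
    simp only [List.concat_eq_append] at h hl ⊢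
    have hl' : w'.length = w.length := by simpa using hl
    have e3 : ∀ w b, P m n (w ++ [b]) = colBump (RowRel m n) (P m n w) b := fun w b => by
      rw [P_eq, P_eq, colP_append_singleton]
    rw [e3, e3]
    have hlen : (P m n w').map List.length = (P m n w).map List.length := by
      rcases (wordE_append_iff hl').1 h with ⟨-, e, -⟩ | ⟨-, e, -⟩
      · exact (ih e).1
      · rw [e]
    refine wordE_colBump hlen (isTab_P w).col (isTab_P w').col ?_
    refine wordE_congr_left h hl' (length_tabWord_eq hlen) (word_P i w).1.symm (word_P i w).2.symm
      ?_ fun e => (ih e).2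
    rintro rfl
    rfl

/-! ### The tableau of the reading word of a tableau -/

section Generic

variable {α : Type*} {R : α → α → Prop} [DecidableRel R]

/-- Invariant of inserting a column beside which the old one may stand: X is the part already
inserted, and the rest Y of the old column is expelled row by row. -/
theorem passCol_append_column {X Y Z : List α} (h : IsCol R (X ++ Z)) (hr : RowLe R Z Y) :
    passCol R (X ++ Y) Z = (X ++ Z, Y) := by
  induction Z generalizing X Y with
  | nil =>
    cases Y with
    | nil => simp [passCol]
    | cons y Y => exact hr.elim
  | cons z Z ih =>
    have hX : ∀ x ∈ X, ¬ R z x := fun x hx => (List.pairwise_append.1 h).2.2 x hx z (by simp)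
    have h' : IsCol R ((X ++ [z]) ++ Z) := by simpa using h
    cases Y with
    | nil =>
      rw [List.append_nil, passCol_cons_none (colInsert_eq_none_of_forall R z X hX)]
      have := ih (Y := []) h' (by cases Z <;> trivial)
      simpa using this
    | cons y Y =>
      rw [passCol_cons_some (colInsert_eq_some R z y X Y hX hr.1)]
      have := ih h' hr.2
      simp only [List.append_assoc, List.singleton_append] at this
      rw [this]

/-- Inserting c pushes every column of T one place to the right. -/
theorem foldl_colBump_column {c : List α} {T : List (List α)} (h : IsTab R (c :: T)) :
    c.foldl (colBump R) T = c :: T := by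
  induction T generalizing c with
  | nil =>
    have hc := isTab_cons_iff.1 h
    have h1 : c.foldl (colBump R) [] = colP R c := rfl
    have h2 := passCol_append_column (X := []) (Y := []) (Z := c) (by simpa using hc.2.1)
      (by cases c <;> trivial)
    simp only [List.nil_append] at h2
    rw [h1, colP_eq_of_ne_nil hc.1, h2]
    rfl
  | cons t T ih =>
    have hc := isTab_cons_iff.1 h
    have h2 := passCol_append_column (X := []) (Y := t) (Z := c) (by simpa using hc.2.1)
      (hc.2.2.1 t rfl)
    simp only [List.nil_append] at h2
    rw [foldl_colBump_cons, h2, ih hc.2.2.2]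

end Generic

theorem P_tabWord {T : List (List (Letter m n))} (h : IsTab (RowRel m n) T) :
    P m n (tabWord T) = T := by
  induction T with
  | nil => rfl
  | cons c T ih =>
    rw [tabWord_cons, P_append, ih h.tail, foldl_colBump_column h]

theorem map_length_eq_iff {T T' : List (List (Letter m n))} (h : IsTab (RowRel m n) T)
    (h' : IsTab (RowRel m n) T') :
    T'.map List.length = T.map List.length ↔ colLens T' = colLens T := by
  constructor
  · intro e
    funext j
    have : ∀ T : List (List (Letter m n)), colLens T j = (T.map List.length).getD j 0 := fun T => by
      simp only [colLens, List.getD_eq_getElem?_getD, List.getElem?_map]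
      cases T[j]? <;> rfl
    rw [this, this, e]
  · intro e
    induction T generalizing T' with
    | nil =>
      cases T' with
      | nil => rfl
      | cons c T' =>
        have := congrFun e 0
        rw [colLens_cons_zero] at this
        exact absurd (List.length_eq_zero_iff.1 (this.trans (by simp [colLens])))
          (h'.ne_nil c (by simp))
    | cons c T ih =>
      cases T' with
      | nil =>
        have := congrFun e 0
        rw [colLens_cons_zero] at this
        exact absurd (List.length_eq_zero_iff.1 (this.symm.trans (by simp [colLens])))
          (h.ne_nil c (by simp))
      | cons c' T' =>
        have h0 := congrFun e 0
        rw [colLens_cons_zero, colLens_cons_zero] at h0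
        rw [List.map_cons, List.map_cons, h0, ih h.tail h'.tail]
        funext j
        have := congrFun e (j + 1)
        rwa [colLens_cons_succ, colLens_cons_succ] at this

theorem wordE_P_colLens {i : Index m n} {w w' : List (Letter m n)} (h : wordE m n i w = some w') :
    colLens (P m n w') = colLens (P m n w) :=
  (map_length_eq_iff (isTab_P w) (isTab_P w')).1 (wordE_P h).1

/-- The reading words of tableaux of a given shape are stable. -/
theorem wordE_tabWord {i : Index m n} {T : List (List (Letter m n))} (hT : IsTab (RowRel m n) T)
    {w : List (Letter m n)} (h : wordE m n i (tabWord T) = some w) :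
    IsTab (RowRel m n) (P m n w) ∧ colLens (P m n w) = colLens T ∧ w = tabWord (P m n w) := by
  have h1 := wordE_P h
  have h2 := wordE_P_colLens h
  rw [P_tabWord hT, h] at h1
  rw [P_tabWord hT] at h2
  exact ⟨isTab_P w, h2, Option.some.inj h1.2⟩

theorem wordF_P {i : Index m n} {w w' : List (Letter m n)} (h : wordF m n i w = some w') :
    colLens (P m n w') = colLens (P m n w) ∧
      wordF m n i (tabWord (P m n w)) = some (tabWord (P m n w')) := by
  rw [wordF_iff_wordE] at h ⊢
  exact ⟨(wordE_P_colLens h).symm, (wordE_P h).2⟩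

theorem wordF_tabWord {i : Index m n} {T : List (List (Letter m n))} (hT : IsTab (RowRel m n) T)
    {w : List (Letter m n)} (h : wordF m n i (tabWord T) = some w) :
    IsTab (RowRel m n) (P m n w) ∧ colLens (P m n w) = colLens T ∧ w = tabWord (P m n w) := by
  have h1 := wordF_P h
  rw [P_tabWord hT, h] at h1
  exact ⟨isTab_P w, h1.1, Option.some.inj h1.2⟩

theorem isStableEmbedding_tableau (μ : YoungDiagram) :
    IsStableEmbedding (words m n) (Tableau.word (m := m) (n := n) (μ := μ)) where
  injective T T' h := by
    have h1 := isTableau_iff.1 T.isTableau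
    have h2 := isTableau_iff.1 T'.isTableau
    refine Tableau.ext ?_
    have : P m n (tabWord T.columns) = P m n (tabWord T'.columns) := congrArg (P m n) h
    rwa [P_tabWord h1.1, P_tabWord h2.1] at this
  e_mem i T w h := by
    have h1 := isTableau_iff.1 T.isTableau
    have h2 := wordE_tabWord h1.1 (show wordE m n i (tabWord T.columns) = some w from h)
    exact ⟨⟨P m n w, isTableau_iff.2 ⟨h2.1, h2.2.1.trans h1.2⟩⟩, h2.2.2.symm⟩
  f_mem i T w h := by
    have h1 := isTableau_iff.1 T.isTableau
    have h2 := wordF_tabWord h1.1 (show wordF m n i (tabWord T.columns) = some w from h)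
    exact ⟨⟨P m n w, isTableau_iff.2 ⟨h2.1, h2.2.1.trans h1.2⟩⟩, h2.2.2.symm⟩

end SuperKnuth

namespace SuperKnuth

variable {m n u v : ℕ}

/-! ### The matrices are stable -/

theorem exists_flatMap_eq {ι β : Type*} [DecidableEq ι] {l : List ι} (hl : l.Nodup)
    (g : ι → List β) {w : List β} (hw : w.length = (l.flatMap g).length) :
    ∃ g' : ι → List β, w = l.flatMap g' ∧ ∀ j ∈ l, (g' j).length = (g j).length := by
  induction l generalizing w with
  | nil => exact ⟨g, by simpa using hw, by simp⟩
  | cons j l ih =>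
    rw [List.nodup_cons] at hl
    rw [List.flatMap_cons, List.length_append] at hw
    obtain ⟨g', h1, h2⟩ := ih hl.2 (w := w.drop (g j).length) (by rw [List.length_drop]; omega)
    refine ⟨Function.update g' j (w.take (g j).length), ?_, ?_⟩
    · rw [List.flatMap_cons, Function.update_self]
      have : l.flatMap (Function.update g' j (w.take (g j).length)) = l.flatMap g' :=
        List.flatMap_congr fun k hk => Function.update_of_ne (by rintro rfl; exact hl.1 hk) _ _
      rw [this, ← h1, List.take_append_drop]
    · intro k hk
      by_cases e : k = j
      · subst e
        rw [Function.update_self, List.length_take]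
        omega
      · rw [Function.update_of_ne e]
        exact h2 k ((List.mem_cons.1 hk).resolve_left e)

theorem length_flatMap_congr {ι β γ : Type*} {l : List ι} {g : ι → List β} {g' : ι → List γ}
    (h : ∀ j ∈ l, (g' j).length = (g j).length) :
    (l.flatMap g').length = (l.flatMap g).length := by
  rw [List.length_flatMap, List.length_flatMap]
  congr 1
  exact List.map_congr_left h

theorem flatMap_inj {ι β : Type*} {l : List ι} {g g' : ι → List β}
    (hl : ∀ j ∈ l, (g' j).length = (g j).length) (h : l.flatMap g' = l.flatMap g) :
    ∀ j ∈ l, g' j = g j := by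
  induction l with
  | nil => simp
  | cons k l ih =>
    rw [List.flatMap_cons, List.flatMap_cons] at h
    obtain ⟨h1, h2⟩ := List.append_inj h (hl k (by simp))
    intro j hj
    rcases List.mem_cons.1 hj with rfl | hj
    · exact h1
    · exact ih (fun j hj => hl j (by simp [hj])) h2 j hj

theorem wordE_flatMap {ι : Type*} {i : Index m n} {l : List ι} {g g' : ι → List (Letter m n)}
    (hl : ∀ j ∈ l, (g' j).length = (g j).length)
    (h : wordE m n i (l.flatMap g) = some (l.flatMap g')) :
    ∀ j ∈ l, g' j = g j ∨ wordE m n i (g j) = some (g' j) := by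
  induction l with
  | nil => simp
  | cons k l ih =>
    rw [List.flatMap_cons, List.flatMap_cons, wordE_append_iff (hl k (by simp))] at h
    have hl' : ∀ j ∈ l, (g' j).length = (g j).length := fun j hj => hl j (by simp [hj])
    intro j hj
    rcases h with ⟨-, h1, h2⟩ | ⟨-, h1, h2⟩
    · rcases List.mem_cons.1 hj with rfl | hj
      · exact Or.inr h1
      · left
        exact flatMap_inj hl' h2 j hj
    · rcases List.mem_cons.1 hj with rfl | hj
      · exact Or.inl h1
      · exact ih hl' h2 j hj

theorem wordE_isBlock {i : Index m n} {j : Letter u v} {w w' : List (Letter m n)}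
    (h : wordE m n i w = some w') : IsBlock m n j w' ↔ IsBlock m n j w := by
  unfold IsBlock
  rw [wordE_isRow h]
  have := wordE_isCol h
  unfold IsCol at this
  rw [this]

/-- The operator changes at most one block, keeps its length and preserves the block property. The
new word is thus the first word of a matrix with the same second word. Both directions of the arrow
are treated at once, for e and f. -/
theorem SuperMatrix.exists_wordPair (A : SuperMatrix m n u v) {i : Index m n}
    {w : List (Letter m n)}
    (h : wordE m n i A.wordPair.1 = some w ∨ wordE m n i w = some A.wordPair.1) :
    ∃ A' : SuperMatrix m n u v, A'.wordPair = (w, A.wordPair.2) := by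
  have hlen : w.length = ((List.finRange (u + v)).flatMap A.block).length := by
    rw [← wordPair_fst]
    rcases h with h | h
    · exact wordE_length h
    · exact (wordE_length h).symm
  obtain ⟨g, rfl, hg⟩ := exists_flatMap_eq (List.nodup_finRange _) A.block hlen
  rw [wordPair_fst] at h
  have hblock : ∀ j, IsBlock m n j (g j) := by
    intro j
    rcases h with h | h
    · rcases wordE_flatMap hg h j (by simp) with e | e
      · rw [e]; exact A.isBlock j
      · rw [wordE_isBlock e]; exact A.isBlock j
    · rcases wordE_flatMap (fun j hj => (hg j hj).symm) h j (by simp) with e | e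
      · rw [← e]; exact A.isBlock j
      · rw [← wordE_isBlock e]; exact A.isBlock j
  refine ⟨matrixOfBlocks g hblock, Prod.ext ?_ ?_⟩
  · rw [wordPair_fst]
    exact List.flatMap_congr fun j _ => block_matrixOfBlocks g hblock j
  · rw [wordPair_snd, wordPair_snd]
    refine List.flatMap_congr fun j hj => ?_
    rw [block_matrixOfBlocks, hg j hj]

theorem SuperMatrix.wordPair_injective :
    Function.Injective (SuperMatrix.wordPair (m := m) (n := n) (u := u) (v := v)) := by
  intro A B h
  have hb : A.biword = B.biword := by
    have : ∀ A : SuperMatrix m n u v, A.biword = A.wordPair.1.zip A.wordPair.2 := fun A => by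
      rw [wordPair]
      exact List.zip_of_prod rfl rfl
    rw [this, this, h]
  ext b b'
  rw [← count_biword, ← count_biword, hb]

theorem isStableEmbedding_wordPair :
    IsStableEmbedding ((words m n).onFst (List (Letter u v)))
      (SuperMatrix.wordPair (m := m) (n := n) (u := u) (v := v)) where
  injective := SuperMatrix.wordPair_injective
  e_mem i A w h := by
    obtain ⟨w₁, h1, rfl⟩ := Option.map_eq_some_iff.1 h
    exact A.exists_wordPair (Or.inl h1)
  f_mem i A w h := by
    obtain ⟨w₁, h1, rfl⟩ := Option.map_eq_some_iff.1 h
    exact A.exists_wordPair (Or.inr (wordF_iff_wordE.1 h1))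

theorem SuperMatrix.transpose_transpose (A : SuperMatrix m n u v) : A.transpose.transpose = A := rfl

theorem isStableEmbedding_wordPairStar :
    IsStableEmbedding ((words u v).onFst (List (Letter m n)))
      (SuperMatrix.wordPairStar (m := m) (n := n) (u := u) (v := v)) where
  injective A B h := by
    have := SuperMatrix.wordPair_injective h
    rw [← A.transpose_transpose, this, B.transpose_transpose]
  e_mem i A w h := by
    obtain ⟨B, hB⟩ := isStableEmbedding_wordPair.e_mem i A.transpose w h
    exact ⟨B.transpose, hB⟩
  f_mem i A w h := by
    obtain ⟨B, hB⟩ := isStableEmbedding_wordPair.f_mem i A.transpose w h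
    exact ⟨B.transpose, hB⟩

/-! ### The effect of the operators on the two tableaux -/

theorem SuperMatrix.length_block_eq {A B : SuperMatrix m n u v} (h : A.wordPair.2 = B.wordPair.2)
    (j : Letter u v) : (A.block j).length = (B.block j).length := by
  have : ∀ A : SuperMatrix m n u v, A.wordPair.2.count j = (A.block j).length := fun A => by
    rw [wordPair_snd]
    exact count_flatMap_replicate _ (List.nodup_finRange _) (fun b => by simp) _ j
  rw [← this, ← this, h]

/-- P₂ is the chain of shapes of the tableaux of the prefixes. On each prefix e_i acts or does
nothing, and the shape of the tableau stays the same in either case. -/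
theorem SuperMatrix.P₂_eq_of_wordE {A B : SuperMatrix m n u v} {i : Index m n}
    (h : wordE m n i A.wordPair.1 = some B.wordPair.1) (h' : A.wordPair.2 = B.wordPair.2) :
    A.P₂ = B.P₂ := by
  rw [P₂_eq_iff]
  intro q
  have hlen : (B.prefixWord q).length = (A.prefixWord q).length :=
    length_flatMap_congr fun j _ => length_block_eq h'.symm j
  have hsplit : ∀ A : SuperMatrix m n u v, ∃ t, A.wordPair.1 = A.prefixWord q ++ t := by
    intro A
    refine ⟨((List.finRange (u + v)).filter fun j => !decide (j.val < q)).flatMap A.block, ?_⟩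
    rw [wordPair_fst, prefixWord, ← List.flatMap_append]
    congr 1
    refine List.Perm.eq_of_pairwise (le := (· < ·)) (fun _ _ _ _ h1 h2 => absurd h1 h2.asymm)
      (List.pairwise_lt_finRange _) ?_ ?_
    · rw [List.pairwise_append]
      refine ⟨(List.pairwise_lt_finRange _).filter _, (List.pairwise_lt_finRange _).filter _, ?_⟩
      intro a ha b hb
      simp only [List.mem_filter, List.mem_finRange, true_and, decide_eq_true_eq,
        Bool.not_eq_true', decide_eq_false_iff_not] at ha hb
      rw [Fin.lt_def]
      omega
    · exact (List.filter_append_perm (fun j : Fin (u + v) => decide (j.val < q))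
        (List.finRange (u + v))).symm
  obtain ⟨t, ht⟩ := hsplit A
  obtain ⟨t', ht'⟩ := hsplit B
  rw [ht, ht', wordE_append_iff hlen] at h
  rcases h with ⟨-, h, -⟩ | ⟨-, h, -⟩
  · exact (wordE_P_colLens h).symm
  · rw [h]

/-- For the converse, φ_i can be read from P₁, so f_i does not kill the word of A. It leads to a
matrix C with the same two tableaux as B, and C = B by injectivity. -/
theorem SuperMatrix.wordF_iff (A B : SuperMatrix m n u v) (i : Index m n) :
    (wordF m n i A.wordPair.1 = some B.wordPair.1 ∧ A.wordPair.2 = B.wordPair.2) ↔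
      (wordF m n i (tabWord A.P₁) = some (tabWord B.P₁) ∧ A.P₂ = B.P₂) := by
  constructor
  · rintro ⟨h1, h2⟩
    exact ⟨(wordF_P h1).2, (P₂_eq_of_wordE (wordF_iff_wordE.1 h1) h2.symm).symm⟩
  · rintro ⟨h1, h2⟩
    cases hF : wordF m n i A.wordPair.1 with
    | none =>
      rw [wordF_eq_none_iff, ← (word_P i _).2, ← wordF_eq_none_iff] at hF
      exact absurd (hF.symm.trans h1) (by simp)
    | some w =>
      obtain ⟨C, hC⟩ := A.exists_wordPair (Or.inr (wordF_iff_wordE.1 hF))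
      have hC1 : C.wordPair.1 = w := by rw [hC]
      have hC2 : C.wordPair.2 = A.wordPair.2 := by rw [hC]
      rw [← hC1] at hF
      have h3 : A.P₂ = C.P₂ := (P₂_eq_of_wordE (wordF_iff_wordE.1 hF) hC2).symm
      have h4 := (wordF_P hF).2
      have h5 : tabWord C.P₁ = tabWord B.P₁ := Option.some.inj (h4.symm.trans h1)
      have h6 : C.P₁ = B.P₁ := by
        rw [← P_tabWord C.isTab_P₁, h5, P_tabWord B.isTab_P₁]
      have : C = B := injective_P _ _ h6 (h3.symm.trans h2)
      subst this
      rw [hC1]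
      exact ⟨rfl, hC2.symm⟩

end SuperKnuth

namespace SuperKnuth

variable {m n u v : ℕ}

/-! ### Constructions of crystals -/

section Restrict

variable {B W : Type*} {C : CrystalData m n W} {r : B → W}

theorem IsStableEmbedding.restrict_e (h : IsStableEmbedding C r) {i : Index m n} {b b' : B} :
    (C.restrict r).e i b = some b' ↔ C.e i (r b) = some (r b') := by
  classical
  constructor
  · intro he
    simp only [CrystalData.restrict] at he
    split_ifs at he with hex
    rw [← Option.some.inj he]
    exact hex.choose_spec
  · intro he
    have hex : ∃ b', C.e i (r b) = some (r b') := ⟨b', he⟩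
    simp only [CrystalData.restrict, dif_pos hex]
    exact congrArg some (h.injective (Option.some.inj (hex.choose_spec.symm.trans he)))

theorem IsStableEmbedding.restrict_f (h : IsStableEmbedding C r) {i : Index m n} {b b' : B} :
    (C.restrict r).f i b = some b' ↔ C.f i (r b) = some (r b') := by
  classical
  constructor
  · intro he
    simp only [CrystalData.restrict] at he
    split_ifs at he with hex
    rw [← Option.some.inj he]
    exact hex.choose_spec
  · intro he
    have hex : ∃ b', C.f i (r b) = some (r b') := ⟨b', he⟩
    simp only [CrystalData.restrict, dif_pos hex]
    exact congrArg some (h.injective (Option.some.inj (hex.choose_spec.symm.trans he)))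

theorem IsStableEmbedding.isCrystal (h : IsStableEmbedding C r) (hC : IsCrystal C) :
    IsCrystal (C.restrict r) where
  even_string i b := hC.even_string i (r b)
  odd_nonneg i b := hC.odd_nonneg i (r b)
  odd_string i b := hC.odd_string i (r b)
  e_spec i b b' he := hC.e_spec i (r b) (r b') (h.restrict_e.1 he)
  f_spec i b b' he := hC.f_spec i (r b) (r b') (h.restrict_f.1 he)
  f_iff_e i b b' := by rw [h.restrict_e, h.restrict_f, hC.f_iff_e]

end Restrict

theorem IsCrystal.onFst {B : Type*} {C : CrystalData m n B} (hC : IsCrystal C) (D : Type*) :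
    IsCrystal (C.onFst D) where
  even_string i b := hC.even_string i b.1
  odd_nonneg i b := hC.odd_nonneg i b.1
  odd_string i b := hC.odd_string i b.1
  e_spec i b b' he := by
    obtain ⟨c, hc, rfl⟩ := Option.map_eq_some_iff.1 he
    exact hC.e_spec i b.1 c hc
  f_spec i b b' he := by
    obtain ⟨c, hc, rfl⟩ := Option.map_eq_some_iff.1 he
    exact hC.f_spec i b.1 c hc
  f_iff_e i b b' := by
    obtain ⟨b, d⟩ := b
    obtain ⟨b', d'⟩ := b'
    simp only [CrystalData.onFst, Option.map_eq_some_iff, Prod.mk.injEq]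
    constructor
    · rintro ⟨c, hc, rfl, rfl⟩
      exact ⟨b, (hC.f_iff_e i b c).1 hc, rfl, rfl⟩
    · rintro ⟨c, hc, rfl, rfl⟩
      exact ⟨b', (hC.f_iff_e i c b').2 hc, rfl, rfl⟩

theorem IsCrystal.onSnd {B : Type*} {C : CrystalData m n B} (hC : IsCrystal C) (D : Type*) :
    IsCrystal (C.onSnd D) where
  even_string i b := hC.even_string i b.2
  odd_nonneg i b := hC.odd_nonneg i b.2
  odd_string i b := hC.odd_string i b.2
  e_spec i b b' he := by
    obtain ⟨c, hc, rfl⟩ := Option.map_eq_some_iff.1 he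
    exact hC.e_spec i b.2 c hc
  f_spec i b b' he := by
    obtain ⟨c, hc, rfl⟩ := Option.map_eq_some_iff.1 he
    exact hC.f_spec i b.2 c hc
  f_iff_e i b b' := by
    obtain ⟨d, b⟩ := b
    obtain ⟨d', b'⟩ := b'
    simp only [CrystalData.onSnd, Option.map_eq_some_iff, Prod.mk.injEq]
    constructor
    · rintro ⟨c, hc, rfl, rfl⟩
      exact ⟨b, (hC.f_iff_e i b c).1 hc, rfl, rfl⟩
    · rintro ⟨c, hc, rfl, rfl⟩
      exact ⟨b', (hC.f_iff_e i c b').2 hc, rfl, rfl⟩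

theorem IsCrystal.sum {ι : Type*} {B : ι → Type*} {C : ∀ k, CrystalData m n (B k)}
    (hC : ∀ k, IsCrystal (C k)) : IsCrystal (CrystalData.sum C) where
  even_string i b := (hC b.1).even_string i b.2
  odd_nonneg i b := (hC b.1).odd_nonneg i b.2
  odd_string i b := (hC b.1).odd_string i b.2
  e_spec i b b' he := by
    obtain ⟨c, hc, rfl⟩ := Option.map_eq_some_iff.1 he
    exact (hC b.1).e_spec i b.2 c hc
  f_spec i b b' he := by
    obtain ⟨c, hc, rfl⟩ := Option.map_eq_some_iff.1 he
    exact (hC b.1).f_spec i b.2 c hc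
  f_iff_e i b b' := by
    obtain ⟨k, b⟩ := b
    simp only [CrystalData.sum, Option.map_eq_some_iff]
    constructor
    · rintro ⟨c, hc, rfl⟩
      exact ⟨b, ((hC k).f_iff_e i b c).1 hc, rfl⟩
    · obtain ⟨k', b'⟩ := b'
      rintro ⟨c, hc, e⟩
      cases e
      exact ⟨_, ((hC _).f_iff_e i _ _).2 hc, rfl⟩

/-! ### Transport along isomorphisms -/

theorem IsCrystalIso.map_f {B₁ B₂ : Type*} {C₁ : CrystalData m n B₁} {C₂ : CrystalData m n B₂}
    {ψ : B₁ → B₂} (h : IsCrystalIso C₁ C₂ ψ) (i : Index m n) (b : B₁) :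
    C₂.f i (ψ b) = (C₁.f i b).map ψ := by
  refine Option.ext fun c => ?_
  obtain ⟨c, rfl⟩ := h.bijective.2 c
  rw [← h.arrow, Option.map_eq_some_iff]
  exact ⟨fun e => ⟨c, e, rfl⟩, fun ⟨a, e, ha⟩ => by rwa [← h.bijective.1 ha]⟩

theorem IsCrystalIso.map_e {B₁ B₂ : Type*} {C₁ : CrystalData m n B₁} {C₂ : CrystalData m n B₂}
    {ψ : B₁ → B₂} (h : IsCrystalIso C₁ C₂ ψ) (h₁ : IsCrystal C₁) (h₂ : IsCrystal C₂)
    (i : Index m n) (b : B₁) : C₂.e i (ψ b) = (C₁.e i b).map ψ := by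
  refine Option.ext fun c => ?_
  obtain ⟨c, rfl⟩ := h.bijective.2 c
  rw [← h₂.f_iff_e, ← h.arrow, h₁.f_iff_e, Option.map_eq_some_iff]
  exact ⟨fun e => ⟨c, e, rfl⟩, fun ⟨a, e, ha⟩ => by rwa [← h.bijective.1 ha]⟩

theorem bind_comm_of_map {B₁ B₂ : Type*} {ψ : B₁ → B₂} (hψ : Function.Injective ψ)
    {g g' : B₁ → Option B₁} {k k' : B₂ → Option B₂} (h : ∀ b, k (ψ b) = (g b).map ψ)
    (h' : ∀ b, k' (ψ b) = (g' b).map ψ) (b : B₁)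
    (hk : (k (ψ b)).bind k' = (k' (ψ b)).bind k) : (g b).bind g' = (g' b).bind g := by
  refine Option.map_injective hψ ?_
  have aux : ∀ {g g' : B₁ → Option B₁} {k k' : B₂ → Option B₂},
      (∀ b, k (ψ b) = (g b).map ψ) → (∀ b, k' (ψ b) = (g' b).map ψ) →
      ((g b).bind g').map ψ = (k (ψ b)).bind k' := by
    intro g g' k k' h h'
    rw [h]
    cases g b with
    | none => rfl
    | some a => simp [h']
  rw [aux h h', aux h' h, hk]

/-- Commutation of the operators on matrices is never verified directly: it is pulled back along the
bijection from a target where the two algebras act on different components. -/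
theorem IsBicrystal.of_iso {B₁ B₂ : Type*} {C₁ : BicrystalData m n u v B₁}
    {C₂ : BicrystalData m n u v B₂} {ψ : B₁ → B₂} (h : IsBicrystalIso C₁ C₂ ψ)
    (h₂ : IsBicrystal C₂) (hl : IsCrystal C₁.left) (hr : IsCrystal C₁.right) :
    IsBicrystal C₁ where
  left := hl
  right := hr
  e_e i j b := bind_comm_of_map h.left.bijective.1 (h.left.map_e hl h₂.left i)
    (h.right.map_e hr h₂.right j) b (h₂.e_e i j _)
  e_f i j b := bind_comm_of_map h.left.bijective.1 (h.left.map_e hl h₂.left i)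
    (h.right.map_f j) b (h₂.e_f i j _)
  f_e i j b := bind_comm_of_map h.left.bijective.1 (h.left.map_f i)
    (h.right.map_e hr h₂.right j) b (h₂.f_e i j _)
  f_f i j b := bind_comm_of_map h.left.bijective.1 (h.left.map_f i)
    (h.right.map_f j) b (h₂.f_f i j _)

/-! ### The direct sum of the tableau crystals -/

theorem isCrystal_tableauCrystal (m n : ℕ) (μ : YoungDiagram) :
    IsCrystal (tableauCrystal m n μ) :=
  (isStableEmbedding_tableau μ).isCrystal (isCrystal_words m n)

theorem isBicrystal_tableauPairs (m n u v : ℕ) : IsBicrystal (tableauPairsBicrystal m n u v) := by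
  have key : ∀ {B D : CommonHook m n u v → Type} (g : ∀ μ, B μ → Option (B μ))
      (g' : ∀ μ, D μ → Option (D μ)) (p : Σ μ, B μ × D μ),
      (((g p.1 p.2.1).map fun b => (b, p.2.2)).map fun x => (⟨p.1, x⟩ : Σ μ, B μ × D μ)).bind
        (fun q : Σ μ, B μ × D μ => ((g' q.1 q.2.2).map fun b => (q.2.1, b)).map fun x => (⟨q.1, x⟩ : Σ μ, B μ × D μ)) =
      (((g' p.1 p.2.2).map fun b => (p.2.1, b)).map fun x => (⟨p.1, x⟩ : Σ μ, B μ × D μ)).bind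
        (fun q : Σ μ, B μ × D μ => ((g q.1 q.2.1).map fun b => (b, q.2.2)).map fun x => (⟨q.1, x⟩ : Σ μ, B μ × D μ)) := by
    rintro B D g g' ⟨μ, b, d⟩
    cases h : g μ b <;> cases h' : g' μ d <;> simp [h, h']
  refine ⟨?_, ?_, ?_, ?_, ?_, ?_⟩
  · exact IsCrystal.sum
      (C := fun μ : CommonHook m n u v => (tableauCrystal m n μ.1).onFst (Tableau u v μ.1))
      fun μ => (isCrystal_tableauCrystal m n μ.1).onFst _
  · exact IsCrystal.sum
      (C := fun μ : CommonHook m n u v => (tableauCrystal u v μ.1).onSnd (Tableau m n μ.1))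
      fun μ => (isCrystal_tableauCrystal u v μ.1).onSnd _
  · exact fun i j p => key (fun μ => (tableauCrystal m n μ.1).e i)
      (fun μ => (tableauCrystal u v μ.1).e j) p
  · exact fun i j p => key (fun μ => (tableauCrystal m n μ.1).e i)
      (fun μ => (tableauCrystal u v μ.1).f j) p
  · exact fun i j p => key (fun μ => (tableauCrystal m n μ.1).f i)
      (fun μ => (tableauCrystal u v μ.1).e j) p
  · exact fun i j p => key (fun μ => (tableauCrystal m n μ.1).f i)
      (fun μ => (tableauCrystal u v μ.1).f j) p

theorem tableauPairs_ext {p q : TableauPairs m n u v} (h₁ : p.2.1.columns = q.2.1.columns)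
    (h₂ : p.2.2.columns = q.2.2.columns) : p = q := by
  obtain ⟨⟨μ, hμ⟩, T, U⟩ := p
  obtain ⟨⟨ν, hν⟩, T', U'⟩ := q
  have h : μ = ν := eq_of_colLen_eq (by
    rw [← (isTableau_iff.1 T.isTableau).2, ← (isTableau_iff.1 T'.isTableau).2]
    exact congrArg colLens h₁)
  subst h
  obtain rfl : T = T' := Tableau.ext h₁
  obtain rfl : U = U' := Tableau.ext h₂
  rfl

/-- Expressed through columns because the shapes of p and q are not known to coincide beforehand;
`tableauPairs_ext` recovers the equality in the dependent sum. -/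
theorem tableauPairs_left_f {p q : TableauPairs m n u v} {i : Index m n} :
    (tableauPairsBicrystal m n u v).left.f i p = some q ↔
      wordF m n i (tabWord p.2.1.columns) = some (tabWord q.2.1.columns) ∧
        p.2.2.columns = q.2.2.columns := by
  have key : ∀ {T T' : Tableau m n p.1.1}, (tableauCrystal m n p.1.1).f i T = some T' ↔
      wordF m n i (tabWord T.columns) = some (tabWord T'.columns) := fun {T T'} =>
    (isStableEmbedding_tableau p.1.1).restrict_f
  constructor
  · intro h
    obtain ⟨a, ha, rfl⟩ := Option.map_eq_some_iff.1 h
    obtain ⟨c, hc, rfl⟩ := Option.map_eq_some_iff.1 ha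
    exact ⟨key.1 hc, rfl⟩
  · rintro ⟨h1, h2⟩
    cases h : (tableauCrystal m n p.1.1).f i p.2.1 with
    | none =>
      exfalso
      obtain ⟨T, hT⟩ := (isStableEmbedding_tableau p.1.1).f_mem i p.2.1 _ h1
      have : (tableauCrystal m n p.1.1).f i p.2.1 = some T := key.2 (h1.trans (by rw [← hT]; rfl))
      rw [h] at this
      cases this
    | some T =>
      have h3 := key.1 h
      have e : (tableauPairsBicrystal m n u v).left.f i p = some ⟨p.1, T, p.2.2⟩ := by
        simp only [tableauPairsBicrystal, CrystalData.sum, CrystalData.onFst, h, Option.map_some]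
      rw [e]
      refine congrArg some (tableauPairs_ext ?_ h2)
      have h4 : tabWord T.columns = tabWord q.2.1.columns := Option.some.inj (h3.symm.trans h1)
      rw [← P_tabWord (isTableau_iff.1 T.isTableau).1, h4,
        P_tabWord (isTableau_iff.1 q.2.1.isTableau).1]

theorem tableauPairs_right_f {p q : TableauPairs m n u v} {i : Index u v} :
    (tableauPairsBicrystal m n u v).right.f i p = some q ↔
      wordF u v i (tabWord p.2.2.columns) = some (tabWord q.2.2.columns) ∧
        p.2.1.columns = q.2.1.columns := by
  have key : ∀ {T T' : Tableau u v p.1.1}, (tableauCrystal u v p.1.1).f i T = some T' ↔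
      wordF u v i (tabWord T.columns) = some (tabWord T'.columns) := fun {T T'} =>
    (isStableEmbedding_tableau p.1.1).restrict_f
  constructor
  · intro h
    obtain ⟨a, ha, rfl⟩ := Option.map_eq_some_iff.1 h
    obtain ⟨c, hc, rfl⟩ := Option.map_eq_some_iff.1 ha
    exact ⟨key.1 hc, rfl⟩
  · rintro ⟨h1, h2⟩
    cases h : (tableauCrystal u v p.1.1).f i p.2.2 with
    | none =>
      exfalso
      obtain ⟨T, hT⟩ := (isStableEmbedding_tableau p.1.1).f_mem i p.2.2 _ h1
      have : (tableauCrystal u v p.1.1).f i p.2.2 = some T := key.2 (h1.trans (by rw [← hT]; rfl))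
      rw [h] at this
      cases this
    | some T =>
      have h3 := key.1 h
      have e : (tableauPairsBicrystal m n u v).right.f i p = some ⟨p.1, p.2.1, T⟩ := by
        simp only [tableauPairsBicrystal, CrystalData.sum, CrystalData.onSnd, h, Option.map_some]
      rw [e]
      refine congrArg some (tableauPairs_ext h2 ?_)
      have h4 : tabWord T.columns = tabWord q.2.2.columns := Option.some.inj (h3.symm.trans h1)
      rw [← P_tabWord (isTableau_iff.1 T.isTableau).1, h4,
        P_tabWord (isTableau_iff.1 q.2.2.isTableau).1]

/-! ### The isomorphism -/

theorem min_le_of_isCol {s : List (Letter m n)} (hc : IsCol (RowRel m n) s) (k : ℕ)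
    (hk : k < s.length) : min k m ≤ (s[k]).val := by
  induction k with
  | zero => simp
  | succ k ih =>
    have h1 := ih (by omega)
    have h2 := List.pairwise_iff_getElem.1 hc k (k + 1) (by omega) hk (by omega)
    rw [rowRel_iff_val] at h2
    omega

/-- Barred letters increase strictly down a column, so entries in rows from m on are unbarred;
unbarred letters increase strictly along rows. This bound forces the hook shape and later the
extremality of H. -/
theorem add_le_of_isTab {T : List (List (Letter m n))} (hT : IsTab (RowRel m n) T) {k : ℕ}
    (hk : m ≤ k) (j : ℕ) (hj : k < (T.getD j []).length) : m + j ≤ ((T.getD j [])[k]).val := by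
  induction j with
  | zero =>
    have := min_le_of_isCol (hT.isCol_getD 0) k hj
    omega
  | succ j ih =>
    have hR := rowLe_iff.1 (hT.rowLe_getD j)
    have hj' : k < (T.getD j []).length := hj.trans_le hR.1
    have h1 := ih hj'
    have h2 := hR.2 k _ _ (List.getElem?_eq_getElem hj') (List.getElem?_eq_getElem hj)
    rw [rowRel_iff_val] at h2
    omega

theorem isHook_of_isTableau {μ : YoungDiagram} {T : List (List (Letter m n))}
    (h : IsTableau m n μ T) : IsHook m n μ := by
  unfold IsHook
  by_contra hlt
  push Not at hlt
  have hlen : m < (T.getD n []).length := by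
    rwa [h.shape, ← YoungDiagram.mem_iff_lt_colLen, YoungDiagram.mem_iff_lt_rowLen]
  -- The cell in row m and column n would have to hold a letter at position at least m + n.
  have h1 := add_le_of_isTab (isTableau_iff.1 h).1 le_rfl n hlen
  have h2 := ((T.getD n [])[m]).isLt
  omega

theorem SuperMatrix.exists_pair (A : SuperMatrix m n u v) : ∃ p : TableauPairs m n u v,
    p.2.1.columns = A.P₁ ∧ p.2.2.columns = A.P₂ := by
  obtain ⟨μ, hμ⟩ := exists_shape A.isTab_P₁
  have h1 : IsTableau m n μ A.P₁ := isTableau_iff.2 ⟨A.isTab_P₁, hμ⟩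
  have h2 : IsTableau u v μ A.P₂ := isTableau_iff.2 ⟨A.isTab_P₂, A.colLens_P₁_eq ▸ hμ⟩
  exact ⟨⟨⟨μ, isHook_of_isTableau h1, isHook_of_isTableau h2⟩, ⟨A.P₁, h1⟩, ⟨A.P₂, h2⟩⟩, rfl, rfl⟩

/-- The map `π = (P_1, P_2)`. -/
noncomputable def SuperMatrix.pair (A : SuperMatrix m n u v) : TableauPairs m n u v :=
  A.exists_pair.choose

theorem SuperMatrix.pair_fst (A : SuperMatrix m n u v) : A.pair.2.1.columns = A.P₁ :=
  A.exists_pair.choose_spec.1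

theorem SuperMatrix.pair_snd (A : SuperMatrix m n u v) : A.pair.2.2.columns = A.P₂ :=
  A.exists_pair.choose_spec.2

theorem SuperMatrix.pair_bijective :
    Function.Bijective (SuperMatrix.pair (m := m) (n := n) (u := u) (v := v)) := by
  constructor
  · intro A B h
    exact injective_P A B (by rw [← pair_fst, ← pair_fst, h]) (by rw [← pair_snd, ← pair_snd, h])
  · intro p
    have h1 := isTableau_iff.1 p.2.1.isTableau
    have h2 := isTableau_iff.1 p.2.2.isTableau
    obtain ⟨A, hA1, hA2⟩ := surjective_P h1.1 h2.1 (h1.2.trans h2.2.symm)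
    exact ⟨A, tableauPairs_ext (A.pair_fst.trans hA1) (A.pair_snd.trans hA2)⟩

theorem onFst_f_iff {B D : Type*} {C : CrystalData m n B} {i : Index m n} {p q : B × D} :
    (C.onFst D).f i p = some q ↔ C.f i p.1 = some q.1 ∧ p.2 = q.2 := by
  simp only [CrystalData.onFst, Option.map_eq_some_iff]
  constructor
  · rintro ⟨a, h, rfl⟩
    exact ⟨h, rfl⟩
  · rintro ⟨h, h'⟩
    exact ⟨q.1, h, Prod.ext rfl h'⟩

theorem count_tabWord_colBump (T : List (List (Letter m n))) (b x : Letter m n) :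
    (tabWord (colBump (RowRel m n) T b)).count x = (tabWord T ++ [b]).count x := by
  induction T generalizing b with
  | nil => simp [colBump, tabWord]
  | cons c T ih =>
    rcases colInsert_cases (RowRel m n) b c with ⟨-, h⟩ | ⟨p, y, q, rfl, -, -, h⟩
    · rw [colBump_cons_none h, tabWord_cons, tabWord_cons, List.append_assoc]
    · rw [colBump_cons_some h, tabWord_cons, tabWord_cons, List.count_append, ih]
      simp only [List.count_append, List.count_cons, List.count_nil]
      omega

theorem count_tabWord_P (w : List (Letter m n)) (x : Letter m n) :
    (tabWord (P m n w)).count x = w.count x := by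
  induction w using List.reverseRecOn with
  | nil => rfl
  | append_singleton w b ih =>
    have e3 : P m n (w ++ [b]) = colBump (RowRel m n) (P m n w) b := by
      rw [P_eq, P_eq, colP_append_singleton]
    rw [e3, count_tabWord_colBump, List.count_append, List.count_append, ih]

theorem wordWt_tabWord_P (w : List (Letter m n)) : wordWt m n (tabWord (P m n w)) = wordWt m n w := by
  funext x
  simp only [wordWt, count_tabWord_P]

theorem SuperMatrix.isBicrystalIso_pair :
    IsBicrystalIso (matrixBicrystal m n u v) (tableauPairsBicrystal m n u v)
      SuperMatrix.pair where
  left :=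
    { bijective := pair_bijective
      wt := fun A => by
        change wordWt m n (tabWord A.pair.2.1.columns) = wordWt m n A.wordPair.1
        rw [pair_fst]; exact wordWt_tabWord_P _
      ε := fun i A => by
        change wordEps m n i (tabWord A.pair.2.1.columns) = wordEps m n i A.wordPair.1
        rw [pair_fst]; exact (word_P i _).1
      φ := fun i A => by
        change wordPhi m n i (tabWord A.pair.2.1.columns) = wordPhi m n i A.wordPair.1
        rw [pair_fst]; exact (word_P i _).2
      arrow := fun i A B => by
        rw [tableauPairs_left_f, pair_fst, pair_fst, pair_snd, pair_snd, ← wordF_iff]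
        exact isStableEmbedding_wordPair.restrict_f.trans onFst_f_iff }
  right :=
    { bijective := pair_bijective
      wt := fun A => by
        change wordWt u v (tabWord A.pair.2.2.columns) = wordWt u v A.wordPairStar.1
        rw [pair_snd]; exact wordWt_tabWord_P _
      ε := fun i A => by
        change wordEps u v i (tabWord A.pair.2.2.columns) = wordEps u v i A.wordPairStar.1
        rw [pair_snd]; exact (word_P i _).1
      φ := fun i A => by
        change wordPhi u v i (tabWord A.pair.2.2.columns) = wordPhi u v i A.wordPairStar.1
        rw [pair_snd]; exact (word_P i _).2
      arrow := fun i A B => by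
        rw [tableauPairs_right_f, pair_fst, pair_fst, pair_snd, pair_snd]
        refine (isStableEmbedding_wordPairStar.restrict_f.trans onFst_f_iff).trans ?_
        -- Transposition exchanges the two structures and the two tableaux.
        exact wordF_iff A.transpose B.transpose i }

theorem isBicrystal_matrix : IsBicrystal (matrixBicrystal m n u v) :=
  IsBicrystal.of_iso SuperMatrix.isBicrystalIso_pair (isBicrystal_tableauPairs m n u v)
    (isStableEmbedding_wordPair.isCrystal ((isCrystal_words m n).onFst _))
    (isStableEmbedding_wordPairStar.isCrystal ((isCrystal_words u v).onFst _))

end SuperKnuth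

namespace SuperKnuth

/-! ### Insertion of the words of the matrices `A_λ` -/

/-- The relation `RowRel` on the positions of the letters. -/
def PosRel (m x y : ℕ) : Prop := x < y ∨ (x = y ∧ x < m)

instance (m : ℕ) : DecidableRel (PosRel m) := fun x y => by unfold PosRel; infer_instance

section Generic

variable {α : Type*} {R : α → α → Prop} [DecidableRel R]

/-- X is the part of the column already renewed, Y the part about to be replaced row by row, V the
untouched bottom. -/
theorem passCol_replace {X Y Z V : List α} (h : IsCol R (X ++ Z)) (hr : List.Forall₂ R Z Y) :
    passCol R (X ++ Y ++ V) Z = (X ++ Z ++ V, Y) := by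
  induction hr generalizing X with
  | nil => simp [passCol]
  | @cons z y Z Y hzy hr ih =>
    have hX : ∀ x ∈ X, ¬ R z x := fun x hx => (List.pairwise_append.1 h).2.2 x hx z (by simp)
    have h' : IsCol R ((X ++ [z]) ++ Z) := by simpa using h
    have e : X ++ y :: Y ++ V = X ++ y :: (Y ++ V) := by simp
    rw [e, passCol_cons_some (colInsert_eq_some R z y X (Y ++ V) hX hzy)]
    have := ih h'
    simp only [List.append_assoc, List.nil_append, List.cons_append] at this ⊢
    rw [this]

theorem passCol_extend {X Z : List α} (h : IsCol R (X ++ Z)) : passCol R X Z = (X ++ Z, []) := by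
  simpa using passCol_append_column (Y := []) h (by cases Z <;> trivial)

end Generic

section Pass

variable {m u : ℕ} (μ : YoungDiagram)

theorem lt_colLen_iff {i j : ℕ} : i < μ.colLen j ↔ j < μ.rowLen i := by
  rw [← YoungDiagram.mem_iff_lt_colLen, YoungDiagram.mem_iff_lt_rowLen]

/-- The letters that the word of `A_λ` contains for the barred `b'`, after `s` columns. -/
def hwEven (u s : ℕ) : List ℕ := (List.range u).flatMap fun k => List.replicate (μ.rowLen k - s) k

/-- The unbarred letters of the block of `t`, after `s` columns. -/
def hwOdd (m s t : ℕ) (q : ℕ) : List ℕ :=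
  (List.range q).reverse.map fun p => m + s + (μ.rowLen (m + p) - 1 - t)

/-- The block of `t`, after `s` columns. -/
def hwBlock (m u s t : ℕ) : List ℕ :=
  List.range' u (min m (μ.colLen t) - u) ++ hwOdd μ m s t (μ.colLen t - m)

/-- The column `s` after the insertion of the block of `t`. -/
def hwColumn (m s t : ℕ) : List ℕ :=
  List.range (min m (μ.colLen s)) ++ hwOdd μ m s t (μ.colLen s - m)

/-- The word of `A_λ`, after `s` columns. -/
def hwWord (m u N s : ℕ) : List ℕ :=
  hwEven μ u s ++ (List.range' s (N - s)).flatMap (hwBlock μ m u s)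

theorem le_of_mem_hwOdd {s t q x : ℕ} (h : x ∈ hwOdd μ m s t q) : m ≤ x := by
  simp only [hwOdd, List.mem_map] at h
  obtain ⟨p, -, rfl⟩ := h
  omega

theorem isCol_range (k : ℕ) : IsCol (PosRel m) (List.range k) := by
  refine List.Pairwise.imp (fun {x y} h => ?_) (List.pairwise_lt_range (n := k))
  unfold PosRel
  omega

theorem isCol_hwOdd (s t q : ℕ) : IsCol (PosRel m) (hwOdd μ m s t q) := by
  unfold hwOdd IsCol
  rw [List.pairwise_map, List.pairwise_reverse]
  refine List.Pairwise.imp (fun {x y} h => ?_) (List.pairwise_lt_range (n := q))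
  have := μ.rowLen_anti (m + x) (m + y) (by omega)
  unfold PosRel
  omega

theorem isCol_hwColumn (s t : ℕ) : IsCol (PosRel m) (hwColumn μ m s t) := by
  unfold hwColumn IsCol
  rw [List.pairwise_append]
  refine ⟨isCol_range _, isCol_hwOdd μ s t _, fun x hx y hy => ?_⟩
  have := le_of_mem_hwOdd μ hy
  rw [List.mem_range] at hx
  unfold PosRel
  omega

theorem hwOdd_split {s t q q' : ℕ} (h : q ≤ q') :
    hwOdd μ m s t q' = ((List.range (q' - q)).reverse.map
      fun p => m + s + (μ.rowLen (m + (q + p)) - 1 - t)) ++ hwOdd μ m s t q := by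
  obtain ⟨d, rfl⟩ := Nat.exists_eq_add_of_le h
  rw [Nat.add_sub_cancel_left]
  unfold hwOdd
  rw [List.range_add, List.reverse_append, List.map_append, ← List.map_reverse, List.map_map]
  rfl

theorem range_append_range' {a b : ℕ} (h : a ≤ b) :
    List.range a ++ List.range' a (b - a) = List.range b := by
  rw [List.range_eq_range', List.range_eq_range']
  have := List.range'_append (s := 0) (m := a) (n := b - a) (step := 1)
  simp only [one_mul, zero_add] at this
  rw [this]
  congr 1
  omega

/-- The block of t + 1 lowers by one exactly the unbarred entries that belong to rows longer than t
+ 1. What it expels is the same block shifted for the next column. -/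
theorem passCol_hwBlock {s t : ℕ} (hst : s ≤ t) :
    passCol (PosRel m) (hwColumn μ m s t) (hwBlock μ m u s (t + 1)) =
      (hwColumn μ m s (t + 1), hwBlock μ m u (s + 1) (t + 1)) := by
  have hc := μ.colLen_anti s (t + 1) (by omega)
  -- Barred letters bump their equals, so these letters replace copies of themselves and leave the
  -- column unchanged.
  have h1 : passCol (PosRel m) (hwColumn μ m s t)
      (List.range' u (min m (μ.colLen (t + 1)) - u)) =
      (hwColumn μ m s t, List.range' u (min m (μ.colLen (t + 1)) - u)) := by
    by_cases hlt : min m (μ.colLen (t + 1)) ≤ u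
    · rw [Nat.sub_eq_zero_of_le hlt]
      simp [passCol]
    · have e1 := range_append_range' (a := u) (b := min m (μ.colLen (t + 1))) (by omega)
      have e2 := range_append_range' (a := min m (μ.colLen (t + 1))) (b := min m (μ.colLen s))
        (by omega)
      have e3 : hwColumn μ m s t = List.range u ++
          List.range' u (min m (μ.colLen (t + 1)) - u) ++
          (List.range' (min m (μ.colLen (t + 1)))
            (min m (μ.colLen s) - min m (μ.colLen (t + 1))) ++
            hwOdd μ m s t (μ.colLen s - m)) := by
        rw [e1, ← List.append_assoc, e2]
        rfl
      rw [e3]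
      refine passCol_replace (by rw [e1]; exact isCol_range _) ?_
      rw [List.forall₂_same]
      intro x hx
      rw [List.mem_range'_1] at hx
      exact Or.inr ⟨rfl, by omega⟩
  have h2 : passCol (PosRel m) (hwColumn μ m s t) (hwOdd μ m s (t + 1) (μ.colLen (t + 1) - m)) =
      (hwColumn μ m s (t + 1), hwOdd μ m (s + 1) (t + 1) (μ.colLen (t + 1) - m)) := by
    have hq : μ.colLen (t + 1) - m ≤ μ.colLen s - m := by omega
    -- The rows concerned have length at most t + 1, so the truncated differences are zero for both
    -- t and t + 1.
    have htail : ((List.range (μ.colLen s - m - (μ.colLen (t + 1) - m))).reverse.map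
          fun p => m + s + (μ.rowLen (m + (μ.colLen (t + 1) - m + p)) - 1 - (t + 1))) =
        (List.range (μ.colLen s - m - (μ.colLen (t + 1) - m))).reverse.map
          fun p => m + s + (μ.rowLen (m + (μ.colLen (t + 1) - m + p)) - 1 - t) := by
      refine List.map_congr_left fun p _ => ?_
      have : ¬ (m + (μ.colLen (t + 1) - m + p) < μ.colLen (t + 1)) := by omega
      rw [lt_colLen_iff] at this
      omega
    have hnew := isCol_hwColumn (m := m) μ s (t + 1)
    unfold hwColumn at hnew ⊢
    rw [hwOdd_split μ hq, htail, ← List.append_assoc] at hnew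
    rw [hwOdd_split μ hq, hwOdd_split (t := t + 1) μ hq, htail, ← List.append_assoc,
      ← List.append_assoc]
    -- These rows are longer than t + 1, so nothing is truncated, and raising s and t together by
    -- one changes nothing.
    have hY : hwOdd μ m (s + 1) (t + 1) (μ.colLen (t + 1) - m) =
        hwOdd μ m s t (μ.colLen (t + 1) - m) := by
      refine List.map_congr_left fun p hp => ?_
      simp only [List.mem_reverse, List.mem_range] at hp
      have : m + p < μ.colLen (t + 1) := by omega
      rw [lt_colLen_iff] at this
      omega
    have hF : List.Forall₂ (PosRel m) (hwOdd μ m s (t + 1) (μ.colLen (t + 1) - m))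
        (hwOdd μ m s t (μ.colLen (t + 1) - m)) := by
      unfold hwOdd
      rw [List.forall₂_map_left_iff, List.forall₂_map_right_iff, List.forall₂_same]
      intro p hp
      simp only [List.mem_reverse, List.mem_range] at hp
      have : m + p < μ.colLen (t + 1) := by omega
      rw [lt_colLen_iff] at this
      left
      omega
    have := passCol_replace (V := []) hnew hF
    simp only [List.append_nil] at this
    rw [this, hY]
  unfold hwBlock
  rw [passCol_append, h1, h2]

theorem passCol_hwBlocks {s : ℕ} (d : ℕ) :
    passCol (PosRel m) (hwColumn μ m s s)
        ((List.range' (s + 1) d).flatMap (hwBlock μ m u s)) =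
      (hwColumn μ m s (s + d), (List.range' (s + 1) d).flatMap (hwBlock μ m u (s + 1))) := by
  induction d with
  | zero => simp [passCol]
  | succ d ih =>
    rw [List.range'_concat, List.flatMap_append, List.flatMap_append, passCol_append, ih]
    have e : s + 1 + 1 * d = (s + d) + 1 := by omega
    simp only [List.flatMap_singleton, e]
    rw [passCol_hwBlock μ (by omega)]
    rfl

/-- If row k reaches column s, the first copy of k settles in the column and every further copy
expels the one before it; each column thus uses up one copy. -/
theorem passCol_hwEven {s k : ℕ} (hk : k ≤ m) :
    passCol (PosRel m) [] (hwEven μ k s) = (List.range (min k (μ.colLen s)), hwEven μ k (s + 1)) := by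
  induction k with
  | zero => simp [hwEven, passCol]
  | succ k ih =>
    have ih := ih (by omega)
    have e : ∀ s, hwEven μ (k + 1) s = hwEven μ k s ++ List.replicate (μ.rowLen k - s) k := by
      intro s
      simp [hwEven, List.range_succ]
    rw [e, e, passCol_append, ih]
    by_cases h : μ.rowLen k ≤ s
    · have : ¬ (k < μ.colLen s) := by rw [lt_colLen_iff]; omega
      rw [Nat.sub_eq_zero_of_le h, Nat.sub_eq_zero_of_le (by omega : μ.rowLen k ≤ s + 1)]
      simp only [List.replicate_zero, passCol, List.append_nil, Prod.mk.injEq, and_true]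
      congr 1
      omega
    · have hlt : k < μ.colLen s := by rw [lt_colLen_iff]; omega
      obtain ⟨d, hd⟩ : ∃ d, μ.rowLen k - s = d + 1 := ⟨μ.rowLen k - s - 1, by omega⟩
      have hd' : μ.rowLen k - (s + 1) = d := by omega
      rw [hd, hd', List.replicate_succ, min_eq_left hlt.le, min_eq_left (by omega : k + 1 ≤ _)]
      have hX : ∀ x ∈ List.range k, ¬ PosRel m k x := fun x hx => by
        rw [List.mem_range] at hx
        unfold PosRel
        omega
      have h1 : colInsert (PosRel m) k (List.range k) = (List.range (k + 1), none) := by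
        rw [colInsert_eq_none_of_forall _ _ _ hX, List.range_succ]
      have h2 : colInsert (PosRel m) k (List.range (k + 1)) = (List.range (k + 1), some k) := by
        rw [List.range_succ]
        exact colInsert_eq_some (PosRel m) k k (List.range k) [] hX (Or.inr ⟨rfl, by omega⟩)
      have h3 : ∀ d, passCol (PosRel m) (List.range (k + 1)) (List.replicate d k) =
          (List.range (k + 1), List.replicate d k) := by
        intro d
        induction d with
        | zero => simp [passCol]
        | succ d ih => rw [List.replicate_succ, passCol_cons_some h2, ih]
      rw [passCol_cons_none h1, h3]

/-- The barred letters from the first part start the column, the block of s is appended below them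
without bumping, and every later block replaces entries by `passCol_hwBlock`. -/
theorem passCol_hwWord {N s : ℕ} (hu : u ≤ m) (hs : s < N) :
    passCol (PosRel m) [] (hwWord μ m u N s) =
      (hwColumn μ m s (N - 1), hwWord μ m u N (s + 1)) := by
  obtain ⟨d, rfl⟩ : ∃ d, N = s + d + 1 := ⟨N - s - 1, by omega⟩
  have e1 : s + d + 1 - s = d + 1 := by omega
  have e2 : s + d + 1 - (s + 1) = d := by omega
  have e3 : s + d + 1 - 1 = s + d := by omega
  unfold hwWord
  rw [e1, e2, e3, List.range'_succ, List.flatMap_cons, passCol_append, passCol_hwEven μ hu,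
    passCol_append]
  have h : passCol (PosRel m) (List.range (min u (μ.colLen s))) (hwBlock μ m u s s) =
      (hwColumn μ m s s, []) := by
    have e : List.range (min u (μ.colLen s)) ++ hwBlock μ m u s s = hwColumn μ m s s := by
      unfold hwBlock hwColumn
      rw [← List.append_assoc]
      congr 1
      by_cases hle : u ≤ μ.colLen s
      · rw [min_eq_left hle]
        exact range_append_range' (by omega)
      · rw [Nat.sub_eq_zero_of_le (by omega : min m (μ.colLen s) ≤ u)]
        simp only [List.range'_zero, List.append_nil]
        congr 1
        omega
    rw [passCol_extend (by rw [e]; exact isCol_hwColumn μ s s), e]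
  simp only [h, passCol_hwBlocks μ, List.nil_append]

/-- The columns of the highest weight tableau. -/
def highestColumn (m j : ℕ) : List ℕ :=
  List.range (min m (μ.colLen j)) ++ List.replicate (μ.colLen j - m) (m + j)

theorem colP_hwWord {N : ℕ} (hu : u ≤ m) (hN : μ.rowLen 0 ≤ N) :
    colP (PosRel m) (hwWord μ m u N 0) = (List.range (μ.rowLen 0)).map (highestColumn μ m) := by
  -- No row is longer than N, so after the last block every truncated difference is zero and all
  -- unbarred entries of column s have become m + s.
  have hcol : ∀ s < μ.rowLen 0, hwColumn μ m s (N - 1) = highestColumn μ m s := by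
    intro s hs
    unfold hwColumn highestColumn
    congr 1
    rw [List.eq_replicate_iff]
    refine ⟨by simp [hwOdd], fun x hx => ?_⟩
    simp only [hwOdd, List.mem_map] at hx
    obtain ⟨p, -, rfl⟩ := hx
    have := μ.rowLen_anti 0 (m + p) (by omega)
    omega
  have hnil : hwWord μ m u N (μ.rowLen 0) = [] := by
    unfold hwWord
    rw [List.append_eq_nil_iff]
    constructor
    · unfold hwEven
      rw [List.flatMap_eq_nil_iff]
      intro k _
      rw [Nat.sub_eq_zero_of_le (μ.rowLen_anti 0 k (by omega))]
      rfl
    · rw [List.flatMap_eq_nil_iff]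
      intro t ht
      rw [List.mem_range'_1] at ht
      have : μ.colLen t = 0 := by
        by_contra h0
        have : 0 < μ.colLen t := by omega
        rw [lt_colLen_iff] at this
        omega
      simp [hwBlock, this, hwOdd]
  have key : ∀ d s, s + d = μ.rowLen 0 →
      colP (PosRel m) (hwWord μ m u N s) = (List.range' s d).map (highestColumn μ m) := by
    intro d
    induction d with
    | zero =>
      intro s hs
      rw [add_zero] at hs
      rw [hs, hnil]
      rfl
    | succ d ih =>
      intro s hs
      have hp := passCol_hwWord (N := N) (s := s) μ hu (by omega)
      have hne : hwWord μ m u N s ≠ [] := by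
        intro e
        rw [e] at hp
        have h1 : hwColumn μ m s (N - 1) = [] := (congrArg Prod.fst hp).symm
        rw [hcol s (by omega)] at h1
        have h2 : 0 < μ.colLen s := by rw [lt_colLen_iff]; omega
        have h3 := congrArg List.length h1
        simp only [highestColumn, List.length_append, List.length_range, List.length_replicate,
          List.length_nil] at h3
        omega
      rw [colP_eq_of_ne_nil hne, hp, List.range'_succ, List.map_cons, ih (s + 1) (by omega),
        hcol s (by omega)]
  rw [key (μ.rowLen 0) 0 (by omega), List.range_eq_range']

end Pass

end SuperKnuth

namespace SuperKnuth

variable {m n u v : ℕ}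

/-! ### The words of the matrices `A_λ` -/

theorem highestTableau_map (μ : YoungDiagram) (h : IsHook m n μ) :
    (highestTableau m n μ h).map (List.map Fin.val) =
      (List.range (μ.rowLen 0)).map (highestColumn μ m) := by
  refine List.ext_getElem (by simp [highestTableau]) fun j h1 h2 => ?_
  simp only [highestTableau, List.getElem_map, List.getElem_ofFn, List.getElem_range]
  refine List.ext_getElem ?_ fun k h3 h4 => ?_
  · simp only [List.length_map, List.length_ofFn, highestColumn, List.length_append,
      List.length_range, List.length_replicate]
    omega
  · simp only [List.length_map, List.length_ofFn] at h3
    simp only [List.getElem_map, List.getElem_ofFn, highestColumn]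
    rw [List.getElem_append]
    simp only [List.length_range, List.getElem_range, List.getElem_replicate]
    by_cases hk : k < m
    · rw [dif_pos hk, dif_pos (by omega)]
    · rw [dif_neg hk, dif_neg (by omega)]

theorem map_map_val_injective {T T' : List (List (Letter m n))}
    (h : T.map (List.map Fin.val) = T'.map (List.map Fin.val)) : T = T' :=
  List.map_injective_iff.2 (List.map_injective_iff.2 Fin.val_injective) h

theorem P_map_val (w : List (Letter m n)) :
    (P m n w).map (List.map Fin.val) = colP (PosRel m) (w.map Fin.val) := by
  rw [P_eq]
  exact (colP_map (fun x y => rowRel_iff_val) w).symm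

theorem countP_range_interval {a b q : ℕ} (hb : b ≤ q) :
    (List.range q).countP (fun p => decide (a ≤ p ∧ p < b)) = b - a := by
  have h : (List.range q).countP (fun p => decide (a ≤ p ∧ p < b)) =
      ((Finset.range q).filter fun p => a ≤ p ∧ p < b).card := by
    rw [List.countP_eq_length_filter, Finset.card_def]
    rfl
  rw [h, ← Nat.card_Ico]
  congr 1
  ext p
  simp only [Finset.mem_filter, Finset.mem_range, Finset.mem_Ico]
  omega

theorem count_map_val (w : List (Letter m n)) (b : ℕ) :
    (w.map Fin.val).count b = if h : b < m + n then w.count ⟨b, h⟩ else 0 := by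
  split_ifs with h
  · exact List.count_map_of_injective w Fin.val Fin.val_injective ⟨b, h⟩
  · rw [List.count_eq_zero]
    intro hb
    obtain ⟨x, -, rfl⟩ := List.mem_map.1 hb
    exact h x.isLt

theorem block_matrixOfGE_barred (μ : YoungDiagram) (hu : u ≤ m) (j : Letter u v) (hj : j.val < u) :
    ((matrixOfGE m n u v μ).block j).map Fin.val = List.replicate (μ.rowLen j.val) j.val := by
  rw [← List.perm_replicate, List.perm_iff_count]
  intro b
  rw [count_map_val, List.count_replicate]
  simp only [SuperMatrix.count_block, matrixOfGE, hj, if_true, beq_iff_eq]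
  by_cases h1 : b < m + n <;> by_cases h2 : b < m <;> by_cases h3 : j.val = b <;>
    simp [h1, h2, h3, eq_comm] <;> omega

/-- ν_k counts the rows below the first m whose length is exactly k, and such a row contributes the
letter at position m + s to the block of t when its length is s + t + 1. -/
theorem count_hwOdd (μ : YoungDiagram) (t b : ℕ) :
    (hwOdd μ m 0 t (μ.colLen t - m)).count b = if b < m then 0 else nuPart m μ (b - m + t + 1) := by
  split_ifs with hb
  · rw [List.count_eq_zero]
    intro h
    have := le_of_mem_hwOdd μ h
    omega
  · obtain ⟨s, rfl⟩ := Nat.exists_eq_add_of_le (not_lt.1 hb)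
    have hanti := μ.colLen_anti t (s + t) (by omega)
    unfold hwOdd nuPart
    rw [List.count, List.countP_map, List.countP_reverse, Nat.add_sub_cancel_left,
      Nat.add_sub_cancel, ← countP_range_interval (a := μ.colLen (s + t + 1) - m)
        (b := μ.colLen (s + t) - m) (q := μ.colLen t - m) (by omega)]
    refine List.countP_congr fun p hp => ?_
    rw [List.mem_range] at hp
    simp only [Function.comp, beq_iff_eq, decide_eq_true_eq]
    have h1 : m + p < μ.colLen t := by omega
    have h2 := lt_colLen_iff μ (i := m + p) (j := s + t)
    have h3 := lt_colLen_iff μ (i := m + p) (j := s + t + 1)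
    rw [lt_colLen_iff] at h1
    omega

theorem sorted_hwBlock (μ : YoungDiagram) (s t : ℕ) : (hwBlock μ m u s t).Pairwise (· ≤ ·) := by
  unfold hwBlock
  rw [List.pairwise_append]
  refine ⟨List.pairwise_le_range', ?_, ?_⟩
  · refine List.Pairwise.imp (fun {x y} h => ?_) (isCol_hwOdd μ s t (μ.colLen t - m))
    unfold PosRel at h
    omega
  · intro x hx y hy
    have := le_of_mem_hwOdd μ hy
    rw [List.mem_range'_1] at hx
    omega

theorem block_matrixOfGE_unbarred (μ : YoungDiagram) (hμ : IsHook m n μ) (t : ℕ)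
    (ht : u + t < u + v) :
    ((matrixOfGE m n u v μ).block ⟨u + t, ht⟩).map Fin.val = hwBlock μ m u 0 t := by
  have hd : deg u v ⟨u + t, ht⟩ = 1 := by simp [deg]
  have hs : (((matrixOfGE m n u v μ).block ⟨u + t, ht⟩).map Fin.val).Pairwise (· ≤ ·) := by
    rw [List.pairwise_map]
    exact IsCol.sorted_le (((matrixOfGE m n u v μ).isBlock _).2 hd)
  refine List.Perm.eq_of_pairwise (fun _ _ _ _ => le_antisymm) hs (sorted_hwBlock μ 0 t) ?_
  rw [List.perm_iff_count]
  intro b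
  have hn : μ.rowLen m ≤ n := hμ
  have hrange : (List.range' u (min m (μ.colLen t) - u)).count b =
      if u ≤ b ∧ b < m ∧ t < μ.rowLen b then 1 else 0 := by
    rw [List.Nodup.count (List.nodup_range' (step := 1))]
    refine if_congr ?_ rfl rfl
    rw [List.mem_range'_1, ← lt_colLen_iff]
    omega
  rw [count_map_val, hwBlock, List.count_append, count_hwOdd, hrange]
  have hut : ¬ u + t < u := by omega
  simp only [SuperMatrix.count_block, matrixOfGE, Nat.add_sub_cancel_left]
  simp only [hut, if_false]
  by_cases h1 : b < m
  · have : b < m + n := by omega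
    simp only [h1, this, if_true, dif_pos, true_and, add_zero, Nat.succ_le_iff]
  · have hz : ∀ k, ¬ (k + 1 ≤ μ.rowLen m) → nuPart m μ (k + 1) = 0 := by
      intro k hk
      have : ¬ m < μ.colLen k := by rw [lt_colLen_iff]; omega
      simp only [nuPart, Nat.add_sub_cancel]
      omega
    simp only [h1, if_false, false_and, and_false, zero_add]
    have e : b - m + 1 + (t + 1) - 1 = b - m + t + 1 := by omega
    rw [e]
    split_ifs with h2 h3
    · rfl
    · exact (hz _ (by omega)).symm
    · exact (hz _ (by omega)).symm

theorem finRange_add (a b : ℕ) : List.finRange (a + b) =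
    (List.finRange a).map (Fin.castAdd b) ++ (List.finRange b).map (Fin.natAdd a) := by
  refine List.ext_getElem (by simp) fun k h1 h2 => ?_
  rw [List.getElem_append]
  ext
  split_ifs with h
  · simp
  · simp at h ⊢; omega

theorem matrixOfGE_word (μ : YoungDiagram) (hμ : IsHook m n μ) (hμ' : IsHook u v μ) (hu : u ≤ m)
    {N : ℕ} (hN : v ≤ N) :
    (matrixOfGE m n u v μ).wordPair.1.map Fin.val = hwWord μ m u N 0 := by
  have hv : μ.rowLen u ≤ v := hμ'
  rw [SuperMatrix.wordPair_fst, List.map_flatMap, finRange_add, List.flatMap_append, hwWord]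
  congr 1
  · rw [List.flatMap_map, hwEven, ← List.map_coe_finRange_eq_range, List.flatMap_map]
    refine List.flatMap_congr fun j _ => ?_
    exact block_matrixOfGE_barred μ hu (Fin.castAdd v j) j.isLt
  · obtain ⟨d, rfl⟩ := Nat.exists_eq_add_of_le hN
    -- Blocks beyond the letters of the second alphabet are empty, since row u has at most v cells;
    -- so N may be as large as convenient.
    have h1 : (List.range' v d).flatMap (hwBlock μ m u 0) = [] := by
      rw [List.flatMap_eq_nil_iff]
      intro t ht
      rw [List.mem_range'_1] at ht
      have : ¬ u < μ.colLen t := by rw [lt_colLen_iff]; omega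
      simp [hwBlock, hwOdd, (by omega : min m (μ.colLen t) - u = 0),
        (by omega : μ.colLen t - m = 0)]
    have h2 : List.range' 0 (v + d - 0) = List.range v ++ List.range' v d := by
      have := range_append_range' (a := v) (b := v + d) (by omega)
      rw [Nat.add_sub_cancel_left] at this
      rw [this, List.range_eq_range']
      rfl
    rw [h2, List.flatMap_append, h1, List.append_nil, List.flatMap_map,
      ← List.map_coe_finRange_eq_range, List.flatMap_map]
    refine List.flatMap_congr fun j _ => ?_
    exact block_matrixOfGE_unbarred μ hμ j.val (by omega)

theorem matrixOfGE_P₁ (μ : YoungDiagram) (hμ : IsHook m n μ) (hμ' : IsHook u v μ) (hu : u ≤ m) :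
    (matrixOfGE m n u v μ).P₁ = highestTableau m n μ hμ := by
  refine map_map_val_injective ?_
  rw [SuperMatrix.P₁, P_map_val, highestTableau_map,
    matrixOfGE_word μ hμ hμ' hu (N := v + μ.rowLen 0) (by omega), colP_hwWord μ hu (by omega)]

end SuperKnuth

namespace SuperKnuth

variable {m n u v : ℕ}

/-! ### A tableau with the shape and the weight of the highest weight tableau -/

/-- H is an insertion tableau: that of A_λ for (u, v) = (m, n). -/
theorem isTab_highestTableau (μ : YoungDiagram) (h : IsHook m n μ) :
    IsTab (RowRel m n) (highestTableau m n μ h) := by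
  rw [← matrixOfGE_P₁ μ h h le_rfl]
  exact SuperMatrix.isTab_P₁ _

theorem highestColumn_of_le {μ : YoungDiagram} {j : ℕ} (hj : μ.rowLen 0 ≤ j) :
    highestColumn μ m j = [] := by
  have : ¬ 0 < μ.colLen j := by rw [lt_colLen_iff]; omega
  simp [highestColumn, (by omega : μ.colLen j = 0)]

theorem highestTableau_getD (μ : YoungDiagram) (h : IsHook m n μ) (j : ℕ) :
    ((highestTableau m n μ h).getD j []).map Fin.val = highestColumn μ m j := by
  have h1 : ∀ T : List (List (Letter m n)),
      (T.getD j []).map Fin.val = (T.map (List.map Fin.val)).getD j [] := fun T => by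
    simp only [List.getD_eq_getElem?_getD, List.getElem?_map]
    cases T[j]? <;> rfl
  rw [h1, highestTableau_map]
  by_cases hj : j < μ.rowLen 0
  · rw [List.getD_eq_getElem _ _ (by simpa using hj)]
    simp
  · rw [List.getD_eq_default _ _ (by simpa using hj), highestColumn_of_le (by omega)]

theorem colLens_highestTableau (μ : YoungDiagram) (h : IsHook m n μ) :
    colLens (highestTableau m n μ h) = μ.colLen := by
  funext j
  have := congrArg List.length (highestTableau_getD μ h j)
  rw [List.length_map] at this
  rw [colLens, this]
  simp only [highestColumn, List.length_append, List.length_range, List.length_replicate]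
  omega

theorem countP_tabWord (p : Letter m n → Bool) (T : List (List (Letter m n))) {L : ℕ}
    (hL : T.length ≤ L) :
    (tabWord T).countP p = ∑ j ∈ Finset.range L, (T.getD j []).countP p := by
  induction T generalizing L with
  | nil => simp [tabWord]
  | cons c T ih =>
    match L, hL with
    | L + 1, hL =>
      rw [tabWord_cons, List.countP_append, Finset.sum_range_succ',
        ih (by simpa using hL : T.length ≤ L)]
      simp

theorem length_filter_le_of_forall {s : List (Letter m n)} {q B : ℕ}
    (h : ∀ k (hk : k < s.length), B ≤ k → q ≤ (s[k]).val) :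
    (s.filter fun x => x.val < q).length ≤ B := by
  rw [← List.take_append_drop B s, List.filter_append, List.length_append]
  have h1 : ((s.drop B).filter fun x => x.val < q) = [] := by
    rw [List.filter_eq_nil_iff]
    intro x hx
    obtain ⟨k, hk, rfl⟩ := List.mem_iff_getElem.1 hx
    rw [List.length_drop] at hk
    have := h (B + k) (by omega) (by omega)
    rw [List.getElem_drop]
    simpa using this
  have h2 : ((s.take B).filter fun x => x.val < q).length ≤ (s.take B).length :=
    List.length_filter_le _ _
  have h3 := List.length_take_le B s
  rw [h1, List.length_nil]
  omega

theorem length_filter_highestColumn (μ : YoungDiagram) (j q : ℕ) :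
    ((highestColumn μ m j).filter fun x => x < q).length =
      min (min m (μ.colLen j)) q + if m + j < q then μ.colLen j - m else 0 := by
  rw [highestColumn, List.filter_append, List.length_append]
  congr 1
  · generalize min m (μ.colLen j) = c
    rw [← List.countP_eq_length_filter]
    have := countP_range_interval (a := 0) (b := min c q) (q := c) (by omega)
    rw [Nat.sub_zero] at this
    rw [← this]
    refine List.countP_congr fun x hx => ?_
    rw [List.mem_range] at hx
    simp only [decide_eq_true_eq]
    omega
  · split_ifs with h <;> simp [h]

/-- For each q and each column, H contains the largest possible number of letters at positions less
than q. Equal weights make the totals equal, so equality holds in every column, and these numbers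
determine a tableau. -/
theorem eq_highestTableau {μ : YoungDiagram} (h : IsHook m n μ) {T : List (List (Letter m n))}
    (hT : IsTab (RowRel m n) T) (hs : colLens T = μ.colLen)
    (hw : ∀ b, (tabWord T).count b = (tabWord (highestTableau m n μ h)).count b) :
    T = highestTableau m n μ h := by
  set H := highestTableau m n μ h with hH
  have hfil : ∀ q j, ((H.getD j []).filter fun x => x.val < q).length =
      min (min m (μ.colLen j)) q + if m + j < q then μ.colLen j - m else 0 := by
    intro q j
    rw [← length_filter_highestColumn, ← highestTableau_getD μ h j, List.filter_map,
      List.length_map]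
    rfl
  have hle : ∀ q j, ((T.getD j []).filter fun x => x.val < q).length ≤
      ((H.getD j []).filter fun x => x.val < q).length := by
    intro q j
    have hlen : (T.getD j []).length = μ.colLen j := congrFun hs j
    have h1 : ((T.getD j []).filter fun x => x.val < q).length ≤ (T.getD j []).length :=
      List.length_filter_le _ _
    rw [hfil]
    split_ifs with hq
    · omega
    -- When q ≤ m + j, only the first min m q rows of column j can hold a letter at a position less
    -- than q.
    · have h2 : ((T.getD j []).filter fun x => x.val < q).length ≤ min m q := by
        refine length_filter_le_of_forall fun k hk hB => ?_
        by_cases hkm : m ≤ k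
        · have := add_le_of_isTab hT hkm j hk
          omega
        · have := min_le_of_isCol (hT.isCol_getD j) k hk
          omega
      omega
  have hperm : (tabWord T).Perm (tabWord H) := List.perm_iff_count.2 hw
  refine hT.eq_of_filter_length (isTab_highestTableau μ h) fun q j => ?_
  have hsum := hperm.countP_eq (fun x => decide (x.val < q))
  rw [countP_tabWord _ T (L := T.length + H.length + j + 1) (by omega),
    countP_tabWord _ H (L := T.length + H.length + j + 1) (by omega)] at hsum
  simp only [List.countP_eq_length_filter] at hsum
  exact (Finset.sum_eq_sum_iff_of_le fun j _ => hle q j).1 hsum j (Finset.mem_range.2 (by omega))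

theorem length_highestTableau (μ : YoungDiagram) (h : IsHook m n μ) :
    (highestTableau m n μ h).length = μ.rowLen 0 := by
  simp [highestTableau]

theorem count_highestTableau (μ : YoungDiagram) (h : IsHook m n μ) (b : Letter m n) :
    (tabWord (highestTableau m n μ h)).count b =
      if b.val < m then μ.rowLen b.val else μ.colLen (b.val - m) - m := by
  have hcol : ∀ j, ((highestTableau m n μ h).getD j []).countP (· == b) =
      if b.val < m then (if j < μ.rowLen b.val then 1 else 0)
        else if j = b.val - m then μ.colLen (b.val - m) - m else 0 := by
    intro j
    have h1 : ((highestTableau m n μ h).getD j []).count b = (highestColumn μ m j).count b.val := by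
      rw [← highestTableau_getD μ h j, List.count_map_of_injective _ _ Fin.val_injective]
    change ((highestTableau m n μ h).getD j []).count b = _
    rw [h1, highestColumn, List.count_append, List.Nodup.count List.nodup_range,
      List.count_replicate]
    simp only [List.mem_range, beq_iff_eq]
    have h2 := lt_colLen_iff μ (i := b.val) (j := j)
    by_cases hb : b.val < m
    · simp only [hb, if_true, if_neg (by omega : ¬ m + j = b.val), add_zero]
      refine if_congr ?_ rfl rfl
      omega
    · simp only [hb, if_false, if_neg (by omega : ¬ b.val < min m (μ.colLen j)), zero_add]
      by_cases hj : j = b.val - m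
      · rw [if_pos (by omega), if_pos hj, hj]
      · rw [if_neg (by omega), if_neg hj]
  have hsum := countP_tabWord (· == b) (highestTableau m n μ h) (length_highestTableau μ h).le
  rw [List.count, hsum]
  simp only [hcol]
  split_ifs with hb
  · rw [← Finset.sum_filter, Finset.sum_const, smul_eq_mul, mul_one]
    have h3 := μ.rowLen_anti 0 b.val (by omega)
    have : (Finset.range (μ.rowLen 0)).filter (fun j => j < μ.rowLen b.val) =
        Finset.range (μ.rowLen b.val) := by
      ext j
      simp only [Finset.mem_filter, Finset.mem_range]
      omega
    rw [this, Finset.card_range]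
  · rw [Finset.sum_ite_eq']
    split_ifs with hlt
    · rfl
    · rw [Finset.mem_range] at hlt
      have : ¬ 0 < μ.colLen (b.val - m) := by rw [lt_colLen_iff]; omega
      omega

/-! ### The highest weight matrices -/

theorem SuperMatrix.count_tabWord_P₂ (A : SuperMatrix m n u v) (b : Letter u v) :
    (tabWord A.P₂).count b = (A.block b).length := by
  rw [P₂, count_tabWord_P, wordPairStar, wordPair_fst, List.count_flatMap, block,
    List.length_flatMap]
  have h1 : List.count b ∘ A.transpose.block = fun x => A.entry x b := by
    funext x
    exact A.transpose.count_block x b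
  rw [h1]
  simp only [List.length_replicate]
  unfold blockOrder
  split_ifs
  · rw [List.map_reverse, List.sum_reverse]
  · rfl

/-- No second insertion is needed: the shape is that of P₁, and the weight is given by the lengths
of the blocks. -/
theorem matrixOfGE_P₂ (μ : YoungDiagram) (hμ : IsHook m n μ) (hμ' : IsHook u v μ) (hu : u ≤ m) :
    (matrixOfGE m n u v μ).P₂ = highestTableau u v μ hμ' := by
  refine eq_highestTableau hμ' (SuperMatrix.isTab_P₂ _) ?_ fun b => ?_
  · rw [← SuperMatrix.colLens_P₁_eq, matrixOfGE_P₁ μ hμ hμ' hu, colLens_highestTableau]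
  · rw [SuperMatrix.count_tabWord_P₂, count_highestTableau, ← List.length_map (f := Fin.val)]
    split_ifs with hb
    · rw [block_matrixOfGE_barred μ hu b hb, List.length_replicate]
    · obtain ⟨t, ht⟩ := Nat.exists_eq_add_of_le (not_lt.1 hb)
      obtain ⟨b, hlt⟩ := b
      simp only at ht
      subst ht
      rw [block_matrixOfGE_unbarred μ hμ t hlt]
      simp only [hwBlock, hwOdd, List.length_append, List.length_range', List.length_map,
        List.length_reverse, List.length_range, Nat.add_sub_cancel_left]
      omega

theorem matrixOf_P (μ : YoungDiagram) (hμ : IsHook m n μ) (hμ' : IsHook u v μ) :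
    (matrixOf m n u v μ).P₁ = highestTableau m n μ hμ ∧
      (matrixOf m n u v μ).P₂ = highestTableau u v μ hμ' := by
  unfold matrixOf
  split_ifs with hu
  · exact ⟨matrixOfGE_P₁ μ hμ hμ' hu, matrixOfGE_P₂ μ hμ hμ' hu⟩
  · exact ⟨matrixOfGE_P₂ μ hμ' hμ (by omega), matrixOfGE_P₁ μ hμ' hμ (by omega)⟩

/-- The two tableaux of a matrix have the same shape, so λ = μ for a highest weight matrix; it
shares both tableaux with A_λ and equals it by injectivity. -/
theorem highestMatrices_eq (m n u v : ℕ) : highestMatrices m n u v =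
    {A | ∃ μ : YoungDiagram, IsHook m n μ ∧ IsHook u v μ ∧ A = matrixOf m n u v μ} := by
  ext A
  constructor
  · rintro ⟨μ, ν, hμ, hν, h1, h2⟩
    have h3 := A.colLens_P₁_eq
    rw [h1, h2, colLens_highestTableau, colLens_highestTableau] at h3
    obtain rfl := eq_of_colLen_eq h3
    refine ⟨μ, hμ, hν, A.injective_P _ ?_ ?_⟩
    · rw [h1, (matrixOf_P μ hμ hν).1]
    · rw [h2, (matrixOf_P μ hμ hν).2]
  · rintro ⟨μ, hμ, hν, rfl⟩
    exact ⟨μ, μ, hμ, hν, matrixOf_P μ hμ hν⟩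

end SuperKnuth

namespace SuperKnuth

/-! ### The super Cauchy identity -/

/-- The distributive law for a finite product of infinite sums, by adding one factor at a time. In a
nonarchimedean ring the product of two summable families is summable without further conditions. -/
theorem hasSum_prod_pi {R : Type*} [CommRing R] [UniformSpace R] [IsUniformAddGroup R]
    [NonarchimedeanRing R] {ι : Type} [Fintype ι] {κ : ι → Type} (f : ∀ p, κ p → R) (g : ι → R)
    (h : ∀ p, HasSum (f p) (g p)) :
    HasSum (fun a : ∀ p, κ p => ∏ p, f p (a p)) (∏ p, g p) := by
  classical
  let Q : ∀ (ι : Type) [Fintype ι], Prop := fun ι _ => ∀ (κ : ι → Type) (f : ∀ p, κ p → R)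
    (g : ι → R), (∀ p, HasSum (f p) (g p)) →
      HasSum (fun a : ∀ p, κ p => ∏ p, f p (a p)) (∏ p, g p)
  refine Fintype.induction_empty_option (P := Q) ?_ ?_ ?_ ι κ f g h
  · intro α β _ e ih κ f g h
    have := Fintype.ofEquiv β e.symm
    have h1 := ih (fun p => κ (e p)) (fun p => f (e p)) (fun p => g (e p)) fun p => h (e p)
    rw [← (Equiv.piCongrLeft κ e).hasSum_iff]
    convert h1 using 1
    · funext a
      simp only [Function.comp]
      rw [← e.prod_comp]
      refine Finset.prod_congr (by congr!) fun p _ => ?_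
      rw [Equiv.piCongrLeft_apply_apply]
    · rw [← e.prod_comp]
      exact Finset.prod_congr (by congr!) fun p _ => rfl
  · intro κ f g h
    simp only [Finset.univ_eq_empty, Finset.prod_empty]
    exact hasSum_unique _
  · intro α _ ih κ f g h
    have h1 := (h none).mul_of_nonarchimedean
      (ih (fun p => κ (some p)) (fun p => f (some p)) (fun p => g (some p)) fun p => h (some p))
    rw [← Equiv.piOptionEquivProd.hasSum_iff] at h1
    rw [Fintype.prod_option]
    convert h1 using 2 with a
    rw [Fintype.prod_option]
    rfl

open scoped MvPowerSeries.WithPiTopology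

theorem nonarchimedeanRing_mvPowerSeries (σ : Type*) :
    NonarchimedeanRing (MvPowerSeries σ ℤ) where
  is_nonarchimedean U hU := by
    obtain ⟨I, hI, hIU⟩ := (IsLinearTopology.hasBasis_open_ideal
      (R := MvPowerSeries σ ℤ)).mem_iff.1 hU
    exact ⟨⟨I.toAddSubgroup, hI⟩, hIU⟩

variable {m n u v : ℕ}

/-- The variable `x_b y_b'`. -/
noncomputable def varXY (m n u v : ℕ) (p : Letter m n × Letter u v) :
    MvPowerSeries (Letter m n ⊕ Letter u v) ℤ := varX m n u v p.1 * varY m n u v p.2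

/-- The exponents that are admitted at a position of a matrix. -/
abbrev Exponent (m n u v : ℕ) (p : Letter m n × Letter u v) : Type :=
  {k : ℕ // deg m n p.1 ≠ deg u v p.2 → k ≤ 1}

/-- The factor of the Cauchy product that belongs to a position. -/
noncomputable def cauchyFactor (m n u v : ℕ) (p : Letter m n × Letter u v) :
    MvPowerSeries (Letter m n ⊕ Letter u v) ℤ :=
  if deg m n p.1 = deg u v p.2 then ∑' k : ℕ, varXY m n u v p ^ k else 1 + varXY m n u v p

theorem constantCoeff_varXY (p : Letter m n × Letter u v) :
    (varXY m n u v p).constantCoeff = 0 := by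
  simp [varXY, varX]

theorem hasSum_cauchyFactor (p : Letter m n × Letter u v) :
    HasSum (fun k : Exponent m n u v p => varXY m n u v p ^ k.val) (cauchyFactor m n u v p) := by
  have h : HasSum ((fun k => varXY m n u v p ^ k) ∘ ((↑) : {k : ℕ |
      deg m n p.1 ≠ deg u v p.2 → k ≤ 1} → ℕ)) (cauchyFactor m n u v p) := by
    -- As a sum over all of ℕ, the series becomes a geometric one where the degrees agree and a sum
    -- of two terms where they differ.
    rw [hasSum_subtype_iff_indicator]
    unfold cauchyFactor
    split_ifs with hd
    · have : {k : ℕ | deg m n p.1 ≠ deg u v p.2 → k ≤ 1} = Set.univ := by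
        ext k
        simp [hd]
      rw [this, Set.indicator_univ]
      exact (MvPowerSeries.WithPiTopology.summable_pow_of_constantCoeff_eq_zero
        (constantCoeff_varXY p)).hasSum
    · have := hasSum_sum_of_ne_finset_zero
        (f := Set.indicator {k : ℕ | deg m n p.1 ≠ deg u v p.2 → k ≤ 1}
          fun k => varXY m n u v p ^ k) (s := Finset.range 2) (L := SummationFilter.unconditional ℕ)
        fun k hk => by
          rw [Finset.mem_range] at hk
          refine Set.indicator_of_notMem (fun hk' => ?_) _
          have := hk' hd
          omega
      convert this using 1
      rw [Finset.sum_range_succ, Finset.sum_range_one,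
        Set.indicator_of_mem (by simp : 0 ∈ {k : ℕ | deg m n p.1 ≠ deg u v p.2 → k ≤ 1}),
        Set.indicator_of_mem (by simp : 1 ∈ {k : ℕ | deg m n p.1 ≠ deg u v p.2 → k ≤ 1}),
        pow_zero, pow_one]
  exact h

/-- The product of the geometric series inverts the product of the 1 - x_b y_b', so the denominator
is cleared by multiplication. -/
theorem prod_cauchyFactor (m n u v : ℕ) :
    ∏ p, cauchyFactor m n u v p = cauchyProduct m n u v := by
  have h1 : ∏ p, cauchyFactor m n u v p =
      (∏ p : Letter m n × Letter u v with deg m n p.1 = deg u v p.2,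
        ∑' k : ℕ, varXY m n u v p ^ k) *
      ∏ p : Letter m n × Letter u v with deg m n p.1 ≠ deg u v p.2, (1 + varXY m n u v p) := by
    unfold cauchyFactor
    rw [Finset.prod_ite]
  have h2 : (∏ p : Letter m n × Letter u v with deg m n p.1 = deg u v p.2,
        ∑' k : ℕ, varXY m n u v p ^ k) *
      ∏ p : Letter m n × Letter u v with deg m n p.1 = deg u v p.2, (1 - varXY m n u v p) = 1 := by
    rw [← Finset.prod_mul_distrib]
    exact Finset.prod_eq_one fun p _ =>
      MvPowerSeries.WithPiTopology.tsum_pow_mul_one_sub_of_constantCoeff_eq_zero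
        (constantCoeff_varXY p)
  have h3 := cauchyProduct_mul m n u v
  have h4 : cauchyProduct m n u v = cauchyProduct m n u v *
      ((∏ p : Letter m n × Letter u v with deg m n p.1 = deg u v p.2,
        ∑' k : ℕ, varXY m n u v p ^ k) *
      ∏ p : Letter m n × Letter u v with deg m n p.1 = deg u v p.2, (1 - varXY m n u v p)) := by
    rw [h2, mul_one]
  rw [h1, h4, mul_left_comm]
  congr 1
  exact h3.symm

/-- A matrix as a family of exponents. -/
def SuperMatrix.equivExponent (m n u v : ℕ) :
    SuperMatrix m n u v ≃ ∀ p, Exponent m n u v p where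
  toFun A p := ⟨A.entry p.1 p.2, A.le_one p.1 p.2⟩
  invFun a := ⟨fun b b' => a (b, b'), fun b b' => (a (b, b')).2⟩
  left_inv _ := rfl
  right_inv _ := rfl

theorem hasSum_matrix (m n u v : ℕ) :
    HasSum (fun A : SuperMatrix m n u v => ∏ p : Letter m n × Letter u v,
      varXY m n u v p ^ A.entry p.1 p.2) (cauchyProduct m n u v) := by
  have := nonarchimedeanRing_mvPowerSeries (Letter m n ⊕ Letter u v)
  have h := hasSum_prod_pi (fun p (k : Exponent m n u v p) => varXY m n u v p ^ k.val)
    (cauchyFactor m n u v) hasSum_cauchyFactor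
  rw [prod_cauchyFactor, ← (SuperMatrix.equivExponent m n u v).hasSum_iff] at h
  exact h

theorem SuperMatrix.count_tabWord_P₁ (A : SuperMatrix m n u v) (b : Letter m n) :
    (tabWord A.P₁).count b = ∑ b', A.entry b b' := by
  rw [P₁, count_tabWord_P, wordPair_fst, List.count_flatMap, Fin.sum_univ_def]
  congr 2
  funext j
  exact A.count_block j b

/-- Insertion preserves content, so the row sums of A give the weight of P₁ and the column sums that
of P₂. -/
theorem SuperMatrix.prod_varXY (A : SuperMatrix m n u v) :
    ∏ p : Letter m n × Letter u v, varXY m n u v p ^ A.entry p.1 p.2 =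
      (∏ b, varX m n u v b ^ A.pair.2.1.word.count b) *
        ∏ b', varY m n u v b' ^ A.pair.2.2.word.count b' := by
  have h1 : ∀ b, A.pair.2.1.word.count b = ∑ b', A.entry b b' := fun b => by
    rw [← count_tabWord_P₁, ← pair_fst]
    rfl
  have h2 : ∀ b', A.pair.2.2.word.count b' = ∑ b, A.entry b b' := fun b' => by
    have := A.transpose.count_tabWord_P₁ b'
    have e : A.transpose.P₁ = A.pair.2.2.columns := A.pair_snd.symm
    rw [e] at this
    exact this
  simp only [h1, h2, varXY, mul_pow, Finset.prod_mul_distrib, Fintype.prod_prod_type,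
    Finset.prod_pow_eq_pow_sum]
  congr 1
  rw [Finset.prod_comm]
  simp only [Finset.prod_pow_eq_pow_sum]

/-- The sum over matrices is carried to pairs of tableaux by π and then grouped by shape; each group
is finite and factors into two hook Schur functions. -/
theorem hasSum_hookSchur (m n u v : ℕ) :
    HasSum
      (fun μ : CommonHook m n u v =>
        hookSchur m n μ.1 (varX m n u v) * hookSchur u v μ.1 (varY m n u v))
      (cauchyProduct m n u v) := by
  have h : HasSum (fun p : TableauPairs m n u v =>
      (∏ b, varX m n u v b ^ p.2.1.word.count b) * ∏ b', varY m n u v b' ^ p.2.2.word.count b')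
      (cauchyProduct m n u v) := by
    rw [← (Equiv.ofBijective _ (SuperMatrix.pair_bijective (m := m) (n := n) (u := u)
      (v := v))).hasSum_iff]
    convert hasSum_matrix m n u v using 2 with A
    exact A.prod_varXY.symm
  refine h.sigma fun μ => ?_
  have hf := hasSum_fintype (fun q : Tableau m n μ.1 × Tableau u v μ.1 =>
    (∏ b, varX m n u v b ^ q.1.word.count b) * ∏ b', varY m n u v b' ^ q.2.word.count b')
  convert hf using 1
  rw [hookSchur, hookSchur, Finset.sum_mul_sum, Fintype.sum_prod_type]

end SuperKnuth

/-! ### The theorem -/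

open SuperKnuth in
open scoped MvPowerSeries.WithPiTopology in
theorem theorem3p7 (m n u v : ℕ) (hmn : 0 < m + n) (huv : 0 < u + v) :
    -- the sets in question are stable under the Kashiwara operators of words
    (∀ μ, IsHook m n μ → IsStableEmbedding (words m n) (Tableau.word (m := m) (n := n) (μ := μ))) ∧
    (∀ μ, IsHook u v μ → IsStableEmbedding (words u v) (Tableau.word (m := u) (n := v) (μ := μ))) ∧
    IsStableEmbedding ((words m n).onFst (List (Letter u v)))
      (SuperMatrix.wordPair (m := m) (n := n) (u := u) (v := v)) ∧
    IsStableEmbedding ((words u v).onFst (List (Letter m n)))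
      (SuperMatrix.wordPairStar (m := m) (n := n) (u := u) (v := v)) ∧
    -- both sides are bicrystals
    IsBicrystal (matrixBicrystal m n u v) ∧
    IsBicrystal (tableauPairsBicrystal m n u v) ∧
    -- the highest weight elements
    highestMatrices m n u v =
      {A | ∃ μ : YoungDiagram, IsHook m n μ ∧ IsHook u v μ ∧ A = matrixOf m n u v μ} ∧
    -- the isomorphism `π = (P_1, P_2)`
    (∃ π : SuperMatrix m n u v → TableauPairs m n u v,
      (∀ A, (π A).2.1.columns = A.P₁ ∧ (π A).2.2.columns = A.P₂) ∧
      IsBicrystalIso (matrixBicrystal m n u v) (tableauPairsBicrystal m n u v) π) ∧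
    -- the super Cauchy identity, for formal power series in the `x_b` and the `y_b'`
    HasSum
      (fun μ : CommonHook m n u v =>
        hookSchur m n μ.1 (varX m n u v) * hookSchur u v μ.1 (varY m n u v))
      (cauchyProduct m n u v) := by
  refine ⟨fun μ _ => isStableEmbedding_tableau μ, fun μ _ => isStableEmbedding_tableau μ,
    isStableEmbedding_wordPair, isStableEmbedding_wordPairStar, isBicrystal_matrix,
    isBicrystal_tableauPairs m n u v, highestMatrices_eq m n u v,
    ⟨SuperMatrix.pair, fun A => ⟨A.pair_fst, A.pair_snd⟩, SuperMatrix.isBicrystalIso_pair⟩,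
    hasSum_hookSchur m n u v⟩
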